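/- **Definitions.** For a finite alphabet $\Sigma$, a relation $R\subseteq(\Sigma^\omega)^k$ is recognised by a ($k$-tape synchronous, nondeterministic) Büchi automaton over the alphabet $\Sigma^k$ if the automaton accepts exactly the convolutions $\otimes(w_1,\dots,w_k)$, $\otimes(w_1,\dots,w_k)[i]=(w_1[i],\dots,w_k[i])$, of the tuples in $R$. An *$\omega$-automatic presentation* of a relational structure $\mathfrak A=(A,(R_i)_i)$ consists of Büchi automata $\mathfrak d=(\mathcal A,\mathcal A_\approx,(\mathcal A_i)_i)$ over a finite alphabet $\Sigma$ and a surjection $f:L(\mathcal A)\to A$ with $L(\mathcal A)\subseteq\Sigma^\omega$, not necessarily injective, such that $\mathcal A_\approx$ recognises $\{(u,w)\in L(\mathcal A)^2: f(u)=f(w)\}$ and each $\mathcal A_i$ recognises $f^{-1}(R_i)\subseteq L(\mathcal A)^{\mathrm{ar}(R_i)}$. It is *automatic* if, for some padding symbol $\Box\in\Sigma$, every word of $L(\mathcal A)$ has the form $w\Box^\omega$ with $w\in(\Sigma\setminus\{\Box\})^*$. A structure is ($\omega$-)automatic if it has an ($\omega$-)automatic presentation. $\mathsf{FOC}$ is first-order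 logic with equality extended by the quantifiers $\exists^{(r\bmod m)}x$ ($m\ge 1$; the number of $x$ is finite and congruent to $r$ modulo $m$), $\exists^{\infty}x$ (there are infinitely many $x$), $\exists^{\le\aleph_0}x$ and $\exists^{>\aleph_0}x$ (the set of all such $x$ is countable, i.e. finite or countably infinite, respectively uncountable). **Theorem 2.** (i) There is an algorithm that, given (the automata $\mathfrak d$ of) an $\omega$-automatic presentation $(\mathfrak d,f)$ of a structure $\mathfrak A$ over a finite signature, an $\mathsf{FOC}$-formula $\varphi(y_1,\dots,y_p,x_1,\dots,x_k)$ with $p,k\ge 0$, and parameters $a_1,\dots,a_p\in A$, each given by an ultimately periodic name $u_jv_j^\omega\in L(\mathcal A)$ with $f(u_jv_j^\omega)=a_j$ (as a pair of finite words $u_j,v_j$, $v_j\neq\varepsilon$), constructs a $k$-tape Büchi automaton that recognises $f^{-1}(R)=\{(w_1,\dots,w_k)\in L(\mathcal A)^k:\ \mathfrak A\models\varphi(a_1,\dots,a_p,f(w_1),\dots,f(w_k))\}$, where $R$ is the $k$-ary relation that $\varphi(\vec a,\vec x)$ defines in $\mathfrak A$. (ii) The $\mathsf{FOC}$-theory (the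 set of true $\mathsf{FOC}$-sentences) of every $\omega$-automatic structure over a finite signature is decidable. (iii) The class of $\omega$-automatic structures and the class of automatic structures are closed under (multi-dimensional, parameter-free) $\mathsf{FOC}$-interpretations: if $\mathfrak B$ is isomorphic to the quotient by $\varepsilon$ of the structure defined on $\{\vec x\in A^d:\mathfrak A\models\delta(\vec x)\}$ by formulas $\varphi_S$, one for each relation symbol $S$ of $\mathfrak B$, where $\delta,\varepsilon,\varphi_S$ are $\mathsf{FOC}$-formulas, and $\mathfrak A$ is ($\omega$-)automatic, then so is $\mathfrak B$. -/

import Mathlib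

/-- The type of infinite words over the alphabet `{0, …, s - 1}`. -/
abbrev OmegaWord (s : ℕ) : Type := ℕ → Fin s

/-- A (finite, nondeterministic) multi-tape synchronous Büchi automaton, given as finite data:
a list of transitions `(p, a, q)`, where the letter `a` is a tuple of symbols (one for each tape),
a list of initial states and a list of accepting states.  States and symbols are natural numbers;
only the finitely many states that occur in the lists matter. -/
structure BuchiAutomaton where
  trans : List (ℕ × List ℕ × ℕ)
  init : List ℕ
  acc : List ℕ

namespace BuchiAutomaton

/-- An automaton as a tuple of lists. -/
def equivProd : BuchiAutomaton ≃ List (ℕ × List ℕ × ℕ) × List ℕ × List ℕ where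
  toFun M := (M.trans, M.init, M.acc)
  invFun t := ⟨t.1, t.2.1, t.2.2⟩
  left_inv _ := rfl
  right_inv _ := rfl

instance : Primcodable BuchiAutomaton := Primcodable.ofEquiv _ equivProd

/-- `M.Accepts w`: the automaton accepts the convolution of the `k` infinite words `w`, i.e. it has
an infinite run on it that starts in an initial state and visits accepting states infinitely
often. -/
def Accepts (M : BuchiAutomaton) {k s : ℕ} (w : Fin k → OmegaWord s) : Prop :=
  ∃ ρ : ℕ → ℕ, ρ 0 ∈ M.init ∧
    (∀ i, (ρ i, List.ofFn (fun j => (w j i : ℕ)), ρ (i + 1)) ∈ M.trans) ∧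
    ∀ N, ∃ i, N ≤ i ∧ ρ i ∈ M.acc

end BuchiAutomaton

/-- The ultimately periodic word `u v v v …` (for nonempty `v`). -/
def upWord {s : ℕ} (u v : List (Fin s)) (hv : v ≠ []) : OmegaWord s := fun i =>
  if h : i < u.length then u[i]
  else v[(i - u.length) % v.length]'(Nat.mod_lt _ (List.length_pos_of_ne_nil hv))

/-- The relations of a relational structure with universe `A`; the signature consists of the
symbols in `ι`, the symbol `i` having arity `ar i`. -/
abbrev RelStructure {ι : Type*} (ar : ι → ℕ) (A : Type*) := ∀ i, (Fin (ar i) → A) → Prop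

/-- Formulas of FOC over a relational signature with free variables among `x_0, …, x_{n-1}`.
Quantifiers bind the variable `x_n`. -/
inductive FOC {ι : Type*} (ar : ι → ℕ) : ℕ → Type _
  | falsum {n : ℕ} : FOC ar n
  | equal {n : ℕ} (i j : Fin n) : FOC ar n
  | rel {n : ℕ} (i : ι) (t : Fin (ar i) → Fin n) : FOC ar n
  | imp {n : ℕ} (φ ψ : FOC ar n) : FOC ar n
  | all {n : ℕ} (φ : FOC ar (n + 1)) : FOC ar n
  | exMod {n : ℕ} (r m : ℕ) (hm : 0 < m) (φ : FOC ar (n + 1)) : FOC ar n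
  | exInf {n : ℕ} (φ : FOC ar (n + 1)) : FOC ar n
  | exCountable {n : ℕ} (φ : FOC ar (n + 1)) : FOC ar n
  | exUncountable {n : ℕ} (φ : FOC ar (n + 1)) : FOC ar n

namespace FOC

/-- Satisfaction of a formula under an assignment of the free variables. -/
def Realize {ι A : Type*} {ar : ι → ℕ} (R : RelStructure ar A) :
    ∀ {n : ℕ}, FOC ar n → (Fin n → A) → Prop
  | _, falsum, _ => False
  | _, equal i j, v => v i = v j
  | _, rel i t, v => R i (fun j => v (t j))
  | _, imp φ ψ, v => φ.Realize R v → ψ.Realize R v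
  | n, all φ, v => ∀ a : A, φ.Realize R (Fin.snoc v a : Fin (n + 1) → A)
  | n, exMod r m _ φ, v =>
      {a : A | φ.Realize R (Fin.snoc v a : Fin (n + 1) → A)}.Finite ∧
        {a : A | φ.Realize R (Fin.snoc v a : Fin (n + 1) → A)}.ncard ≡ r [MOD m]
  | n, exInf φ, v => {a : A | φ.Realize R (Fin.snoc v a : Fin (n + 1) → A)}.Infinite
  | n, exCountable φ, v => {a : A | φ.Realize R (Fin.snoc v a : Fin (n + 1) → A)}.Countable
  | n, exUncountable φ, v => ¬ {a : A | φ.Realize R (Fin.snoc v a : Fin (n + 1) → A)}.Countable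

/-- The Gödel number of a formula over a finite signature. -/
def code {r : ℕ} {ar : Fin r → ℕ} : ∀ {n : ℕ}, FOC ar n → ℕ
  | _, falsum => Nat.pair 0 0 + 1
  | _, equal i j => Nat.pair 1 (Nat.pair i j) + 1
  | _, rel i t => Nat.pair 2 (Nat.pair i (Encodable.encode (List.ofFn fun j => (t j : ℕ)))) + 1
  | _, imp φ ψ => Nat.pair 3 (Nat.pair φ.code ψ.code) + 1
  | _, all φ => Nat.pair 4 φ.code + 1
  | _, exMod r m _ φ => Nat.pair 5 (Nat.pair r (Nat.pair m φ.code)) + 1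
  | _, exInf φ => Nat.pair 6 φ.code + 1
  | _, exCountable φ => Nat.pair 7 φ.code + 1
  | _, exUncountable φ => Nat.pair 8 φ.code + 1

end FOC

/-- The automata of an ω-automatic presentation: an alphabet `{0, …, alphabet - 1}`, an automaton
for the set of names, one for the equality of the named elements and one for each relation. -/
structure OmegaPresentation (ι : Type*) where
  alphabet : ℕ
  dom : BuchiAutomaton
  eqv : BuchiAutomaton
  rel : ι → BuchiAutomaton

namespace OmegaPresentation

/-- The set of names, i.e. the language of the domain automaton. -/
abbrev Dom {ι : Type*} (d : OmegaPresentation ι) : Type :=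
  {w : OmegaWord d.alphabet // d.dom.Accepts ![w]}

/-- `d` together with the surjective naming function `f` is an ω-automatic presentation (not
necessarily injective) of the structure with relations `R`: the automaton `d.eqv` recognises
`{(u, w) | f u = f w}` and `d.rel i` recognises the preimage of the relation `R i`. -/
structure Presents {ι A : Type*} {ar : ι → ℕ} (d : OmegaPresentation ι) (R : RelStructure ar A)
    (f : d.Dom → A) : Prop where
  surjective : Function.Surjective f
  eqv_iff : ∀ u w : OmegaWord d.alphabet, d.eqv.Accepts ![u, w] ↔
    ∃ (hu : d.dom.Accepts ![u]) (hw : d.dom.Accepts ![w]), f ⟨u, hu⟩ = f ⟨w, hw⟩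
  rel_iff : ∀ (i : ι) (w : Fin (ar i) → OmegaWord d.alphabet), (d.rel i).Accepts w ↔
    ∃ h : ∀ j, d.dom.Accepts ![w j], R i (fun j => f ⟨w j, h j⟩)

/-- The presentation is one over finite words: there is a padding symbol `□` such that every name
has the form `x □ □ □ …` with `x` a finite word in which `□` does not occur. -/
def IsFiniteWord {ι : Type*} (d : OmegaPresentation ι) : Prop :=
  ∃ pad : Fin d.alphabet, ∀ w : d.Dom,
    ∃ n : ℕ, (∀ i < n, w.1 i ≠ pad) ∧ ∀ i, n ≤ i → w.1 i = pad

/-- A presentation over a finite signature as input for an algorithm. -/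
def data {r : ℕ} (d : OmegaPresentation (Fin r)) :
    ℕ × BuchiAutomaton × BuchiAutomaton × List BuchiAutomaton :=
  (d.alphabet, d.dom, d.eqv, List.ofFn d.rel)

end OmegaPresentation

/-- The structure is ω-automatic. -/
def IsOmegaAutomatic {ι A : Type*} {ar : ι → ℕ} (R : RelStructure ar A) : Prop :=
  ∃ (d : OmegaPresentation ι) (f : d.Dom → A), d.Presents R f

/-- The structure is automatic, i.e. it has a presentation over finite words. -/
def IsAutomatic {ι A : Type*} {ar : ι → ℕ} (R : RelStructure ar A) : Prop :=
  ∃ (d : OmegaPresentation ι) (f : d.Dom → A), d.Presents R f ∧ d.IsFiniteWord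

/-- A (multi-dimensional) FOC-interpretation: the formulas `δ(x)`, `ε(x, y)` and, for each symbol
`i` of arity `br i` of the target signature, `φ_i(x_1, …, x_{br i})`, where `x`, `y` and all `x_j`
are tuples of `dim` variables. -/
structure FOCInterpretation {ι κ : Type*} (ar : ι → ℕ) (br : κ → ℕ) where
  dim : ℕ
  dom : FOC ar dim
  eqv : FOC ar (dim + dim)
  rel : ∀ i, FOC ar (br i * dim)

/-- `I.Interprets R S`: the structure with relations `S` is, up to isomorphism, the quotient by `ε`
of the structure that `I` defines on `{x | δ(x)}` in the structure with relations `R`; the map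
`g` is the coordinate map. -/
def FOCInterpretation.Interprets {ι κ A B : Type*} {ar : ι → ℕ} {br : κ → ℕ}
    (I : FOCInterpretation ar br) (R : RelStructure ar A) (S : RelStructure br B) : Prop :=
  ∃ g : {x : Fin I.dim → A // I.dom.Realize R x} → B,
    Function.Surjective g ∧
    (∀ x y, I.eqv.Realize R (Fin.append x.1 y.1) ↔ g x = g y) ∧
    ∀ (i : κ) (x : Fin (br i) → {x : Fin I.dim → A // I.dom.Realize R x}),
      (I.rel i).Realize R (fun j => (x j.divNat).1 j.modNat) ↔ S i (fun j => g (x j))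

/-! The proof separates regularity from effectivity.

Regularity. A relation on infinite words is treated as ω-regular when a finite multiplicative
colouring of finite words saturates it (`Sat`): the colours of the blocks of any factorization
decide whether the relation holds. Boolean operations are then immediate, projection is a power-set
colouring, and counting modulo `m` is a colouring by numbers of decorations (`Sat.ncard_modEq`).
Automata give saturated relations (`sat_at`), and by Ramsey's theorem saturated relations have
automata (`Sat.exists_automaton`). None of this is algorithmic.

Effectivity. That an automaton recognizes `¬ (M₁ ∧ M₂)` is witnessed by a finite set of transition
profiles (`NandCheck`), so it is a Σ₁ property. Since such an automaton exists, an unbounded search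
finds one. `ER` packages "recognized by automata that are specified by a Σ₁ predicate"; it is closed
under Boolean operations and projection, so whatever is first-order definable over words from
automata is effectively regular.

Cardinality quantifiers are reduced to such definitions. Given a set of words closed under an
equivalence relation, either there is a `Pattern`, i.e. two words whose blockwise mixtures stay in
the set and are inequivalent for nested sets of blocks with infinite difference, or boundedly many
words represent all classes up to finite changes (`exists_bound`). A pattern embeds the reals
through Dedekind cuts. Without it there are countably many classes, and they are infinitely many iff
they accumulate near a single word (`InfNear`). Hence "uncountable" is `Pattern` and "infinite" is
`Pattern ∨ InfNear`.

For counting modulo `m`, a finite set of classes has a regular transversal `U t`, where the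
parameter word `t` codes the bounded number of representatives, and regular predicates `G r t` that
count lexicographically smaller elements of the transversal modulo `m` (`exists_certificate`). Their
correctness is expressed without counting, by recursion along the lexicographic order, so suitable
automata can be searched for and verified.

For (i) these steps are combined along the Gödel number of the formula (`exists_derivation`), and
parameters are fixed by a product with lassos. For (ii) the theory and its complement are both Σ₁.
For (iii) an element of the interpreted structure is named by the convolution of a tuple of names.
-/

/-- A predicate is `Sig1` if it has the form `∃ k, q a k` with a primitive recursive relation `q`. -/
def Sig1 {α : Type*} [Primcodable α] (p : α → Prop) : Prop :=
  ∃ q : α → ℕ → Prop, PrimrecRel q ∧ ∀ a, p a ↔ ∃ k, q a k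

/-! ### Closure properties of Σ₁ predicates, and uniformization by search. -/

namespace Sig1

variable {α β γ : Type*} [Primcodable α] [Primcodable β] [Primcodable γ]

theorem of_eq {p q : α → Prop} (hp : Sig1 p) (h : ∀ a, p a ↔ q a) : Sig1 q := by
  obtain ⟨r, hr, e⟩ := hp
  exact ⟨r, hr, fun a => (h a).symm.trans (e a)⟩

theorem of_primrecPred {p : α → Prop} (hp : PrimrecPred p) : Sig1 p :=
  ⟨fun a _ => p a, hp.comp Primrec.fst, fun _ => by simp⟩

theorem comp {p : β → Prop} {f : α → β} (hp : Sig1 p) (hf : Primrec f) :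
    Sig1 fun a => p (f a) := by
  obtain ⟨r, hr, e⟩ := hp
  exact ⟨fun a k => r (f a) k, hr.comp (hf.comp Primrec.fst) Primrec.snd, fun a => e (f a)⟩

theorem and {p q : α → Prop} (hp : Sig1 p) (hq : Sig1 q) : Sig1 fun a => p a ∧ q a := by
  obtain ⟨r, hr, e⟩ := hp
  obtain ⟨r', hr', e'⟩ := hq
  refine ⟨fun a k => r a k.unpair.1 ∧ r' a k.unpair.2,
    (hr.comp Primrec.fst (Primrec.fst.comp (Primrec.unpair.comp Primrec.snd))).and
      (hr'.comp Primrec.fst (Primrec.snd.comp (Primrec.unpair.comp Primrec.snd))), fun a => ?_⟩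
  beta_reduce
  rw [e, e']
  constructor
  · rintro ⟨⟨i, hi⟩, j, hj⟩
    exact ⟨Nat.pair i j, by simpa using ⟨hi, hj⟩⟩
  · rintro ⟨k, h1, h2⟩
    exact ⟨⟨_, h1⟩, _, h2⟩

theorem or {p q : α → Prop} (hp : Sig1 p) (hq : Sig1 q) : Sig1 fun a => p a ∨ q a := by
  obtain ⟨r, hr, e⟩ := hp
  obtain ⟨r', hr', e'⟩ := hq
  refine ⟨fun a k => r a k ∨ r' a k, PrimrecPred.or hr hr', fun a => ?_⟩
  beta_reduce
  rw [e, e', exists_or]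

/-- The new witness is a pair of a code of `b` and a witness for `p a b`. Decoding is partial, but a
quantifier over the decoded option, seen as a list, is bounded and hence primitive recursive. -/
theorem ex {p : α → β → Prop} (hp : Sig1 fun x : α × β => p x.1 x.2) :
    Sig1 fun a => ∃ b, p a b := by
  obtain ⟨r, hr, e⟩ := hp
  have h1 : PrimrecRel fun (b : β) (x : α × ℕ) => r (x.1, b) x.2 :=
    hr.comp ((Primrec.fst.comp Primrec.snd).pair Primrec.fst) (Primrec.snd.comp Primrec.snd)
  have h2 := h1.exists_mem_list
  refine ⟨fun a k => ∃ b ∈ (Encodable.decode (α := β) k.unpair.1).toList, r (a, b) k.unpair.2,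
    ?_, fun a => ?_⟩
  · exact h2.comp (Primrec.optionToList.comp (Primrec.decode.comp (Primrec.fst.comp
      (Primrec.unpair.comp Primrec.snd)))) (Primrec.fst.pair (Primrec.snd.comp
      (Primrec.unpair.comp Primrec.snd)))
  · constructor
    · rintro ⟨b, hb⟩
      obtain ⟨k, hk⟩ := (e (a, b)).1 hb
      exact ⟨Nat.pair (Encodable.encode b) k, b, by simp, by simpa using hk⟩
    · rintro ⟨k, b, -, hb⟩
      exact ⟨b, (e (a, b)).2 ⟨_, hb⟩⟩

/-- Collection: the finitely many witnesses have a common strict bound, and this bound is the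
witness for the whole statement. -/
theorem forall_mem_list {p : α → β → Prop} {f : α → List β}
    (hp : Sig1 fun x : α × β => p x.1 x.2) (hf : Primrec f) :
    Sig1 fun a => ∀ b ∈ f a, p a b := by
  obtain ⟨r, hr, e⟩ := hp
  have h1 : PrimrecRel fun (k : ℕ) (x : α × β) => r x k := PrimrecRel.swap hr
  have h2 : PrimrecRel fun (b : β) (x : ℕ × α) => ∃ k < x.1, r (x.2, b) k :=
    PrimrecPred.of_eq (h1.exists_mem_list.comp
      (Primrec.list_range.comp (Primrec.fst.comp Primrec.snd))
      ((Primrec.snd.comp Primrec.snd).pair Primrec.fst)) fun x => by simp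
  refine ⟨fun a K => ∀ b ∈ f a, ∃ k < K, r (a, b) k,
    h2.forall_mem_list.comp (hf.comp Primrec.fst) (Primrec.snd.pair Primrec.fst), fun a => ?_⟩
  constructor
  · intro h
    have h' : ∀ b ∈ f a, ∃ k, r (a, b) k := fun b hb => (e (a, b)).1 (h b hb)
    clear h
    beta_reduce
    generalize f a = l at h'
    induction l with
    | nil => exact ⟨0, by simp⟩
    | cons c l ih =>
      simp only [List.mem_cons, forall_eq_or_imp] at h' ⊢
      obtain ⟨K, hK⟩ := ih h'.2
      obtain ⟨k, hk⟩ := h'.1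
      refine ⟨max (k + 1) K, ⟨k, by omega, hk⟩, fun b hb => ?_⟩
      obtain ⟨k', h1, h2⟩ := hK b hb
      exact ⟨k', by omega, h2⟩
  · rintro ⟨K, hK⟩ b hb
    obtain ⟨k, -, hk⟩ := hK b hb
    exact (e (a, b)).2 ⟨k, hk⟩

theorem forall_lt {p : α → ℕ → Prop} {f : α → ℕ}
    (hp : Sig1 fun x : α × ℕ => p x.1 x.2) (hf : Primrec f) :
    Sig1 fun a => ∀ i < f a, p a i :=
  (hp.forall_mem_list (Primrec.list_range.comp hf)).of_eq fun a => by simp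

/-- A `Sig1` relation can be uniformized by a partial recursive function. -/
theorem exists_partrec {p : α × β → Prop} (hp : Sig1 p) :
    ∃ F : α →. β, Partrec F ∧ (∀ a, ∀ b ∈ F a, p (a, b)) ∧
      ∀ a, (∃ b, p (a, b)) → ∃ b, b ∈ F a := by
  classical
  obtain ⟨r, hr, e⟩ := hp
  -- The number `k` codes a candidate `b` together with a possible witness for it; the search
  -- returns the candidate of the least successful `k`.
  let g : α → ℕ → Option β := fun a k =>
    (Encodable.decode (α := β) k.unpair.1).bind fun b =>
      if r (a, b) k.unpair.2 then some b else none
  have hg : Primrec₂ g := by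
    refine Primrec.option_bind (Primrec.decode.comp (Primrec.fst.comp
      (Primrec.unpair.comp Primrec.snd))) ?_
    refine Primrec.ite ?_ (Primrec.option_some.comp Primrec.snd) (Primrec.const none)
    exact hr.comp ((Primrec.fst.comp Primrec.fst).pair Primrec.snd)
      (Primrec.snd.comp (Primrec.unpair.comp (Primrec.snd.comp Primrec.fst)))
  refine ⟨fun a => Nat.rfindOpt (g a), Partrec.rfindOpt hg.to_comp, fun a b hb => ?_, ?_⟩
  · obtain ⟨k, hk⟩ := Nat.rfindOpt_spec hb
    simp only [g, Option.mem_def, Option.bind_eq_some_iff] at hk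
    obtain ⟨c, -, hc⟩ := hk
    split_ifs at hc with h
    · cases hc
      exact (e (a, b)).2 ⟨_, h⟩
  · rintro a ⟨b, hb⟩
    obtain ⟨k, hk⟩ := (e (a, b)).1 hb
    have : (Nat.rfindOpt (g a)).Dom := by
      rw [Nat.rfindOpt_dom]
      exact ⟨Nat.pair (Encodable.encode b) k, b, by simp [g, hk]⟩
    exact ⟨_, Part.get_mem this⟩

theorem rePred {p : α → Prop} (hp : Sig1 p) : REPred p := by
  have h : Sig1 fun x : α × Unit => p x.1 := hp.comp Primrec.fst
  obtain ⟨F, hF, h1, h2⟩ := h.exists_partrec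
  refine hF.dom_re.of_eq fun a => ?_
  rw [Part.dom_iff_mem]
  exact ⟨fun ⟨b, hb⟩ => h1 a b hb, fun ha => h2 a ⟨(), ha⟩⟩

end Sig1

/-! ### Closure of primitive recursive predicates and functions under explicit definitions. -/

theorem PrimrecPred.imp {α : Type*} [Primcodable α] {p q : α → Prop} (hp : PrimrecPred p)
    (hq : PrimrecPred q) : PrimrecPred fun a => p a → q a :=
  (hp.not.or hq).of_eq fun _ => imp_iff_not_or.symm

theorem PrimrecPred.iff {α : Type*} [Primcodable α] {p q : α → Prop} (hp : PrimrecPred p)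
    (hq : PrimrecPred q) : PrimrecPred fun a => (p a ↔ q a) :=
  ((hp.imp hq).and (hq.imp hp)).of_eq fun _ => iff_iff_implies_and_implies.symm

theorem PrimrecPred.exists_mem {α β : Type*} [Primcodable α] [Primcodable β] {p : α → β → Prop}
    {f : α → List β} (hp : PrimrecPred fun x : α × β => p x.1 x.2) (hf : Primrec f) :
    PrimrecPred fun a => ∃ b ∈ f a, p a b := by
  have h1 : PrimrecRel fun (b : β) (a : α) => p a b := hp.comp (Primrec.snd.pair Primrec.fst)
  exact h1.exists_mem_list.comp hf Primrec.id

theorem PrimrecPred.forall_mem {α β : Type*} [Primcodable α] [Primcodable β] {p : α → β → Prop}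
    {f : α → List β} (hp : PrimrecPred fun x : α × β => p x.1 x.2) (hf : Primrec f) :
    PrimrecPred fun a => ∀ b ∈ f a, p a b := by
  have h1 : PrimrecRel fun (b : β) (a : α) => p a b := hp.comp (Primrec.snd.pair Primrec.fst)
  exact h1.forall_mem_list.comp hf Primrec.id

section compositional

variable {α β γ : Type*} [Primcodable α] [Primcodable β] [Primcodable γ]

namespace Primrec

theorem fst_apply {f : α → β × γ} (hf : Primrec f) : Primrec fun a => (f a).1 := Primrec.fst.comp hf

theorem snd_apply {f : α → β × γ} (hf : Primrec f) : Primrec fun a => (f a).2 := Primrec.snd.comp hf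

theorem getD_apply {f : α → List β} {g : α → ℕ} (hf : Primrec f) (hg : Primrec g) (d : β) :
    Primrec fun a => (f a).getD (g a) d := (Primrec.list_getD d).comp hf hg

theorem range_apply {f : α → ℕ} (hf : Primrec f) : Primrec fun a => List.range (f a) :=
  Primrec.list_range.comp hf

theorem map_apply {f : α → List β} {g : α → β → γ} (hf : Primrec f)
    (hg : Primrec fun x : α × β => g x.1 x.2) : Primrec fun a => (f a).map (g a) :=
  Primrec.list_map hf hg

theorem flatMap_apply {f : α → List β} {g : α → β → List γ} (hf : Primrec f)
    (hg : Primrec fun x : α × β => g x.1 x.2) : Primrec fun a => (f a).flatMap (g a) :=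
  Primrec.list_flatMap hf hg

theorem append_apply {f g : α → List β} (hf : Primrec f) (hg : Primrec g) :
    Primrec fun a => f a ++ g a := Primrec.list_append.comp hf hg

theorem cons_apply {f : α → β} {g : α → List β} (hf : Primrec f) (hg : Primrec g) :
    Primrec fun a => f a :: g a := Primrec.list_cons.comp hf hg

theorem length_apply {f : α → List β} (hf : Primrec f) : Primrec fun a => (f a).length :=
  Primrec.list_length.comp hf

theorem or_apply {f g : α → Bool} (hf : Primrec f) (hg : Primrec g) :
    Primrec fun a => f a || g a := Primrec.or.comp hf hg

theorem add_apply {f g : α → ℕ} (hf : Primrec f) (hg : Primrec g) :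
    Primrec fun a => f a + g a := Primrec.nat_add.comp hf hg

theorem sub_apply {f g : α → ℕ} (hf : Primrec f) (hg : Primrec g) :
    Primrec fun a => f a - g a := Primrec.nat_sub.comp hf hg

theorem mod_apply {f g : α → ℕ} (hf : Primrec f) (hg : Primrec g) :
    Primrec fun a => f a % g a := Primrec.nat_mod.comp hf hg

theorem natPair_apply {f g : α → ℕ} (hf : Primrec f) (hg : Primrec g) :
    Primrec fun a => Nat.pair (f a) (g a) := Primrec₂.natPair.comp hf hg

theorem encode_apply {f : α → β} (hf : Primrec f) :
    Primrec fun a => Encodable.encode (f a) := Primrec.encode.comp hf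

end Primrec

namespace PrimrecPred

theorem eq {f g : α → β} (hf : Primrec f) (hg : Primrec g) : PrimrecPred fun a => f a = g a :=
  Primrec.eq.comp hf hg

theorem lt {f g : α → ℕ} (hf : Primrec f) (hg : Primrec g) : PrimrecPred fun a => f a < g a :=
  Primrec.nat_lt.comp hf hg

theorem le {f g : α → ℕ} (hf : Primrec f) (hg : Primrec g) : PrimrecPred fun a => f a ≤ g a :=
  Primrec.nat_le.comp hf hg

theorem mem {f : α → β} {g : α → List β} (hf : Primrec f) (hg : Primrec g) :
    PrimrecPred fun a => f a ∈ g a :=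
  (PrimrecPred.exists_mem (p := fun a b => b = f a)
    (eq Primrec.snd (hf.comp Primrec.fst)) hg).of_eq fun a => by simp

end PrimrecPred

end compositional

attribute [fun_prop] Primrec PrimrecPred Sig1
attribute [fun_prop] Primrec.id Primrec.const Primrec.comp Primrec.fst Primrec.snd Primrec.pair
  Primrec.fst_apply Primrec.snd_apply Primrec.getD_apply Primrec.range_apply Primrec.map_apply
  Primrec.flatMap_apply Primrec.append_apply Primrec.cons_apply Primrec.length_apply
  Primrec.or_apply Primrec.add_apply Primrec.sub_apply Primrec.mod_apply Primrec.natPair_apply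
  Primrec.encode_apply Primrec.ite
attribute [fun_prop] PrimrecPred.eq PrimrecPred.lt PrimrecPred.le PrimrecPred.mem PrimrecPred.and
  PrimrecPred.or PrimrecPred.not PrimrecPred.imp PrimrecPred.iff PrimrecPred.exists_mem
  PrimrecPred.forall_mem
attribute [fun_prop] Sig1.and Sig1.or Sig1.ex Sig1.forall_mem_list Sig1.forall_lt

/-! ### Access to the components of an automaton is primitive recursive. -/

namespace BuchiAutomaton

theorem primrec_trans : Primrec trans :=
  Primrec.fst.comp (Primrec.of_equiv (e := equivProd))

theorem primrec_init : Primrec init :=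
  Primrec.fst.comp (Primrec.snd.comp (Primrec.of_equiv (e := equivProd)))

theorem primrec_acc : Primrec acc :=
  Primrec.snd.comp (Primrec.snd.comp (Primrec.of_equiv (e := equivProd)))

@[fun_prop] theorem primrec_mk {α : Type*} [Primcodable α] {f : α → List (ℕ × List ℕ × ℕ)}
    {g h : α → List ℕ} (hf : Primrec f) (hg : Primrec g) (hh : Primrec h) :
    Primrec fun a => BuchiAutomaton.mk (f a) (g a) (h a) :=
  (Primrec.of_equiv_symm (e := equivProd)).comp (hf.pair (hg.pair hh))

@[fun_prop] theorem primrec_trans_apply {α : Type*} [Primcodable α] {M : α → BuchiAutomaton}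
    (hM : Primrec M) : Primrec fun a => (M a).trans := primrec_trans.comp hM

@[fun_prop] theorem primrec_init_apply {α : Type*} [Primcodable α] {M : α → BuchiAutomaton}
    (hM : Primrec M) : Primrec fun a => (M a).init := primrec_init.comp hM

@[fun_prop] theorem primrec_acc_apply {α : Type*} [Primcodable α] {M : α → BuchiAutomaton}
    (hM : Primrec M) : Primrec fun a => (M a).acc := primrec_acc.comp hM

end BuchiAutomaton

/-! ### Ramsey's theorem and factorizations of infinite words -/

/-- Infinite Ramsey theorem for pairs and finitely many colours. -/
theorem exists_strictMono_homogeneous {C : Type*} [Finite C] (f : ℕ → ℕ → C) :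
    ∃ k : ℕ → ℕ, StrictMono k ∧ ∃ c, ∀ i j, i < j → f (k i) (k j) = c := by
  -- A nonprincipal ultrafilter selects the colour `c i` that `f i j` has for almost all `j`, and
  -- then the colour `d` that `c i` has for almost all `i`.
  let U : Ultrafilter ℕ := Filter.hyperfilter ℕ
  have h1 : ∀ i, ∃ c, ∀ᶠ j in (U : Filter ℕ), f i j = c := fun i => by
    obtain ⟨c, hc⟩ := Ultrafilter.eq_pure_of_finite (U.map (f i))
    refine ⟨c, ?_⟩
    have : {c} ∈ U.map (f i) := by rw [hc]; exact Set.mem_singleton c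
    exact this
  choose c hc using h1
  obtain ⟨d, hd⟩ := Ultrafilter.eq_pure_of_finite (U.map c)
  have hd' : ∀ᶠ i in (U : Filter ℕ), c i = d := by
    have : {d} ∈ U.map c := by rw [hd]; exact Set.mem_singleton d
    exact this
  -- Greedy choice: the next index only has to avoid finitely many null sets, so it exists.
  obtain ⟨k, -, hk⟩ := exists_seq_of_forall_finset_exists (fun i => c i = d)
    (fun i j => i < j ∧ f i j = d) (fun s hs => by
      have h2 : ∀ᶠ j in (U : Filter ℕ), ∀ i ∈ s, f i j = d := by
        rw [Filter.eventually_all_finset]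
        intro i hi
        have := hc i
        rwa [hs i hi] at this
      have h3 : ∀ᶠ j in (U : Filter ℕ), ∀ i ∈ s, i < j := by
        rw [Filter.eventually_all_finset]
        intro i _
        have : (Set.Iic i)ᶜ ∈ Filter.hyperfilter ℕ :=
          (Set.finite_Iic i).compl_mem_hyperfilter
        filter_upwards [this] with j hj
        simpa using hj
      obtain ⟨j, hj, hj2, hj3⟩ := (hd'.and (h2.and h3)).exists
      exact ⟨j, hj, fun i hi => ⟨hj3 i hi, hj2 i hi⟩⟩)
  exact ⟨k, fun i j hij => (hk i j hij).1, d, fun i j hij => (hk i j hij).2⟩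

/-- `k` lists the left ends of the blocks of a factorization of `ℕ` into finite intervals. -/
def IsFact (k : ℕ → ℕ) : Prop := StrictMono k ∧ k 0 = 0

/-- Ramsey's theorem for the pairs `(f i j, f 0 j)` also makes the initial factor constant. The left
end of block `0` is moved to position `0`, so homogeneity is only claimed from index `1` on. -/
theorem exists_fact_homogeneous {C : Type*} [Finite C] (f : ℕ → ℕ → C) :
    ∃ k, IsFact k ∧ ∃ s e, (∀ i, 1 ≤ i → f 0 (k i) = s) ∧
      ∀ i j, 1 ≤ i → i < j → f (k i) (k j) = e := by
  obtain ⟨k, hk, c, hc⟩ := exists_strictMono_homogeneous fun i j => (f i j, f 0 j)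
  refine ⟨fun i => if i = 0 then 0 else k i, ⟨?_, by simp⟩, c.2, c.1, ?_, ?_⟩
  · intro i j hij
    have := hk hij
    have h0 := hk.id_le j
    dsimp only [id] at h0
    dsimp only
    split_ifs <;> omega
  · intro i hi
    have := hc 0 i (by omega)
    beta_reduce
    rw [if_neg (by omega)]
    exact congrArg Prod.snd this
  · intro i j hi hij
    beta_reduce
    rw [if_neg (by omega), if_neg (by omega)]
    exact congrArg Prod.fst (hc i j hij)

/-! ### The block that contains a given position. -/

namespace IsFact

variable {k : ℕ → ℕ}

theorem exists_block (hk : IsFact k) (j : ℕ) : ∃ i, k i ≤ j ∧ j < k (i + 1) := by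
  have h : ∃ i, j < k i := ⟨j + 1, lt_of_lt_of_le (Nat.lt_succ_self j) (hk.1.id_le _)⟩
  classical
  have h0 : Nat.find h ≠ 0 := fun h0 => by
    have := Nat.find_spec h
    rw [h0, hk.2] at this
    omega
  refine ⟨Nat.find h - 1, not_lt.1 (Nat.find_min h (by omega)), ?_⟩
  rw [Nat.sub_add_cancel (Nat.pos_of_ne_zero h0)]
  exact Nat.find_spec h

/-- The number of the block that contains the position `j`. -/
noncomputable def blk (hk : IsFact k) (j : ℕ) : ℕ := (hk.exists_block j).choose

theorem le_blk (hk : IsFact k) (j : ℕ) : k (hk.blk j) ≤ j := (hk.exists_block j).choose_spec.1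

theorem lt_blk (hk : IsFact k) (j : ℕ) : j < k (hk.blk j + 1) := (hk.exists_block j).choose_spec.2

theorem blk_eq (hk : IsFact k) {i j : ℕ} (h1 : k i ≤ j) (h2 : j < k (i + 1)) : hk.blk j = i := by
  have h3 := hk.le_blk j
  have h4 := hk.lt_blk j
  have h5 := hk.1.lt_iff_lt.1 (lt_of_le_of_lt h1 h4)
  have h6 := hk.1.lt_iff_lt.1 (lt_of_le_of_lt h3 h2)
  omega

theorem blk_apply (hk : IsFact k) (i : ℕ) : hk.blk (k i) = i :=
  hk.blk_eq le_rfl (hk.1 (Nat.lt_succ_self i))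

theorem blk_zero (hk : IsFact k) : hk.blk 0 = 0 := by
  have := hk.blk_apply 0
  rwa [hk.2] at this

theorem lt_succ (hk : IsFact k) (i : ℕ) : k i < k (i + 1) := hk.1 (Nat.lt_succ_self i)

theorem blk_mono (hk : IsFact k) : Monotone hk.blk := fun i j hij => by
  have h1 := hk.le_blk i
  have h2 := hk.lt_blk j
  have := hk.1.lt_iff_lt.1 (lt_of_le_of_lt h1 (lt_of_le_of_lt hij h2))
  omega

theorem blk_succ (hk : IsFact k) (j : ℕ) :
    (hk.blk (j + 1) = hk.blk j ∧ j + 1 < k (hk.blk j + 1)) ∨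
      (hk.blk (j + 1) = hk.blk j + 1 ∧ j + 1 = k (hk.blk j + 1)) := by
  have h1 := hk.le_blk j
  have h2 := hk.lt_blk j
  rcases Nat.lt_or_ge (j + 1) (k (hk.blk j + 1)) with h | h
  · exact Or.inl ⟨hk.blk_eq (by omega) h, h⟩
  · have h3 : j + 1 = k (hk.blk j + 1) := by omega
    refine Or.inr ⟨?_, h3⟩
    conv_lhs => rw [h3]
    exact hk.blk_apply _

end IsFact

/-- The factor `w a, …, w (b - 1)` of an infinite word. -/
def seg {X : Type*} (w : ℕ → X) (a b : ℕ) : List X := (List.Ico a b).map w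

section seg

variable {X : Type*}

theorem seg_append (w : ℕ → X) {a b c : ℕ} (h1 : a ≤ b) (h2 : b ≤ c) :
    seg w a b ++ seg w b c = seg w a c := by
  simp only [seg, ← List.map_append, List.Ico.append_consecutive h1 h2]

@[simp] theorem length_seg (w : ℕ → X) (a b : ℕ) : (seg w a b).length = b - a := by
  simp [seg]

theorem getElem_seg (w : ℕ → X) (a b i : ℕ) (h : i < (seg w a b).length) :
    (seg w a b)[i] = w (a + i) := by
  simp [seg, List.Ico]

theorem seg_congr {w w' : ℕ → X} {a b : ℕ} (h : ∀ i, a ≤ i → i < b → w i = w' i) :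
    seg w a b = seg w' a b := by
  refine List.map_congr_left fun i hi => ?_
  rw [List.Ico.mem] at hi
  exact h i hi.1 hi.2

theorem seg_self (w : ℕ → X) (a : ℕ) : seg w a a = [] := by simp [seg]

theorem seg_succ (w : ℕ → X) {a b : ℕ} (h : a ≤ b) : seg w a (b + 1) = seg w a b ++ [w b] := by
  simp [seg, List.Ico.succ_top h]

theorem eq_of_seg_eq {w w' : ℕ → X} {a b : ℕ} (h : seg w a b = seg w' a b) {i : ℕ} (h1 : a ≤ i)
    (h2 : i < b) : w i = w' i := by
  have h3 : i - a < (seg w a b).length := by simp; omega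
  have h4 : i - a < (seg w' a b).length := by simp; omega
  have h5 : (seg w a b)[i - a] = (seg w' a b)[i - a] := by simp only [h]
  rw [getElem_seg, getElem_seg, Nat.add_sub_cancel' h1] at h5
  exact h5

theorem map_seg {Y : Type*} (g : X → Y) (w : ℕ → X) (a b : ℕ) :
    (seg w a b).map g = seg (fun i => g (w i)) a b := by
  simp [seg]

/-- Gluing of finite words to an infinite one. -/
theorem exists_glue [Nonempty X] {k : ℕ → ℕ} (hk : IsFact k) (x : ℕ → List X)
    (hx : ∀ i, (x i).length = k (i + 1) - k i) :
    ∃ w : ℕ → X, ∀ i, seg w (k i) (k (i + 1)) = x i := by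
  let d : X := Classical.arbitrary X
  refine ⟨fun j => (x (hk.blk j)).getD (j - k (hk.blk j)) d, fun i => ?_⟩
  refine List.ext_getElem (by simp [hx]) fun n h1 h2 => ?_
  rw [getElem_seg]
  have h3 : hk.blk (k i + n) = i := hk.blk_eq (by omega) (by rw [hx] at h2; omega)
  simp only [h3, Nat.add_sub_cancel_left]
  rw [List.getD_eq_getElem _ _ h2]

end seg

/-! ### Relations saturated by a finite colouring -/

/-- Assignments of infinite words over `ℕ` to tracks: `v t i` is the letter on track `t` at
position `i`. -/
abbrev Env : Type := ℕ → ℕ → ℕ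

/-- The tuple of letters of all tracks at a position. -/
def Env.col (v : Env) (i : ℕ) : ℕ → ℕ := fun t => v t i

/-- A multiplicative colouring of finite words with finitely many colours. -/
structure Coloring where
  D : Type
  fin : Finite D
  mul : D → D → D
  h : List (ℕ → ℕ) → D
  h_append : ∀ u v, h (u ++ v) = mul (h u) (h v)

namespace Coloring

/-- The colour of a factor. -/
def seg (c : Coloring) (v : Env) (a b : ℕ) : c.D := c.h (_root_.seg v.col a b)

theorem seg_mul (c : Coloring) (v : Env) {a b d : ℕ} (h1 : a ≤ b) (h2 : b ≤ d) :
    c.mul (c.seg v a b) (c.seg v b d) = c.seg v a d := by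
  rw [seg, seg, seg, ← c.h_append, seg_append _ h1 h2]

theorem seg_congr (c : Coloring) {v v' : Env} {a b : ℕ}
    (h : ∀ i, a ≤ i → i < b → ∀ t, v t i = v' t i) : c.seg v a b = c.seg v' a b := by
  exact congrArg c.h (_root_.seg_congr fun i h1 h2 => funext (h i h1 h2))

/-- `c` saturates `R`: whether `R` holds depends only on the colours of the blocks of any
factorization. -/
def Saturates (c : Coloring) (R : Env → Prop) : Prop :=
  ∀ v v' k k', IsFact k → IsFact k' →
    (∀ i, c.seg v (k i) (k (i + 1)) = c.seg v' (k' i) (k' (i + 1))) → R v → R v'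

/-- Saturation is symmetric in the two environments; this is why complementation costs nothing for
colourings. -/
theorem Saturates.iff {c : Coloring} {R : Env → Prop} (hc : c.Saturates R) {v v' : Env}
    {k k' : ℕ → ℕ} (hk : IsFact k) (hk' : IsFact k')
    (h : ∀ i, c.seg v (k i) (k (i + 1)) = c.seg v' (k' i) (k' (i + 1))) : R v ↔ R v' :=
  ⟨hc v v' k k' hk hk' h, hc v' v k' k hk' hk fun i => (h i).symm⟩

/-- The product of finitely many colourings. -/
def pi {ι : Type} [Finite ι] (c : ι → Coloring) : Coloring where
  D := ∀ i, (c i).D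
  fin := by
    have := fun i => (c i).fin
    infer_instance
  mul a b i := (c i).mul (a i) (b i)
  h u i := (c i).h u
  h_append u v := funext fun i => (c i).h_append u v

end Coloring

/-- The relation is saturated by some finite colouring (that is, it is ω-regular). -/
def Sat (R : Env → Prop) : Prop := ∃ c : Coloring, c.Saturates R

namespace Sat

theorem exists_common {ι : Type} [Finite ι] {R : ι → Env → Prop} (h : ∀ i, Sat (R i)) :
    ∃ c : Coloring, ∀ i, c.Saturates (R i) := by
  choose c hc using h
  refine ⟨Coloring.pi c, fun i v v' k k' hk hk' hv => hc i v v' k k' hk hk' fun j => ?_⟩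
  exact congrFun (hv j) i

/-- A common colouring transfers all truth values simultaneously, so any Boolean function of them is
saturated. -/
theorem boolean {ι : Type} [Finite ι] {R : ι → Env → Prop} (h : ∀ i, Sat (R i))
    (P : (ι → Prop) → Prop) : Sat fun v => P fun i => R i v := by
  obtain ⟨c, hc⟩ := exists_common h
  refine ⟨c, fun v v' k k' hk hk' hv hR => ?_⟩
  have : (fun i => R i v) = fun i => R i v' :=
    funext fun i => propext ((hc i).iff hk hk' hv)
  beta_reduce at hR ⊢
  rwa [← this]

theorem of_iff {R R' : Env → Prop} (h : Sat R) (e : ∀ v, R v ↔ R' v) : Sat R' :=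
  (funext fun v => propext (e v) : R = R') ▸ h

theorem const (p : Prop) : Sat fun _ => p :=
  boolean (ι := Empty) (R := fun i => i.elim) (fun i => i.elim) fun _ => p

theorem not {R : Env → Prop} (h : Sat R) : Sat fun v => ¬ R v :=
  boolean (ι := Unit) (R := fun _ => R) (fun _ => h) fun f => ¬ f ()

theorem and {R R' : Env → Prop} (h : Sat R) (h' : Sat R') : Sat fun v => R v ∧ R' v :=
  boolean (ι := Bool) (R := fun b => cond b R R') (fun b => by cases b <;> assumption)
    fun f => f true ∧ f false

theorem imp {R R' : Env → Prop} (h : Sat R) (h' : Sat R') : Sat fun v => R v → R' v :=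
  (h.and h'.not).not.of_iff fun v => by tauto

theorem forall_finite {ι : Type} [Finite ι] {R : ι → Env → Prop} (h : ∀ i, Sat (R i)) :
    Sat fun v => ∀ i, R i v :=
  boolean h fun f => ∀ i, f i

theorem exists_finite {ι : Type} [Finite ι] {R : ι → Env → Prop} (h : ∀ i, Sat (R i)) :
    Sat fun v => ∃ i, R i v :=
  boolean h fun f => ∃ i, f i

/-- Preimages under letter-to-letter maps. -/
theorem comap {R : Env → Prop} (h : Sat R) (g : (ℕ → ℕ) → ℕ → ℕ) :
    Sat fun v => R fun t i => g (v.col i) t := by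
  obtain ⟨c, hc⟩ := h
  refine ⟨⟨c.D, c.fin, c.mul, fun u => c.h (u.map g), fun u v => by
    rw [List.map_append, c.h_append]⟩, fun v v' k k' hk hk' hv hR => ?_⟩
  refine hc _ _ k k' hk hk' (fun i => ?_) hR
  have := hv i
  simp only [Coloring.seg, map_seg] at this
  exact this

/-- Projections. -/
theorem ex {R : Env → Prop} (h : Sat R) (t : ℕ) :
    Sat fun v => ∃ x, R (Function.update v t x) := by
  obtain ⟨c, hc⟩ := h
  have := c.fin
  -- `e` erases track `t`. The new colour of `u` is the set of colours of all words that agree with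
  -- `u` outside track `t`.
  let e : (ℕ → ℕ) → ℕ → ℕ := fun l => Function.update l t 0
  refine ⟨⟨Set c.D, inferInstance, Set.image2 c.mul,
    fun u => {d | ∃ x : List (ℕ → ℕ), x.map e = u.map e ∧ c.h x = d}, fun u v => ?_⟩,
    fun v v' k k' hk hk' hv => ?_⟩
  · ext d
    simp only [Set.mem_ofPred_eq, Set.mem_image2]
    constructor
    · rintro ⟨x, hx, rfl⟩
      rw [List.map_append, List.map_eq_append_iff] at hx
      obtain ⟨x1, x2, rfl, h1, h2⟩ := hx
      exact ⟨_, ⟨x1, h1, rfl⟩, _, ⟨x2, h2, rfl⟩, (c.h_append _ _).symm⟩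
    · rintro ⟨_, ⟨x1, h1, rfl⟩, _, ⟨x2, h2, rfl⟩, rfl⟩
      exact ⟨x1 ++ x2, by rw [List.map_append, List.map_append, h1, h2], c.h_append _ _⟩
  · rintro ⟨y, hy⟩
    -- The witness `y` is transferred block by block: the set of possible colours is the same for
    -- corresponding blocks, so each block of `v'` has a variant with the colour that `y` produces.
    -- The variants are glued afterwards.
    have h1 : ∀ i, ∃ x : List (ℕ → ℕ), x.map e = (seg v'.col (k' i) (k' (i + 1))).map e ∧
        c.h x = c.seg (Function.update v t y) (k i) (k (i + 1)) := fun i => by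
      have h2 : c.seg (Function.update v t y) (k i) (k (i + 1)) ∈
          {d | ∃ x : List (ℕ → ℕ), x.map e = (seg v.col (k i) (k (i + 1))).map e ∧ c.h x = d} := by
        refine ⟨_, ?_, rfl⟩
        rw [map_seg, map_seg]
        refine seg_congr fun j _ _ => funext fun t' => ?_
        by_cases ht : t' = t
        · subst ht; simp [e]
        · simp [e, ht, Env.col]
      have h3 := hv i
      simp only [Coloring.seg] at h3
      rw [h3] at h2
      exact h2
    choose x hx hx' using h1
    obtain ⟨w, hw⟩ := exists_glue hk' x fun i => by
      have := congrArg List.length (hx i)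
      simpa using this
    refine ⟨fun j => w j t, ?_⟩
    have hw' : ∀ j, Env.col (Function.update v' t fun j => w j t) j = w j := fun j => by
      have h4 := hx (hk'.blk j)
      rw [← hw, map_seg, map_seg] at h4
      have h5 := eq_of_seg_eq h4 (hk'.le_blk j) (hk'.lt_blk j)
      funext t'
      by_cases ht : t' = t
      · subst ht; simp [Env.col]
      · have := congrFun h5 t'
        simp only [e, Function.update_of_ne ht] at this
        simp [Env.col, ht, this]
    refine hc _ _ k k' hk hk' (fun i => ?_) hy
    rw [← hx', ← hw, Coloring.seg]
    exact congrArg c.h (seg_congr fun j _ _ => (hw' j).symm)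

theorem all {R : Env → Prop} (h : Sat R) (t : ℕ) :
    Sat fun v => ∀ x, R (Function.update v t x) :=
  (h.not.ex t).not.of_iff fun v => by simp

theorem forall_col (p : (ℕ → ℕ) → Prop) : Sat fun v => ∀ i, p (v.col i) := by
  refine ⟨⟨Prop, inferInstance, And, fun u => ∀ l ∈ u, p l, fun u v => ?_⟩,
    fun v v' k k' hk hk' hv hR j => ?_⟩
  · simp [or_imp, forall_and]
  · have h1 := hv (hk'.blk j)
    simp only [Coloring.seg, seg, List.mem_map, List.Ico.mem, eq_iff_iff] at h1
    refine h1.1 ?_ _ ⟨j, ⟨hk'.le_blk j, hk'.lt_blk j⟩, rfl⟩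
    rintro _ ⟨i, -, rfl⟩
    exact hR i

theorem frequently_col (p : (ℕ → ℕ) → Prop) : Sat fun v => ∀ N, ∃ i, N ≤ i ∧ p (v.col i) := by
  refine ⟨⟨Prop, inferInstance, Or, fun u => ∃ l ∈ u, p l, fun u v => ?_⟩,
    fun v v' k k' hk hk' hv hR N => ?_⟩
  · simp [or_and_right, exists_or]
  · obtain ⟨i, hi, hp⟩ := hR (k N)
    have h0 : N ≤ hk.blk i := by
      have := hk.blk_mono hi
      rwa [hk.blk_apply] at this
    have h1 := hv (hk.blk i)
    simp only [Coloring.seg, seg, List.mem_map, List.Ico.mem, eq_iff_iff] at h1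
    obtain ⟨_, ⟨j, hj, rfl⟩, hj'⟩ := h1.1 ⟨_, ⟨i, ⟨hk.le_blk i, hk.lt_blk i⟩, rfl⟩, hp⟩
    exact ⟨j, (h0.trans (hk'.1.id_le _)).trans hj.1, hj'⟩

end Sat

/-! ### The lexicographic order is ω-regular. -/

/-- The strict lexicographic order of infinite words. -/
def LexLt (x y : ℕ → ℕ) : Prop := ∃ i, x i < y i ∧ ∀ j < i, x j = y j

theorem LexLt.irrefl (x : ℕ → ℕ) : ¬ LexLt x x := fun ⟨_, h, _⟩ => lt_irrefl _ h

theorem LexLt.trans {x y z : ℕ → ℕ} (h1 : LexLt x y) (h2 : LexLt y z) : LexLt x z := by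
  obtain ⟨i, hi, hi'⟩ := h1
  obtain ⟨j, hj, hj'⟩ := h2
  rcases lt_trichotomy i j with h | rfl | h
  · exact ⟨i, by rw [← hj' i h]; exact hi, fun l hl => (hi' l hl).trans (hj' l (hl.trans h))⟩
  · exact ⟨i, hi.trans hj, fun l hl => (hi' l hl).trans (hj' l hl)⟩
  · exact ⟨j, by rw [hi' j h]; exact hj, fun l hl => (hi' l (hl.trans h)).trans (hj' l hl)⟩

theorem LexLt.total {x y : ℕ → ℕ} (h : x ≠ y) : LexLt x y ∨ LexLt y x := by
  classical
  have h' : ∃ i, x i ≠ y i := Function.ne_iff.1 h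
  have h1 := Nat.find_spec h'
  have h2 : ∀ j < Nat.find h', x j = y j := fun j hj => not_not.1 (Nat.find_min h' hj)
  rcases lt_or_gt_of_ne h1 with h3 | h3
  · exact Or.inl ⟨_, h3, h2⟩
  · exact Or.inr ⟨_, h3, fun j hj => (h2 j hj).symm⟩

/-- A finite word is coloured by the lexicographic comparison of its two tracks; `Ordering.then` is
the multiplication. The order is decided in the first block whose colour is not `.eq`. -/
theorem Sat.lexLt (t t' : ℕ) : Sat fun v => LexLt (v t) (v t') := by
  let f : List (ℕ → ℕ) → Ordering := fun u => u.foldr (fun l o => (compare (l t) (l t')).then o) .eq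
  have hf : ∀ u v, f (u ++ v) = (f u).then (f v) := fun u v => by
    induction u with
    | nil => rfl
    | cons a u ih =>
      have : f (a :: (u ++ v)) = (compare (a t) (a t')).then (f (u ++ v)) := rfl
      rw [List.cons_append, this, ih]
      show _ = ((compare (a t) (a t')).then (f u)).then (f v)
      cases compare (a t) (a t') <;> rfl
  have hcol : ∀ (v : Env) a b, a ≤ b → (f (seg v.col a b) = .eq ↔
      ∀ i, a ≤ i → i < b → v t i = v t' i) := fun v a b hab => by
    induction b, hab using Nat.le_induction with
    | base => simp only [seg_self]; exact ⟨fun _ i h1 h2 => by omega, fun _ => rfl⟩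
    | succ b hab ih =>
      rw [seg_succ _ hab, hf]
      have h3 : f [v.col b] = compare (v t b) (v t' b) := by
        show (compare (v t b) (v t' b)).then .eq = _
        cases compare (v t b) (v t' b) <;> rfl
      rw [h3, Ordering.then_eq_eq, ih, Nat.compare_eq_eq]
      constructor
      · rintro ⟨h1, h2⟩ i hi hi'
        rcases Nat.lt_succ_iff_lt_or_eq.1 hi' with h | rfl
        · exact h1 i hi h
        · exact h2
      · intro h
        exact ⟨fun i h1 h2 => h i h1 (by omega), h b hab (by omega)⟩
  have hlt : ∀ (v : Env) a b, a ≤ b → (f (seg v.col a b) = .lt ↔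
      ∃ i, a ≤ i ∧ i < b ∧ v t i < v t' i ∧ ∀ j, a ≤ j → j < i → v t j = v t' j) := fun v a b hab => by
    induction b, hab using Nat.le_induction with
    | base =>
      simp only [seg_self]
      exact ⟨fun h => (by cases h), fun ⟨i, h1, h2, _⟩ => by omega⟩
    | succ b hab ih =>
      rw [seg_succ _ hab, hf]
      have h3 : f [v.col b] = compare (v t b) (v t' b) := by
        show (compare (v t b) (v t' b)).then .eq = _
        cases compare (v t b) (v t' b) <;> rfl
      rw [h3, Ordering.then_eq_lt, ih, Nat.compare_eq_lt, hcol v a b hab]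
      constructor
      · rintro (⟨i, h1, h2, h4⟩ | ⟨h1, h2⟩)
        · exact ⟨i, h1, by omega, h4⟩
        · exact ⟨b, hab, by omega, h2, fun j hj hj' => h1 j hj hj'⟩
      · rintro ⟨i, h1, h2, h4, h5⟩
        rcases Nat.lt_succ_iff_lt_or_eq.1 h2 with h | rfl
        · exact Or.inl ⟨i, h1, h, h4, h5⟩
        · exact Or.inr ⟨h5, h4⟩
  refine ⟨⟨Ordering, inferInstance, Ordering.then, f, hf⟩, fun v v' k k' hk hk' hv hR => ?_⟩
  simp only [Coloring.seg] at hv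
  obtain ⟨i, hi, hi'⟩ := hR
  have h1 : f (seg v.col (k (hk.blk i)) (k (hk.blk i + 1))) = .lt :=
    (hlt v _ _ (hk.lt_succ _).le).2 ⟨i, hk.le_blk i, hk.lt_blk i, hi, fun j _ hj => hi' j hj⟩
  rw [hv, hlt v' _ _ (hk'.lt_succ _).le] at h1
  obtain ⟨j, h2, h3, h4, h5⟩ := h1
  refine ⟨j, h4, fun l hl => ?_⟩
  rcases Nat.lt_or_ge l (k' (hk.blk i)) with h | h
  · have h6 : hk'.blk l < hk.blk i := hk'.1.lt_iff_lt.1 (lt_of_le_of_lt (hk'.le_blk l) h)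
    have h7 : f (seg v.col (k (hk'.blk l)) (k (hk'.blk l + 1))) = .eq :=
      (hcol v _ _ (hk.lt_succ _).le).2 fun m _ hm => hi' m <| hm.trans_le <|
        (hk.1.monotone h6).trans (hk.le_blk i)
    rw [hv, hcol v' _ _ (hk'.lt_succ _).le] at h7
    exact h7 l (hk'.le_blk l) (hk'.lt_blk l)
  · exact h5 l h hl

/-! ### Büchi automata and saturated relations -/

namespace BuchiAutomaton

/-- Acceptance of an infinite word over tuples. -/
def AcceptsWord (M : BuchiAutomaton) (w : ℕ → List ℕ) : Prop :=
  ∃ ρ : ℕ → ℕ, ρ 0 ∈ M.init ∧ (∀ i, (ρ i, w i, ρ (i + 1)) ∈ M.trans) ∧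
    ∀ N, ∃ i, N ≤ i ∧ ρ i ∈ M.acc

/-- `M.Path u p b q`: there is a run from `p` to `q` on `u`, and it enters an accepting state iff
`b = true`. -/
def Path (M : BuchiAutomaton) : List (List ℕ) → ℕ → Bool → ℕ → Prop
  | [], p, b, q => p = q ∧ b = false
  | a :: u, p, b, q => ∃ r b', (p, a, r) ∈ M.trans ∧ M.Path u r b' q ∧
      (b = true ↔ r ∈ M.acc ∨ b' = true)

variable {M : BuchiAutomaton}

theorem path_append {u v : List (List ℕ)} {p : ℕ} {b : Bool} {q : ℕ} :
    M.Path (u ++ v) p b q ↔ ∃ r b₁ b₂, M.Path u p b₁ r ∧ M.Path v r b₂ q ∧ b = (b₁ || b₂) := by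
  induction u generalizing p b with
  | nil =>
    constructor
    · intro h
      exact ⟨p, false, b, ⟨rfl, rfl⟩, h, by simp⟩
    · rintro ⟨r, b₁, b₂, ⟨rfl, rfl⟩, h, rfl⟩
      simpa using h
  | cons a u ih =>
    simp only [List.cons_append, Path]
    constructor
    · rintro ⟨r, b', h1, h2, h3⟩
      obtain ⟨r', c₁, c₂, h4, h5, rfl⟩ := ih.1 h2
      classical
      refine ⟨r', decide (r ∈ M.acc ∨ c₁ = true), c₂, ⟨r, c₁, h1, h4, by simp⟩, h5, ?_⟩
      rw [Bool.eq_iff_iff, h3]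
      simp [or_assoc]
    · rintro ⟨r', b₁, b₂, ⟨r, c₁, h1, h2, h3⟩, h4, rfl⟩
      refine ⟨r, c₁ || b₂, h1, ih.2 ⟨r', c₁, b₂, h2, h4, rfl⟩, ?_⟩
      simp [h3, or_assoc]

theorem path_singleton {a : List ℕ} {p : ℕ} {b : Bool} {q : ℕ} :
    M.Path [a] p b q ↔ (p, a, q) ∈ M.trans ∧ (b = true ↔ q ∈ M.acc) := by
  simp only [Path]
  constructor
  · rintro ⟨r, b', h1, ⟨rfl, rfl⟩, h3⟩
    exact ⟨h1, by simpa using h3⟩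
  · rintro ⟨h1, h2⟩
    exact ⟨q, false, h1, ⟨rfl, rfl⟩, by simpa using h2⟩

theorem path_seg {w : ℕ → List ℕ} {a b : ℕ} (hab : a ≤ b) {p : ℕ} {f : Bool} {q : ℕ} :
    M.Path (seg w a b) p f q ↔ ∃ r : ℕ → ℕ, r a = p ∧ r b = q ∧
      (∀ i, a ≤ i → i < b → (r i, w i, r (i + 1)) ∈ M.trans) ∧
      (f = true ↔ ∃ i, a < i ∧ i ≤ b ∧ r i ∈ M.acc) := by
  induction b, hab using Nat.le_induction generalizing f q with
  | base =>
    rw [seg_self]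
    constructor
    · rintro ⟨rfl, rfl⟩
      refine ⟨fun _ => p, rfl, rfl, fun i h1 h2 => by omega, ?_⟩
      simp only [Bool.false_eq_true, false_iff]
      rintro ⟨i, h1, h2, -⟩
      omega
    · rintro ⟨r, rfl, rfl, -, h⟩
      refine ⟨rfl, Bool.eq_false_iff.2 fun hf => ?_⟩
      obtain ⟨i, h1, h2, -⟩ := h.1 hf
      omega
  | succ b hab ih =>
    rw [seg_succ _ hab, path_append]
    constructor
    · rintro ⟨r', b₁, b₂, h1, h2, rfl⟩
      obtain ⟨r, h3, h4, h5, h6⟩ := ih.1 h1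
      obtain ⟨h7, h8⟩ := path_singleton.1 h2
      refine ⟨Function.update r (b + 1) q, ?_, by simp, fun i hi hi' => ?_, ?_⟩
      · rw [Function.update_of_ne (by omega), h3]
      · rcases Nat.lt_succ_iff_lt_or_eq.1 hi' with h | rfl
        · rw [Function.update_of_ne (by omega), Function.update_of_ne (by omega)]
          exact h5 i hi h
        · rw [Function.update_of_ne (by omega), Function.update_self, h4]
          exact h7
      · simp only [Bool.or_eq_true, h6, h8]
        constructor
        · rintro (⟨i, hi, hi', h⟩ | h)
          · exact ⟨i, hi, by omega, by rwa [Function.update_of_ne (by omega)]⟩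
          · exact ⟨b + 1, by omega, le_rfl, by simpa using h⟩
        · rintro ⟨i, hi, hi', h⟩
          rcases Nat.lt_or_ge i (b + 1) with h' | h'
          · rw [Function.update_of_ne (by omega)] at h
            exact Or.inl ⟨i, hi, by omega, h⟩
          · have : i = b + 1 := by omega
            subst this
            exact Or.inr (by simpa using h)
    · rintro ⟨r, rfl, rfl, h1, h2⟩
      classical
      refine ⟨r b, decide (∃ i, a < i ∧ i ≤ b ∧ r i ∈ M.acc), decide (r (b + 1) ∈ M.acc),
        ih.2 ⟨r, rfl, rfl, fun i hi hi' => h1 i hi (by omega), by simp⟩,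
        path_singleton.2 ⟨h1 b hab (by omega), by simp⟩, ?_⟩
      rw [Bool.eq_iff_iff, h2]
      simp only [Bool.or_eq_true, decide_eq_true_eq]
      constructor
      · rintro ⟨i, hi, hi', h⟩
        rcases Nat.lt_or_ge i (b + 1) with h' | h'
        · exact Or.inl ⟨i, hi, by omega, h⟩
        · have : i = b + 1 := by omega
          exact Or.inr (this ▸ h)
      · rintro (⟨i, hi, hi', h⟩ | h)
        · exact ⟨i, hi, by omega, h⟩
        · exact ⟨b + 1, by omega, le_rfl, h⟩

/-- Acceptance depends only on which paths exist on the blocks. The flag of a block refers to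
positions in the half-open interval `(k i, k (i + 1)]`, so that consecutive blocks share no
position. -/
theorem acceptsWord_iff_blocks {w : ℕ → List ℕ} {k : ℕ → ℕ} (hk : IsFact k) :
    M.AcceptsWord w ↔ ∃ (s : ℕ → ℕ) (f : ℕ → Bool), s 0 ∈ M.init ∧
      (∀ i, M.Path (seg w (k i) (k (i + 1))) (s i) (f i) (s (i + 1))) ∧
      ∀ N, ∃ i, N ≤ i ∧ f i = true := by
  constructor
  · rintro ⟨ρ, h0, h1, h2⟩
    classical
    refine ⟨fun i => ρ (k i), fun i => decide (∃ j, k i < j ∧ j ≤ k (i + 1) ∧ ρ j ∈ M.acc),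
      (by show ρ (k 0) ∈ _; rwa [hk.2]), fun i => (path_seg (hk.lt_succ i).le).2
        ⟨ρ, rfl, rfl, fun j _ _ => h1 j, by simp⟩, fun N => ?_⟩
    -- The state at `j` is entered by reading position `j - 1`, so the visit belongs to the block of
    -- `j - 1`.
    obtain ⟨j, hj, hj'⟩ := h2 (k N + 1)
    have h3 : N ≤ hk.blk (j - 1) := by
      have := hk.blk_mono (show k N ≤ j - 1 by omega)
      rwa [hk.blk_apply] at this
    have h4 := hk.le_blk (j - 1)
    have h5 := hk.lt_blk (j - 1)
    exact ⟨_, h3, by simpa using ⟨j, by omega, by omega, hj'⟩⟩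
  · rintro ⟨s, f, h0, h1, h2⟩
    have h3 := fun i => (path_seg (hk.lt_succ i).le).1 (h1 i)
    choose r hr1 hr2 hr3 hr4 using h3
    -- The runs on adjacent blocks agree at the common end point, so they can be glued.
    have key : ∀ i j, k i ≤ j → j ≤ k (i + 1) → r (hk.blk j) j = r i j := fun i j hi hj => by
      rcases hj.lt_or_eq with h | rfl
      · rw [hk.blk_eq hi h]
      · rw [hk.blk_apply, hr1, hr2]
    refine ⟨fun j => r (hk.blk j) j, ?_, fun j => ?_, fun N => ?_⟩
    · have := hk.blk_zero
      have h4 := hr1 0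
      rw [hk.2] at h4
      beta_reduce
      rwa [this, h4]
    · have h4 := hk.le_blk j
      have h5 := hk.lt_blk j
      beta_reduce
      rw [key (hk.blk j) (j + 1) (by omega) (by omega)]
      exact hr3 _ j h4 h5
    · obtain ⟨i, hi, hi'⟩ := h2 N
      obtain ⟨j, h4, h5, h6⟩ := (hr4 i).1 hi'
      refine ⟨j, (hi.trans (hk.1.id_le i)).trans h4.le, ?_⟩
      beta_reduce
      rwa [key i j h4.le h5]

theorem exists_state_bound (M : BuchiAutomaton) :
    ∃ N, (∀ p ∈ M.init, p < N) ∧ ∀ t ∈ M.trans, t.1 < N ∧ t.2.2 < N := by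
  refine ⟨(M.init ++ (M.trans.map fun t => t.1) ++ (M.trans.map fun t => t.2.2)).sum + 1,
    fun p hp => ?_, fun t ht => ⟨?_, ?_⟩⟩ <;> rw [Nat.lt_succ_iff] <;>
    refine List.le_sum_of_mem ?_
  · simp [hp]
  · simp only [List.mem_append, List.mem_map]
    exact Or.inl (Or.inr ⟨t, ht, rfl⟩)
  · simp only [List.mem_append, List.mem_map]
    exact Or.inr ⟨t, ht, rfl⟩

theorem Path.lt_of_lt {N : ℕ} (hN : ∀ t ∈ M.trans, t.1 < N ∧ t.2.2 < N) {u : List (List ℕ)}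
    {p : ℕ} {b : Bool} {q : ℕ} (hp : p < N) (h : M.Path u p b q) : q < N := by
  induction u generalizing p b with
  | nil => exact h.1 ▸ hp
  | cons a u ih =>
    obtain ⟨r, b', h1, h2, -⟩ := h
    exact ih (hN _ h1).2 h2

/-- Acceptance of a word with a homogeneous factorization. -/
theorem acceptsWord_iff_linked {w : ℕ → List ℕ} {k : ℕ → ℕ} (hk : IsFact k)
    {S E : ℕ → Bool → ℕ → Prop}
    (hS : ∀ i, 1 ≤ i → ∀ p b q, M.Path (seg w 0 (k i)) p b q ↔ S p b q)
    (hE : ∀ i j, 1 ≤ i → i < j → ∀ p b q, M.Path (seg w (k i) (k j)) p b q ↔ E p b q) :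
    M.AcceptsWord w ↔ ∃ p ∈ M.init, ∃ b q, S p b q ∧ E q true q := by
  constructor
  · rintro ⟨ρ, h0, h1, h2⟩
    obtain ⟨N, -, hN⟩ := M.exists_state_bound
    have hρ : ∀ i, ρ i < N := fun i => (hN _ (h1 i)).1
    -- Some state `q` recurs at infinitely many block ends. Two of its occurrences with an accepting
    -- visit in between yield the loop.
    obtain ⟨q, hq⟩ := Finite.exists_infinite_fiber fun i => (⟨ρ (k (i + 1)), hρ _⟩ : Fin N)
    have hq' := Set.infinite_coe_iff.1 hq
    obtain ⟨i, hi, -⟩ := hq'.exists_gt 0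
    obtain ⟨m, hm, hm'⟩ := h2 (k (i + 1) + 1)
    obtain ⟨j, hj, hj'⟩ := hq'.exists_gt (m + i)
    have hi2 : ρ (k (i + 1)) = q := congrArg Fin.val hi
    have hj2 : ρ (k (j + 1)) = q := congrArg Fin.val hj
    have hmj : m ≤ k (j + 1) := le_trans (b := j + 1) (by omega) (hk.1.id_le (j + 1))
    classical
    refine ⟨ρ 0, h0, decide (∃ l, 0 < l ∧ l ≤ k (i + 1) ∧ ρ l ∈ M.acc), q,
      (hS (i + 1) (by omega) _ _ _).1 ((path_seg (Nat.zero_le _)).2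
        ⟨ρ, rfl, hi2, fun l _ _ => h1 l, by simp⟩),
      (hE (i + 1) (j + 1) (by omega) (by omega) _ _ _).1
        ((path_seg (hk.1.monotone (by omega))).2 ⟨ρ, hi2, hj2, fun l _ _ => h1 l, ?_⟩)⟩
    simp only [true_iff]
    exact ⟨m, by omega, hmj, hm'⟩
  · rintro ⟨p, hp, b, q, h1, h2⟩
    rw [acceptsWord_iff_blocks hk]
    refine ⟨fun i => if i = 0 then p else q, fun i => if i = 0 then b else true, by simpa using hp,
      fun i => ?_, fun N => ⟨N + 1, by omega, by simp⟩⟩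
    rcases Nat.eq_zero_or_pos i with rfl | hi
    · simpa [hk.2] using (hS 1 le_rfl _ _ _).2 h1
    · simpa [hi.ne'] using (hE i (i + 1) hi (by omega) _ _ _).2 h2

/-- The automaton accepts the convolution of the words on the listed tracks. -/
def At (M : BuchiAutomaton) (ρ : List ℕ) (v : Env) : Prop :=
  M.AcceptsWord fun i => ρ.map (v.col i)

/-- The colour of a word is its transition profile, i.e. the set of all triples of source, flag and
target of its paths; profiles multiply by composing paths. -/
theorem sat_at (M : BuchiAutomaton) (ρ : List ℕ) : Sat (M.At ρ) := by
  obtain ⟨N, hN0, hN⟩ := M.exists_state_bound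
  let P : List (ℕ → ℕ) → Set (Fin N × Bool × Fin N) := fun u =>
    {x | M.Path (u.map fun l => ρ.map l) x.1 x.2.1 x.2.2}
  refine ⟨⟨Set (Fin N × Bool × Fin N), inferInstance, fun X Y =>
    {x | ∃ r b₁ b₂, (x.1, b₁, r) ∈ X ∧ (r, b₂, x.2.2) ∈ Y ∧ x.2.1 = (b₁ || b₂)}, P,
    fun u v => ?_⟩, fun v v' k k' hk hk' hv hR => ?_⟩
  · ext ⟨p, b, q⟩
    simp only [P, Set.mem_ofPred_eq, List.map_append, path_append]
    constructor
    · rintro ⟨r, b₁, b₂, h1, h2, h3⟩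
      exact ⟨⟨r, h1.lt_of_lt hN p.2⟩, b₁, b₂, h1, h2, h3⟩
    · rintro ⟨r, b₁, b₂, h1, h2, h3⟩
      exact ⟨r, b₁, b₂, h1, h2, h3⟩
  · rw [At, acceptsWord_iff_blocks hk] at hR
    rw [At, acceptsWord_iff_blocks hk']
    obtain ⟨s, f, h0, h1, h2⟩ := hR
    refine ⟨s, f, h0, fun i => ?_, h2⟩
    have hs : ∀ i, s i < N := fun i => by
      induction i with
      | zero => exact hN0 _ h0
      | succ i ih => exact (h1 i).lt_of_lt hN ih
    have h3 : ((⟨s i, hs i⟩, f i, ⟨s (i + 1), hs _⟩) : Fin N × Bool × Fin N) ∈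
        P (seg v.col (k i) (k (i + 1))) := by
      simpa [P, map_seg] using h1 i
    have h4 : P (seg v.col (k i) (k (i + 1))) = P (seg v'.col (k' i) (k' (i + 1))) := hv i
    rw [h4] at h3
    simpa [P, map_seg] using h3

/-- An automaton with an arbitrary finite state set, as a `BuchiAutomaton`. -/
theorem exists_of_finite {Q : Type} [Finite Q] (init acc : Set Q) (step : Q → List ℕ → Q → Prop)
    {A : Set (List ℕ)} (hA : A.Finite) :
    ∃ M : BuchiAutomaton, ∀ w : ℕ → List ℕ, (∀ i, w i ∈ A) →
      (M.AcceptsWord w ↔ ∃ r : ℕ → Q, r 0 ∈ init ∧ (∀ i, step (r i) (w i) (r (i + 1))) ∧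
        ∀ N, ∃ i, N ≤ i ∧ r i ∈ acc) := by
  obtain ⟨n, ⟨e⟩⟩ := Finite.exists_equiv_fin Q
  let g : Q → ℕ := fun q => e q
  have hg : Function.Injective g := Fin.val_injective.comp e.injective
  have hT : {t : ℕ × List ℕ × ℕ | ∃ p a q, a ∈ A ∧ step p a q ∧ t = (g p, a, g q)}.Finite := by
    refine ((((Set.finite_univ (α := Q)).prod (hA.prod (Set.finite_univ (α := Q)))).image
      fun x : Q × List ℕ × Q => (g x.1, x.2.1, g x.2.2))).subset ?_
    rintro _ ⟨p, a, q, ha, -, rfl⟩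
    exact ⟨(p, a, q), by simp [ha], rfl⟩
  refine ⟨⟨hT.toFinset.toList, ((Set.toFinite init).image g).toFinset.toList,
    ((Set.toFinite acc).image g).toFinset.toList⟩, fun w hw => ?_⟩
  simp only [AcceptsWord, Finset.mem_toList, Set.Finite.mem_toFinset]
  constructor
  · rintro ⟨ρ, h0, h1, h2⟩
    have h3 : ∀ i, ∃ q, g q = ρ i := fun i => by
      obtain ⟨p, a, q, -, -, h⟩ := h1 i
      exact ⟨p, (congrArg Prod.fst h).symm⟩
    choose r hr using h3
    refine ⟨r, ?_, fun i => ?_, fun N => ?_⟩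
    · obtain ⟨q, hq, hq'⟩ := h0
      rwa [← hg (hq'.trans (hr 0).symm)]
    · obtain ⟨p, a, q, -, h4, h5⟩ := h1 i
      simp only [Prod.mk.injEq, ← hr] at h5
      rw [hg h5.1, h5.2.1, hg h5.2.2]
      exact h4
    · obtain ⟨i, hi, q, hq, hq'⟩ := h2 N
      exact ⟨i, hi, by rwa [← hg (hq'.trans (hr i).symm)]⟩
  · rintro ⟨r, h0, h1, h2⟩
    refine ⟨fun i => g (r i), ⟨_, h0, rfl⟩, fun i => ⟨_, _, _, hw i, h1 i, rfl⟩, fun N => ?_⟩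
    obtain ⟨i, hi, h⟩ := h2 N
    exact ⟨i, hi, _, h, rfl⟩

end BuchiAutomaton

/-- The words on the tracks `t < n` are over the alphabet `{0, …, S - 1}` and the other tracks are
constantly `0`. -/
def InEnv (S n : ℕ) (v : Env) : Prop := ∀ i, (∀ t < n, v t i < S) ∧ ∀ t, n ≤ t → v t i = 0

theorem InEnv.col_eq {S n : ℕ} {v : Env} (hv : InEnv S n v) (i : ℕ) :
    (fun t => ((List.range n).map (v.col i)).getD t 0) = v.col i := by
  funext t
  rcases Nat.lt_or_ge t n with h | h
  · simp [h]
  · rw [List.getD_eq_default _ _ (by simpa using h)]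
    exact ((hv i).2 t h).symm

theorem finite_tuples (S n : ℕ) : {a : List ℕ | a.length = n ∧ ∀ x ∈ a, x < S}.Finite := by
  refine (List.finite_length_eq (Fin S) n |>.image fun l => l.map Fin.val).subset ?_
  rintro a ⟨h1, h2⟩
  refine ⟨a.pmap Fin.mk h2, by simpa using h1, ?_⟩
  simp [List.map_pmap]

theorem InEnv.mem_tuples {S n : ℕ} {v : Env} (hv : InEnv S n v) (i : ℕ) :
    (List.range n).map (v.col i) ∈ {a : List ℕ | a.length = n ∧ ∀ x ∈ a, x < S} := by
  refine ⟨by simp, fun x hx => ?_⟩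
  simp only [List.mem_map, List.mem_range] at hx
  obtain ⟨t, ht, rfl⟩ := hx
  exact (hv i).1 t ht

/-- Büchi's theorem: saturated relations are recognized by automata. -/
theorem Sat.exists_automaton {R : Env → Prop} (h : Sat R) (S n : ℕ) :
    ∃ M : BuchiAutomaton, ∀ v, InEnv S n v → (M.At (List.range n) v ↔ R v) := by
  classical
  obtain ⟨c, hc⟩ := h
  have := c.fin
  -- The pairs `(s, e)` such that some environment in `R` has a factorization with block colours `s,
  -- e, e, …`.
  let Good : Set (c.D × c.D) := {x | ∃ v k, IsFact k ∧ R v ∧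
    c.seg v (k 0) (k 1) = x.1 ∧ ∀ i, 1 ≤ i → c.seg v (k i) (k (i + 1)) = x.2}
  -- A state consists of a guessed good pair, which never changes, a flag telling whether the first
  -- block is finished, a flag marking block starts (these states are accepting), and the colour of
  -- the current block read so far.
  let Q := (c.D × c.D) × Bool × Bool × c.D
  let nxt : c.D → List ℕ → c.D := fun d a => c.mul d (c.h [fun t => a.getD t 0])
  obtain ⟨M, hM⟩ := BuchiAutomaton.exists_of_finite (Q := Q)
    {x | x.1 ∈ Good ∧ x.2 = (false, true, c.h [])} {x | x.2.2.1 = true}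
    (fun p a q => q.1 = p.1 ∧ ((q.2.1 = p.2.1 ∧ q.2.2.1 = false ∧ q.2.2.2 = nxt p.2.2.2 a) ∨
      (nxt p.2.2.2 a = (if p.2.1 = true then p.1.2 else p.1.1) ∧ q.2 = (true, true, c.h []))))
    (finite_tuples S n)
  refine ⟨M, fun v hv => ?_⟩
  rw [BuchiAutomaton.At, hM _ hv.mem_tuples]
  have hn : ∀ a j, a ≤ j → nxt (c.seg v a j) ((List.range n).map (v.col j)) =
      c.seg v a (j + 1) := fun a j haj => by
    simp only [nxt]
    rw [hv.col_eq, ← c.seg_mul v haj (Nat.le_succ j)]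
    simp [Coloring.seg, seg_succ _ (le_refl j), seg_self]
  constructor
  · rintro ⟨r, ⟨h0, h0'⟩, h1, h2⟩
    have hse : ∀ i, (r i).1 = (r 0).1 := fun i => by
      induction i with
      | zero => rfl
      | succ i ih => rw [(h1 i).1, ih]
    obtain ⟨v₀, k₀, hk₀, hR, hs, he⟩ := h0
    -- By the acceptance condition the run marks infinitely many block starts; their enumeration is
    -- a factorization of `v` with the guessed colours.
    let B : ℕ → Prop := fun j => (r j).2.2.1 = true
    have hB : (Set.ofPred B).Infinite := by
      rw [Set.infinite_iff_exists_gt]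
      intro N
      obtain ⟨i, hi, h⟩ := h2 (N + 1)
      exact ⟨i, h, hi⟩
    have hB0 : B 0 := by simp [B, h0']
    have hk : IsFact (Nat.nth B) := ⟨Nat.nth_strictMono hB, Nat.nth_zero_of_zero hB0⟩
    have hph : ∀ i, (r (Nat.nth B i)).2 = (decide (1 ≤ i), true, c.h []) := fun i => by
      have hBi : B (Nat.nth B i) := Nat.nth_mem_of_infinite hB i
      rcases Nat.eq_zero_or_pos i with rfl | hi
      · rw [hk.2, h0']; simp
      · have hpos : Nat.nth B i ≠ 0 := by
          have := hk.1 hi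
          omega
        obtain ⟨j, hj⟩ := Nat.exists_eq_succ_of_ne_zero hpos
        have h3 := (h1 j).2
        rw [← Nat.succ_eq_add_one, ← hj] at h3
        rcases h3 with h3 | h3
        · have h4 : (r (Nat.nth B i)).2.2.1 = true := hBi
          rw [h3.2.1] at h4
          cases h4
        · rw [h3.2]; simp [Nat.succ_le_iff.2 hi]
    have hcur : ∀ i j, Nat.nth B i ≤ j → j < Nat.nth B (i + 1) →
        (r j).2.1 = decide (1 ≤ i) ∧ (r j).2.2.2 = c.seg v (Nat.nth B i) j := fun i j hij => by
      induction j, hij using Nat.le_induction with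
      | base =>
        intro _
        rw [hph]
        exact ⟨rfl, by rw [Coloring.seg, seg_self]⟩
      | succ j hij ih =>
        intro hj
        obtain ⟨h3, h4⟩ := ih (by omega)
        have h5 : ¬ B (j + 1) := fun hB1 => by
          have h6 : ¬ i + 1 < Nat.count B (j + 2) := fun h => by
            have := (Nat.lt_nth_iff_count_lt hB).1 h
            omega
          have h7 : i < Nat.count B (j + 1) :=
            (Nat.lt_nth_iff_count_lt hB).2 (by omega)
          rw [Nat.count_succ, if_pos hB1] at h6
          omega
        rcases (h1 j).2 with h6 | h6
        · refine ⟨h6.1.trans h3, ?_⟩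
          rw [h6.2.2, h4, hn _ _ hij]
        · exact absurd (by simp [B, h6.2]) h5
    have hcol : ∀ i, c.seg v (Nat.nth B i) (Nat.nth B (i + 1)) =
        if 1 ≤ i then (r 0).1.2 else (r 0).1.1 := fun i => by
      have hlt := hk.lt_succ i
      obtain ⟨j, hj⟩ : ∃ j, Nat.nth B (i + 1) = j + 1 :=
        Nat.exists_eq_succ_of_ne_zero (by omega)
      obtain ⟨h3, h4⟩ := hcur i j (by omega) (by omega)
      rcases (h1 j).2 with h6 | h6
      · have h7 : (r (Nat.nth B (i + 1))).2.2.1 = true := Nat.nth_mem_of_infinite hB _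
        rw [hj, h6.2.1] at h7
        cases h7
      · rw [hj, ← hn _ _ (by omega), ← h4, h6.1, h3, hse]
        simp
    refine hc v₀ v k₀ _ hk₀ hk (fun i => ?_) hR
    rw [hcol]
    split_ifs with hi
    · exact he i hi
    · obtain rfl : i = 0 := by omega
      exact hs
  · intro hR
    -- For the converse the run guesses a homogeneous factorization of `v`, whose pair `(s, e)` is
    -- good because `v` itself lies in `R`.
    obtain ⟨k, hk, s, e, hs, he⟩ := exists_fact_homogeneous fun i j => c.seg v i j
    refine ⟨fun j => ((s, e), decide (1 ≤ hk.blk j), decide (j = k (hk.blk j)),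
      c.seg v (k (hk.blk j)) j), ⟨⟨v, k, hk, hR, ?_, fun i hi => he i _ hi (by omega)⟩, ?_⟩,
      fun j => ⟨rfl, ?_⟩, fun N => ⟨k N, hk.1.id_le N, ?_⟩⟩
    · rw [hk.2]; exact hs 1 le_rfl
    · have := hk.blk_zero
      simp [this, hk.2, Coloring.seg, seg_self]
    · rcases hk.blk_succ j with ⟨h3, h4⟩ | ⟨h3, h4⟩
      · left
        have h5 := hk.le_blk j
        refine ⟨by simp [h3], by simp [h3]; omega, ?_⟩
        simp only [h3]
        rw [hn _ _ h5]
      · right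
        have h5 := hk.le_blk j
        simp only [hn _ _ h5, h3]
        refine ⟨?_, ?_⟩
        · rw [h4]
          rcases Nat.eq_zero_or_pos (hk.blk j) with h6 | h6
          · simp only [h6, hk.2]
            simpa using hs 1 le_rfl
          · have : 1 ≤ hk.blk j := h6
            simpa [this] using he _ _ h6 (Nat.lt_succ_self _)
        · rw [← h4]
          simp [Coloring.seg, seg_self]
    · simp [hk.blk_apply]

/-! ### A decidable check for Boolean relations between automata -/

/-- All words of length `n` over `{0, …, S - 1}`. -/
def tuples (S : ℕ) : ℕ → List (List ℕ)
  | 0 => [[]]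
  | n + 1 => (tuples S n).flatMap fun a => (List.range S).map fun x => a ++ [x]

theorem mem_tuples {S n : ℕ} {a : List ℕ} : a ∈ tuples S n ↔ a.length = n ∧ ∀ x ∈ a, x < S := by
  induction n generalizing a with
  | zero => simp +contextual [tuples]
  | succ n ih =>
    simp only [tuples, List.mem_flatMap, List.mem_map, List.mem_range, ih]
    constructor
    · rintro ⟨b, ⟨rfl, h⟩, x, hx, rfl⟩
      refine ⟨by simp, fun y hy => ?_⟩
      rw [List.mem_append, List.mem_singleton] at hy
      rcases hy with hy | rfl
      · exact h y hy
      · exact hx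
    · rintro ⟨h1, h2⟩
      have hne : a ≠ [] := by rintro rfl; simp at h1
      refine ⟨a.dropLast, ⟨by simp [h1], fun x hx => h2 x (List.mem_of_mem_dropLast hx)⟩,
        a.getLast hne, h2 _ (List.getLast_mem hne), List.dropLast_append_getLast hne⟩

@[fun_prop] theorem primrec_tuples {α : Type*} [Primcodable α] {S n : α → ℕ} (hS : Primrec S)
    (hn : Primrec n) : Primrec fun a => tuples (S a) (n a) := by
  have h1 : Primrec fun x : α × ℕ × List (List ℕ) =>
      x.2.2.flatMap fun b => (List.range (S x.1)).map fun y => b ++ [y] := by fun_prop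
  have h : Primrec fun a => Nat.rec (motive := fun _ => List (List ℕ)) [[]]
      (fun _ l => l.flatMap fun b => (List.range (S a)).map fun x => b ++ [x]) (n a) :=
    Primrec.nat_rec' (h := fun a (x : ℕ × List (List ℕ)) =>
      x.2.flatMap fun b => (List.range (S a)).map fun y => b ++ [y]) hn (Primrec.const _) h1
  refine h.of_eq fun a => ?_
  induction n a with
  | zero => rfl
  | succ m ih => simp only [ih, tuples]

/-- Select the listed entries of a tuple. -/
def sel (ρ a : List ℕ) : List ℕ := ρ.map fun t => a.getD t 0

@[fun_prop] theorem primrec_sel {α : Type*} [Primcodable α] {f g : α → List ℕ} (hf : Primrec f)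
    (hg : Primrec g) : Primrec fun a => sel (f a) (g a) := by
  unfold sel
  fun_prop

namespace BuchiAutomaton

/-- A list of triples `(p, b, q)`, the profile of a finite word. -/
abbrev Prof : Type := List (ℕ × Bool × ℕ)

/-- An automaton together with the list of tracks that it reads. -/
abbrev Comp : Type := BuchiAutomaton × List ℕ

/-- `z` lists the paths of the component on the word `u`. -/
def IsProf (C : Comp) (u : List (List ℕ)) (z : Prof) : Prop :=
  ∀ p b q, (p, b, q) ∈ z ↔ C.1.Path (u.map (sel C.2)) p b q

/-- This and `IsCompProf` are the bounded-quantifier forms of `IsProf` for a letter and for a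
concatenation; they make certificates primitive recursively checkable. In the second clause the flag
of `x` need not be compared, as the first clause determines it. -/
def IsLetterProf (C : Comp) (a : List ℕ) (z : Prof) : Prop :=
  (∀ x ∈ z, (x.1, sel C.2 a, x.2.2) ∈ C.1.trans ∧ (x.2.1 = true ↔ x.2.2 ∈ C.1.acc)) ∧
    ∀ t ∈ C.1.trans, t.2.1 = sel C.2 a →
      ∃ x ∈ z, x.1 = t.1 ∧ x.2.2 = t.2.2

def IsCompProf (z z₁ z₂ : Prof) : Prop :=
  (∀ x ∈ z, ∃ x₁ ∈ z₁, ∃ x₂ ∈ z₂,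
    x₁.1 = x.1 ∧ x₁.2.2 = x₂.1 ∧ x₂.2.2 = x.2.2 ∧ x.2.1 = (x₁.2.1 || x₂.2.1)) ∧
  ∀ x₁ ∈ z₁, ∀ x₂ ∈ z₂, x₁.2.2 = x₂.1 → (x₁.1, x₁.2.1 || x₂.2.1, x₂.2.2) ∈ z

/-- Acceptance of a word with factor profiles `s, e, e, …`: a path in `s` from an initial state to a
state with an accepting loop in `e`. -/
def LinkedAcc (M : BuchiAutomaton) (s e : Prof) : Prop :=
  ∃ x ∈ s, x.1 ∈ M.init ∧ (x.2.2, true, x.2.2) ∈ e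

section primrec

variable {α : Type*} [Primcodable α]

@[fun_prop] theorem primrec_isLetterProf {C : α → Comp} {a : α → List ℕ} {z : α → Prof}
    (hC : Primrec C) (ha : Primrec a) (hz : Primrec z) :
    PrimrecPred fun x => IsLetterProf (C x) (a x) (z x) := by
  unfold IsLetterProf
  fun_prop

@[fun_prop] theorem primrec_isCompProf {z z₁ z₂ : α → Prof}
    (hz : Primrec z) (hz₁ : Primrec z₁) (hz₂ : Primrec z₂) :
    PrimrecPred fun x => IsCompProf (z x) (z₁ x) (z₂ x) := by
  unfold IsCompProf
  fun_prop

@[fun_prop] theorem primrec_linkedAcc {M : α → BuchiAutomaton} {s e : α → Prof}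
    (hM : Primrec M) (hs : Primrec s) (he : Primrec e) :
    PrimrecPred fun x => LinkedAcc (M x) (s x) (e x) := by
  unfold LinkedAcc
  fun_prop

end primrec

theorem isLetterProf_iff {C : Comp} {a : List ℕ} {z : Prof} :
    IsLetterProf C a z ↔ IsProf C [a] z := by
  simp only [IsProf, List.map_cons, List.map_nil, path_singleton]
  constructor
  · rintro ⟨h1, h2⟩ p b q
    refine ⟨fun h => h1 _ h, fun ⟨h3, h4⟩ => ?_⟩
    obtain ⟨⟨p', b', q'⟩, hx, rfl, rfl⟩ := h2 _ h3 rfl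
    have h5 := (h1 _ hx).2
    have : b = b' := Bool.eq_iff_iff.2 (h4.trans h5.symm)
    exact this ▸ hx
  · intro h
    refine ⟨fun x hx => (h _ _ _).1 hx, fun t ht hta => ?_⟩
    classical
    refine ⟨(t.1, decide (t.2.2 ∈ C.1.acc), t.2.2), (h _ _ _).2 ⟨?_, by simp⟩, rfl, rfl⟩
    rw [← hta]
    exact ht

theorem isCompProf_iff {C : Comp} {u₁ u₂ : List (List ℕ)} {z z₁ z₂ : Prof}
    (h₁ : IsProf C u₁ z₁) (h₂ : IsProf C u₂ z₂) :
    IsCompProf z z₁ z₂ ↔ IsProf C (u₁ ++ u₂) z := by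
  simp only [IsProf, List.map_append, path_append]
  constructor
  · rintro ⟨h3, h4⟩ p b q
    constructor
    · intro h
      obtain ⟨⟨p₁, b₁, q₁⟩, hx₁, ⟨p₂, b₂, q₂⟩, hx₂, rfl, rfl, rfl, rfl⟩ := h3 _ h
      exact ⟨_, _, _, (h₁ _ _ _).1 hx₁, (h₂ _ _ _).1 hx₂, rfl⟩
    · rintro ⟨r, b₁, b₂, h5, h6, rfl⟩
      exact h4 _ ((h₁ _ _ _).2 h5) _ ((h₂ _ _ _).2 h6) rfl
  · intro h
    refine ⟨fun x hx => ?_, fun x₁ hx₁ x₂ hx₂ he => ?_⟩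
    · obtain ⟨r, b₁, b₂, h5, h6, h7⟩ := (h _ _ _).1 hx
      exact ⟨_, (h₁ _ _ _).2 h5, _, (h₂ _ _ _).2 h6, rfl, rfl, rfl, h7⟩
    · refine (h _ _ _).2 ⟨_, _, _, (h₁ _ _ _).1 hx₁, ?_, rfl⟩
      rw [he]
      exact (h₂ _ _ _).1 hx₂

/-- The empty word is excluded because every natural number has a trivial path on it, so that it has
no finite profile. -/
theorem exists_finite_profs (C : Comp) : ∃ Z : Set Prof, Z.Finite ∧
    ∀ u : List (List ℕ), u ≠ [] → ∃ z ∈ Z, IsProf C u z := by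
  classical
  obtain ⟨N, -, hN⟩ := C.1.exists_state_bound
  let F : Finset (ℕ × Bool × ℕ) := Finset.range N ×ˢ (Finset.univ ×ˢ Finset.range N)
  refine ⟨(fun X : Finset (ℕ × Bool × ℕ) => X.toList) '' (F.powerset : Set (Finset (ℕ × Bool × ℕ))),
    (Finset.finite_toSet _).image _, fun u hu => ?_⟩
  refine ⟨_, ⟨F.filter fun x => C.1.Path (u.map (sel C.2)) x.1 x.2.1 x.2.2,
    Finset.mem_coe.2 (Finset.mem_powerset.2 (Finset.filter_subset _ _)), rfl⟩,
    fun p b q => ?_⟩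
  simp only [Finset.mem_toList, Finset.mem_filter, and_iff_right_iff_imp]
  intro h
  have hp : p < N := by
    cases u with
    | nil => exact absurd rfl hu
    | cons a u =>
      obtain ⟨r, b', h1, -⟩ := h
      exact (hN _ h1).1
  simp [F, hp, h.lt_of_lt hN hp]

/-- Acceptance of the selected tracks. -/
def Comp.Accepts (C : Comp) (w : ℕ → List ℕ) : Prop := C.1.AcceptsWord fun i => sel C.2 (w i)

theorem accepts_iff_linkedAcc {C : Comp} {w : ℕ → List ℕ} {k : ℕ → ℕ} (hk : IsFact k) {s e : Prof}
    (hs : ∀ i, 1 ≤ i → IsProf C (seg w 0 (k i)) s)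
    (he : ∀ i j, 1 ≤ i → i < j → IsProf C (seg w (k i) (k j)) e) :
    C.Accepts w ↔ LinkedAcc C.1 s e := by
  rw [Comp.Accepts, acceptsWord_iff_linked hk (S := fun p b q => (p, b, q) ∈ s)
    (E := fun p b q => (p, b, q) ∈ e)]
  · constructor
    · rintro ⟨p, hp, b, q, h1, h2⟩
      exact ⟨_, h1, hp, h2⟩
    · rintro ⟨x, hx, h1, h2⟩
      exact ⟨_, h1, _, _, hx, h2⟩
  · intro i hi p b q
    rw [hs i hi p b q, map_seg]
  · intro i j hi hij p b q
    rw [he i j hi hij p b q, map_seg]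

/-- `Z` certifies that, for all words over the given letters, the first component accepts iff the
other two do not both accept. -/
def NandCheck (letters : List (List ℕ)) (C : Fin 3 → Comp) (Z : List (Fin 3 → Prof)) : Prop :=
  (∀ a ∈ letters, ∃ z ∈ Z, ∀ i, IsLetterProf (C i) a (z i)) ∧
  (∀ z₁ ∈ Z, ∀ z₂ ∈ Z, ∃ z ∈ Z, ∀ i, IsCompProf (z i) (z₁ i) (z₂ i)) ∧
  ∀ s ∈ Z, ∀ e ∈ Z, (∀ i, IsCompProf (e i) (e i) (e i)) → (∀ i, IsCompProf (s i) (s i) (e i)) →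
    (LinkedAcc (C 0).1 (s 0) (e 0) ↔
      ¬ (LinkedAcc (C 1).1 (s 1) (e 1) ∧ LinkedAcc (C 2).1 (s 2) (e 2)))

/-- The first two clauses place a profile of every nonempty factor of `w` in `Z`. Ramsey's theorem,
with members of `Z` as colours, gives a homogeneous factorization; its pair `(s, e)` satisfies the
equations `ee = e` and `se = s`, and the third clause compares acceptance for it. -/
theorem NandCheck.accepts_iff {letters : List (List ℕ)} {C : Fin 3 → Comp}
    {Z : List (Fin 3 → Prof)} (h : NandCheck letters C Z) {w : ℕ → List ℕ}
    (hw : ∀ i, w i ∈ letters) :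
    (C 0).Accepts w ↔ ¬ ((C 1).Accepts w ∧ (C 2).Accepts w) := by
  obtain ⟨h1, h2, h3⟩ := h
  have h4 : ∀ a d, ∃ z ∈ Z, ∀ i, IsProf (C i) (seg w a (a + d + 1)) (z i) := fun a d => by
    induction d with
    | zero =>
      obtain ⟨z, hz, hz'⟩ := h1 (w a) (hw a)
      refine ⟨z, hz, fun i => ?_⟩
      rw [add_zero, seg_succ _ le_rfl, seg_self]
      exact isLetterProf_iff.1 (hz' i)
    | succ d ih =>
      obtain ⟨z₁, hz₁, hz₁'⟩ := ih
      obtain ⟨z₂, hz₂, hz₂'⟩ := h1 (w (a + d + 1)) (hw _)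
      obtain ⟨z, hz, hz'⟩ := h2 z₁ hz₁ z₂ hz₂
      refine ⟨z, hz, fun i => ?_⟩
      rw [← add_assoc, seg_succ _ (by omega)]
      exact (isCompProf_iff (hz₁' i) (isLetterProf_iff.1 (hz₂' i))).1 (hz' i)
  have : Finite {z // z ∈ Z} := Z.finite_toSet
  -- A colouring of all pairs is needed, so an arbitrary member of `Z` is used for `b ≤ a`.
  have h5 : ∀ a b, ∃ z : {z // z ∈ Z}, a < b → ∀ i, IsProf (C i) (seg w a b) (z.1 i) := fun a b => by
    rcases Nat.lt_or_ge a b with hab | hab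
    · obtain ⟨z, hz, hz'⟩ := h4 a (b - a - 1)
      rw [show a + (b - a - 1) + 1 = b by omega] at hz'
      exact ⟨⟨z, hz⟩, fun _ => hz'⟩
    · obtain ⟨z, hz, -⟩ := h4 0 0
      exact ⟨⟨z, hz⟩, fun h => by omega⟩
  choose f hf using h5
  obtain ⟨k, hk, s, e, hs, he⟩ := exists_fact_homogeneous f
  have hs' : ∀ i, 1 ≤ i → ∀ j, IsProf (C j) (seg w 0 (k i)) (s.1 j) := fun i hi j => by
    rw [← hs i hi]
    refine hf _ _ ?_ j
    have := hk.1 hi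
    omega
  have he' : ∀ i j, 1 ≤ i → i < j → ∀ l, IsProf (C l) (seg w (k i) (k j)) (e.1 l) :=
    fun i j hi hij l => by
      rw [← he i j hi hij]
      exact hf _ _ (hk.1 hij) l
  have h6 := h3 s.1 s.2 e.1 e.2 (fun i => by
      rw [isCompProf_iff (he' 1 2 le_rfl (by omega) i) (he' 2 3 (by omega) (by omega) i),
        seg_append _ (hk.1.monotone (by omega)) (hk.1.monotone (by omega))]
      exact he' 1 3 le_rfl (by omega) i) (fun i => by
      rw [isCompProf_iff (hs' 1 le_rfl i) (he' 1 2 (by omega) (by omega) i),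
        seg_append _ (Nat.zero_le _) (hk.1.monotone (by omega))]
      exact hs' 2 (by omega) i)
  have h7 : ∀ l, (C l).Accepts w ↔ LinkedAcc (C l).1 (s.1 l) (e.1 l) := fun l =>
    accepts_iff_linkedAcc hk (fun i hi => hs' i hi l) (fun i j hi hij => he' i j hi hij l)
  rw [h7, h7, h7]
  exact h6

/-- `Z` consists of the profile triples of nonempty words over the letters. A pair `(s, e)` in the
third clause is realized by words `us`, `ue`, and the hypothesis for `us ue ue …` gives the required
equivalence. -/
theorem exists_nandCheck {letters : List (List ℕ)} {C : Fin 3 → Comp}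
    (h : ∀ w : ℕ → List ℕ, (∀ i, w i ∈ letters) →
      ((C 0).Accepts w ↔ ¬ ((C 1).Accepts w ∧ (C 2).Accepts w))) :
    ∃ Z, NandCheck letters C Z := by
  choose Z hZ hZ' using fun i => exists_finite_profs (C i)
  let Y : Set (Fin 3 → Prof) := {z | (∀ i, z i ∈ Z i) ∧
    ∃ u : List (List ℕ), u ≠ [] ∧ (∀ a ∈ u, a ∈ letters) ∧ ∀ i, IsProf (C i) u (z i)}
  have hY : Y.Finite := (Set.Finite.pi' hZ).subset fun z hz => hz.1
  have hY' : ∀ u : List (List ℕ), u ≠ [] → (∀ a ∈ u, a ∈ letters) →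
      ∃ z ∈ Y, ∀ i, IsProf (C i) u (z i) := fun u hu hu' => by
    choose z hz hz' using fun i => hZ' i u hu
    exact ⟨z, ⟨hz, u, hu, hu', hz'⟩, hz'⟩
  refine ⟨hY.toFinset.toList, ?_⟩
  simp only [NandCheck, Finset.mem_toList, Set.Finite.mem_toFinset]
  refine ⟨fun a ha => ?_, ?_, ?_⟩
  · obtain ⟨z, hz, hz'⟩ := hY' [a] (by simp) (by simpa using ha)
    exact ⟨z, hz, fun i => isLetterProf_iff.2 (hz' i)⟩
  · rintro z₁ ⟨-, u₁, hu₁, hl₁, hz₁⟩ z₂ ⟨-, u₂, hu₂, hl₂, hz₂⟩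
    obtain ⟨z, hz, hz'⟩ := hY' (u₁ ++ u₂) (by simp [hu₁]) (by
      intro a ha
      rcases List.mem_append.1 ha with ha | ha
      · exact hl₁ a ha
      · exact hl₂ a ha)
    exact ⟨z, hz, fun i => (isCompProf_iff (hz₁ i) (hz₂ i)).2 (hz' i)⟩
  · rintro s ⟨-, us, hus, hls, hs⟩ e ⟨-, ue, hue, hle, he⟩ hee hse
    have h1 := List.length_pos_iff.2 hus
    have h2 := List.length_pos_iff.2 hue
    -- The block ends of the ultimately periodic word `us ue ue …`.
    let k : ℕ → ℕ := fun i => if i = 0 then 0 else us.length + (i - 1) * ue.length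
    have hk1 : ∀ i, k (i + 1) = us.length + i * ue.length := fun i => by simp [k]
    have hk : IsFact k := by
      refine ⟨strictMono_nat_of_lt_succ fun i => ?_, by simp [k]⟩
      rcases Nat.eq_zero_or_pos i with rfl | hi
      · rw [hk1]; simp only [k, if_pos]; omega
      · obtain ⟨j, rfl⟩ := Nat.exists_eq_succ_of_ne_zero hi.ne'
        rw [hk1, Nat.succ_eq_add_one, hk1, add_mul]
        omega
    obtain ⟨w, hw⟩ := exists_glue hk (fun i => if i = 0 then us else ue) fun i => by
      rcases Nat.eq_zero_or_pos i with rfl | hi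
      · rw [hk1]; simp [k]
      · obtain ⟨j, rfl⟩ := Nat.exists_eq_succ_of_ne_zero hi.ne'
        rw [hk1, Nat.succ_eq_add_one, hk1, add_mul]
        simp only [Nat.add_eq_zero_iff, one_ne_zero, and_false, if_false]
        omega
    have hwl : ∀ j, w j ∈ letters := fun j => by
      have h3 : w j ∈ seg w (k (hk.blk j)) (k (hk.blk j + 1)) :=
        List.mem_map.2 ⟨j, List.Ico.mem.2 ⟨hk.le_blk j, hk.lt_blk j⟩, rfl⟩
      rw [hw] at h3
      split_ifs at h3
      · exact hls _ h3
      · exact hle _ h3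
    have hs' : ∀ l, ∀ i, 1 ≤ i → IsProf (C l) (seg w 0 (k i)) (s l) := fun l i hi => by
      induction i, hi using Nat.le_induction with
      | base =>
        have := hw 0
        rw [hk.2] at this
        simp only [if_true, zero_add] at this
        rw [this]
        exact hs l
      | succ i hi ih =>
        rw [← seg_append _ (Nat.zero_le _) (hk.lt_succ i).le, hw, if_neg (by omega)]
        exact (isCompProf_iff ih (he l)).1 (hse l)
    have he' : ∀ l, ∀ i j, 1 ≤ i → i < j → IsProf (C l) (seg w (k i) (k j)) (e l) :=
      fun l i j hi hij => by
        induction j, hij using Nat.le_induction with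
        | base =>
          have := hw i
          rw [if_neg (by omega)] at this
          rw [Nat.succ_eq_add_one, this]
          exact he l
        | succ j hj ih =>
          rw [← seg_append _ (hk.1.monotone (show i ≤ j by omega)) (hk.lt_succ j).le, hw,
            if_neg (by omega)]
          exact (isCompProf_iff ih (he l)).1 (hee l)
    rw [← accepts_iff_linkedAcc hk (hs' 0) (he' 0), ← accepts_iff_linkedAcc hk (hs' 1) (he' 1),
      ← accepts_iff_linkedAcc hk (hs' 2) (he' 2)]
    exact h w hwl

/-- On words over `S` letters on `n` tracks, `M` recognizes the relation
`¬ (M₁.At ρ₁ ∧ M₂.At ρ₂)`. -/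
def IsNand (S n : ℕ) (M : BuchiAutomaton) (C₁ C₂ : Comp) : Prop :=
  ∃ Z : List (Prof × Prof × Prof), NandCheck (tuples S n) ![(M, List.range n), C₁, C₂]
    (Z.map fun z : Prof × Prof × Prof => ![z.1, z.2.1, z.2.2])

/-- The only unbounded quantifier is the one over the certificate; all others range over lists. -/
theorem sig1_isNand {α : Type*} [Primcodable α] {S n : α → ℕ} {M : α → BuchiAutomaton}
    {C₁ C₂ : α → Comp} (hS : Primrec S) (hn : Primrec n) (hM : Primrec M) (hC₁ : Primrec C₁)
    (hC₂ : Primrec C₂) : Sig1 fun a => IsNand (S a) (n a) (M a) (C₁ a) (C₂ a) := by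
  refine Sig1.ex (Sig1.of_primrecPred ?_)
  refine PrimrecPred.of_eq (p := fun x : α × List (Prof × Prof × Prof) =>
    (∀ b ∈ tuples (S x.1) (n x.1), ∃ z ∈ x.2, IsLetterProf (M x.1, List.range (n x.1)) b z.1 ∧
      IsLetterProf (C₁ x.1) b z.2.1 ∧ IsLetterProf (C₂ x.1) b z.2.2) ∧
    (∀ z₁ ∈ x.2, ∀ z₂ ∈ x.2, ∃ z ∈ x.2, IsCompProf z.1 z₁.1 z₂.1 ∧
      IsCompProf z.2.1 z₁.2.1 z₂.2.1 ∧ IsCompProf z.2.2 z₁.2.2 z₂.2.2) ∧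
    ∀ s ∈ x.2, ∀ e ∈ x.2, (IsCompProf e.1 e.1 e.1 ∧
      IsCompProf e.2.1 e.2.1 e.2.1 ∧ IsCompProf e.2.2 e.2.2 e.2.2) →
      (IsCompProf s.1 s.1 e.1 ∧ IsCompProf s.2.1 s.2.1 e.2.1 ∧
        IsCompProf s.2.2 s.2.2 e.2.2) → (LinkedAcc (M x.1) s.1 e.1 ↔
      ¬ (LinkedAcc (C₁ x.1).1 s.2.1 e.2.1 ∧ LinkedAcc (C₂ x.1).1 s.2.2 e.2.2))) ?_ fun x => ?_
  · fun_prop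
  · have h : ∀ (l : List (Prof × Prof × Prof)) (g : Prof × Prof × Prof → Fin 3 → Prof)
        (p : (Fin 3 → Prof) → Prop), (∃ z ∈ l.map g, p z) ↔ ∃ z ∈ l, p (g z) := fun l g p => by
      simp only [List.mem_map]
      exact ⟨fun ⟨_, ⟨z, hz, e⟩, hp⟩ => ⟨z, hz, e ▸ hp⟩, fun ⟨z, hz, hp⟩ => ⟨_, ⟨z, hz, rfl⟩, hp⟩⟩
    simp only [NandCheck, List.forall_mem_map, h, Fin.forall_fin_succ]
    simp

theorem IsNand.at_iff {S n : ℕ} {M : BuchiAutomaton} {C₁ C₂ : Comp} (h : IsNand S n M C₁ C₂)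
    {v : Env} (hv : InEnv S n v) :
    M.At (List.range n) v ↔ ¬ (C₁.1.At C₁.2 v ∧ C₂.1.At C₂.2 v) := by
  obtain ⟨Z, hZ⟩ := h
  have h1 := hZ.accepts_iff (w := fun i => (List.range n).map (v.col i)) fun i =>
    mem_tuples.2 (hv.mem_tuples i)
  have h2 : ∀ ρ i, sel ρ ((List.range n).map (v.col i)) = ρ.map (v.col i) := fun ρ i => by
    rw [sel, hv.col_eq]
  simp only [Comp.Accepts, h2] at h1
  exact h1

theorem isNand_of_at_iff {S n : ℕ} {M : BuchiAutomaton} {C₁ C₂ : Comp}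
    (hM : ∀ v, InEnv S n v → (M.At (List.range n) v ↔ ¬ (C₁.1.At C₁.2 v ∧ C₂.1.At C₂.2 v))) :
    IsNand S n M C₁ C₂ := by
  have key : ∀ w : ℕ → List ℕ, (∀ i, w i ∈ tuples S n) →
      (Comp.Accepts (M, List.range n) w ↔ ¬ (C₁.Accepts w ∧ C₂.Accepts w)) := fun w hw => by
    have h1 : ∀ i, (w i).length = n ∧ ∀ x ∈ w i, x < S := fun i => mem_tuples.1 (hw i)
    have hv : InEnv S n fun t i => (w i).getD t 0 := fun i => by
      refine ⟨fun t ht => ?_, fun t ht => List.getD_eq_default _ _ (by rw [(h1 i).1]; exact ht)⟩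
      have ht' : t < (w i).length := by rw [(h1 i).1]; exact ht
      beta_reduce
      rw [List.getD_eq_getElem _ _ ht']
      exact (h1 i).2 _ (List.getElem_mem _)
    exact hM _ hv
  obtain ⟨Z, hZ⟩ := exists_nandCheck (C := ![(M, List.range n), C₁, C₂]) key
  refine ⟨Z.map fun z => (z 0, z 1, z 2), ?_⟩
  have h : (fun z : Fin 3 → Prof => ![z 0, z 1, z 2]) = id :=
    funext fun z => funext fun i => by fin_cases i <;> rfl
  simpa [Function.comp_def, h] using hZ

/-- Existence comes from colourings, correctness is certified by profiles. Together they make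
Boolean combinations effective by search, without a complementation construction. -/
theorem exists_isNand (S n : ℕ) (C₁ C₂ : Comp) : ∃ M, IsNand S n M C₁ C₂ := by
  obtain ⟨M, hM⟩ := (((sat_at C₁.1 C₁.2).and (sat_at C₂.1 C₂.2)).not).exists_automaton S n
  exact ⟨M, isNand_of_at_iff hM⟩

end BuchiAutomaton

/-! ### Effectively recognizable relations -/

open BuchiAutomaton Function

/-- The parametrized relation `R` on words with letters below `S` on `n` tracks is recognized by
automata that can be found effectively. -/
def ER {α : Type*} [Primcodable α] (S n : α → ℕ) (R : α → Env → Prop) : Prop :=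
  ∃ D : α × BuchiAutomaton → Prop, Sig1 D ∧
    (∀ a M, D (a, M) → ∀ v, InEnv (S a) (n a) v → (M.At (List.range (n a)) v ↔ R a v)) ∧
    ∀ a, ∃ M, D (a, M)

/-- The automaton accepts the columns of `v` on the first `n` tracks, extended by the words
in `l`. -/
def BuchiAutomaton.On (M : BuchiAutomaton) (n : ℕ) (v : Env) (l : List (ℕ → ℕ)) : Prop :=
  M.AcceptsWord fun i => (List.range n).map (v.col i) ++ l.map fun w => w i

theorem BuchiAutomaton.On.congr {n : ℕ} {v v' : Env} (h : ∀ t < n, v t = v' t)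
    (M : BuchiAutomaton) : M.On n v = M.On n v' := by
  funext l
  have : ∀ i, (List.range n).map (v.col i) = (List.range n).map (v'.col i) := fun i =>
    List.map_congr_left fun t ht => congrFun (h t (List.mem_range.1 ht)) i
  simp only [On, this]

/-- Projection of an automaton to the first `n` of `n + 1` tracks. -/
def BuchiAutomaton.proj (S n : ℕ) (M : BuchiAutomaton) : BuchiAutomaton where
  trans := (tuples S n).flatMap fun b => (List.range S).flatMap fun x =>
    M.trans.flatMap fun t => if t.2.1 = b ++ [x] then [(t.1, b, t.2.2)] else []
  init := M.init
  acc := M.acc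

theorem BuchiAutomaton.mem_trans_proj {S n : ℕ} {M : BuchiAutomaton} {p q : ℕ} {b : List ℕ} :
    (p, b, q) ∈ (M.proj S n).trans ↔
      b ∈ tuples S n ∧ ∃ x < S, (p, b ++ [x], q) ∈ M.trans := by
  simp only [proj, List.mem_flatMap, List.mem_range]
  constructor
  · rintro ⟨b', hb', x, hx, t, ht, h⟩
    split_ifs at h with h'
    · obtain ⟨rfl, rfl, rfl⟩ : p = t.1 ∧ b = b' ∧ q = t.2.2 := by simpa using h
      refine ⟨hb', x, hx, ?_⟩
      rw [← h']
      exact ht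
    · simp at h
  · rintro ⟨hb, x, hx, h⟩
    exact ⟨b, hb, x, hx, _, h, by simp⟩

theorem BuchiAutomaton.proj_at {S n : ℕ} {M : BuchiAutomaton} {v : Env} (hv : InEnv S n v) :
    (M.proj S n).At (List.range n) v ↔
      ∃ x : ℕ → ℕ, (∀ i, x i < S) ∧ M.At (List.range (n + 1)) (update v n x) := by
  have h1 : ∀ (x : ℕ → ℕ) i, (List.range (n + 1)).map (Env.col (update v n x) i) =
      (List.range n).map (v.col i) ++ [x i] := fun x i => by
    rw [List.range_succ, List.map_append]
    congr 1
    · exact List.map_congr_left fun t ht => by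
        simp [Env.col, update_of_ne (List.mem_range.1 ht).ne]
    · simp [Env.col]
  simp only [At, AcceptsWord, h1]
  constructor
  · rintro ⟨q, h0, h2, h3⟩
    choose x hx hx' using fun i => (mem_trans_proj.1 (h2 i)).2
    exact ⟨x, hx, q, h0, hx', h3⟩
  · rintro ⟨x, hx, q, h0, h2, h3⟩
    exact ⟨q, h0, fun i => mem_trans_proj.2 ⟨mem_tuples.2 (hv.mem_tuples i), x i, hx i, h2 i⟩, h3⟩

theorem BuchiAutomaton.primrec_proj {α : Type*} [Primcodable α] {S n : α → ℕ}
    {M : α → BuchiAutomaton} (hS : Primrec S) (hn : Primrec n) (hM : Primrec M) :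
    Primrec fun a => (M a).proj (S a) (n a) := by
  unfold proj
  fun_prop

theorem InEnv.update {S n : ℕ} {v : Env} (hv : InEnv S n v) {x : ℕ → ℕ} (hx : ∀ i, x i < S) :
    InEnv S (n + 1) (update v n x) := fun i => by
  refine ⟨fun t ht => ?_, fun t ht => ?_⟩
  · rcases Nat.lt_succ_iff_lt_or_eq.1 ht with h | rfl
    · rw [update_of_ne h.ne]
      exact (hv i).1 t h
    · rw [update_self]
      exact hx i
  · rw [update_of_ne (by omega)]
    exact (hv i).2 t (by omega)

/-- The automaton with the states below `K`, initial state `0`, and the given transition and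
acceptance predicates. -/
def BuchiAutomaton.ofStep (K S l : ℕ) (step : ℕ × List ℕ × ℕ → Prop) (acc : ℕ → Prop)
    [DecidablePred step] [DecidablePred acc] : BuchiAutomaton where
  trans := (List.range K).flatMap fun p => (tuples S l).flatMap fun b =>
    (List.range K).flatMap fun q => if step (p, b, q) then [(p, b, q)] else []
  init := [0]
  acc := (List.range K).flatMap fun p => if acc p then [p] else []

theorem BuchiAutomaton.mem_trans_ofStep {K S l : ℕ} {step : ℕ × List ℕ × ℕ → Prop}
    {acc : ℕ → Prop} [DecidablePred step] [DecidablePred acc] {p q : ℕ} {b : List ℕ} :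
    (p, b, q) ∈ (ofStep K S l step acc).trans ↔
      p < K ∧ q < K ∧ b ∈ tuples S l ∧ step (p, b, q) := by
  simp only [ofStep, List.mem_flatMap, List.mem_range]
  constructor
  · rintro ⟨p', hp, b', hb, q', hq, h⟩
    split_ifs at h with h'
    · obtain ⟨rfl, rfl, rfl⟩ : p = p' ∧ b = b' ∧ q = q' := by simpa using h
      exact ⟨hp, hq, hb, h'⟩
    · simp at h
  · rintro ⟨hp, hq, hb, h⟩
    exact ⟨p, hp, b, hb, q, hq, by simp [h]⟩

theorem BuchiAutomaton.mem_acc_ofStep {K S l : ℕ} {step : ℕ × List ℕ × ℕ → Prop}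
    {acc : ℕ → Prop} [DecidablePred step] [DecidablePred acc] {p : ℕ} :
    p ∈ (ofStep K S l step acc).acc ↔ p < K ∧ acc p := by
  simp only [ofStep, List.mem_flatMap, List.mem_range]
  constructor
  · rintro ⟨p', hp, h⟩
    split_ifs at h with h'
    · obtain rfl : p = p' := by simpa using h
      exact ⟨hp, h'⟩
    · simp at h
  · rintro ⟨hp, h⟩
    exact ⟨p, hp, by simp [h]⟩

namespace ER

variable {α : Type*} [Primcodable α] {S n : α → ℕ} {R R' : α → Env → Prop}

theorem of_iff (h : ER S n R) (e : ∀ a v, InEnv (S a) (n a) v → (R a v ↔ R' a v)) : ER S n R' := by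
  obtain ⟨D, h1, h2, h3⟩ := h
  exact ⟨D, h1, fun a M hM v hv => (h2 a M hM v hv).trans (e a v hv), h3⟩

/-- The Σ₁ specification guesses automata for both relations and asks for a certified combination.
Every other Boolean operation is derived from this one. -/
theorem nand (hS : Primrec S) (hn : Primrec n) (h : ER S n R) (h' : ER S n R') :
    ER S n fun a v => ¬ (R a v ∧ R' a v) := by
  obtain ⟨D, h1, h2, h3⟩ := h
  obtain ⟨D', h1', h2', h3'⟩ := h'
  refine ⟨fun x => ∃ m : BuchiAutomaton × BuchiAutomaton, D (x.1, m.1) ∧ D' (x.1, m.2) ∧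
    IsNand (S x.1) (n x.1) x.2 (m.1, List.range (n x.1)) (m.2, List.range (n x.1)), ?_, ?_, ?_⟩
  · refine Sig1.ex (Sig1.and (h1.comp (by fun_prop)) (Sig1.and (h1'.comp (by fun_prop))
      (sig1_isNand ?_ ?_ ?_ ?_ ?_))) <;> fun_prop
  · rintro a M ⟨m, hm, hm', hN⟩ v hv
    rw [hN.at_iff hv]
    exact not_congr (and_congr (h2 a _ hm v hv) (h2' a _ hm' v hv))
  · intro a
    obtain ⟨M₁, hM₁⟩ := h3 a
    obtain ⟨M₂, hM₂⟩ := h3' a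
    obtain ⟨M, hM⟩ := exists_isNand (S a) (n a) (M₁, List.range (n a)) (M₂, List.range (n a))
    exact ⟨M, (M₁, M₂), hM₁, hM₂, hM⟩

theorem not (hS : Primrec S) (hn : Primrec n) (h : ER S n R) : ER S n fun a v => ¬ R a v :=
  (nand hS hn h h).of_iff fun _ _ _ => by rw [and_self_iff]

theorem and (hS : Primrec S) (hn : Primrec n) (h : ER S n R) (h' : ER S n R') :
    ER S n fun a v => R a v ∧ R' a v :=
  (not hS hn (nand hS hn h h')).of_iff fun _ _ _ => not_not

theorem or (hS : Primrec S) (hn : Primrec n) (h : ER S n R) (h' : ER S n R') :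
    ER S n fun a v => R a v ∨ R' a v :=
  (nand hS hn (not hS hn h) (not hS hn h')).of_iff fun _ _ _ => by tauto

theorem imp (hS : Primrec S) (hn : Primrec n) (h : ER S n R) (h' : ER S n R') :
    ER S n fun a v => R a v → R' a v :=
  (nand hS hn h (not hS hn h')).of_iff fun _ _ _ => by tauto

/-- `IsNand` also converts an automaton that reads selected tracks into one that reads all `n`
tracks, but it negates the relation; hence two complementations. -/
theorem at_ (hS : Primrec S) (hn : Primrec n) {M : α → BuchiAutomaton} {ρ : α → List ℕ}
    (hM : Primrec M) (hρ : Primrec ρ) : ER S n fun a v => (M a).At (ρ a) v := by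
  have h : ER S n fun a v => ¬ (M a).At (ρ a) v := by
    refine ⟨fun x => IsNand (S x.1) (n x.1) x.2 (M x.1, ρ x.1) (M x.1, ρ x.1),
      sig1_isNand ?_ ?_ ?_ ?_ ?_, fun a N hN v hv => ?_, fun a => ?_⟩
    any_goals fun_prop
    · rw [hN.at_iff hv, and_self_iff]
    · obtain ⟨N, hN⟩ := exists_isNand (S a) (n a) (M a, ρ a) (M a, ρ a)
      exact ⟨N, hN⟩
  exact (not hS hn h).of_iff fun _ _ _ => not_not

/-- In the premise the quantified word sits on track `n a` of the environment. The condition `hR`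
ensures that `R` sees this track only through its word argument, so that the track can be projected
away. -/
theorem ex (hS : Primrec S) (hn : Primrec n) {R : α → Env → (ℕ → ℕ) → Prop}
    (h : ER S (fun a => n a + 1) fun a v => R a v (v (n a)))
    (hR : ∀ a v v' x, (∀ t < n a, v t = v' t) → (R a v x ↔ R a v' x)) :
    ER S n fun a v => ∃ x : ℕ → ℕ, (∀ i, x i < S a) ∧ R a v x := by
  obtain ⟨D, h1, h2, h3⟩ := h
  refine ⟨fun x => ∃ M, D (x.1, M) ∧ x.2 = M.proj (S x.1) (n x.1), ?_, ?_, fun a => ?_⟩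
  · refine Sig1.ex (Sig1.and (h1.comp (by fun_prop)) (Sig1.of_primrecPred (PrimrecPred.eq ?_
      (primrec_proj ?_ ?_ ?_)))) <;> fun_prop
  · rintro a N ⟨M, hM, hN⟩ v hv
    dsimp only at hM hN ⊢
    rw [hN, proj_at hv]
    refine exists_congr fun x => and_congr_right fun hx => ?_
    rw [h2 a M hM _ (hv.update hx)]
    beta_reduce
    rw [update_self]
    exact hR _ _ _ _ fun t ht => update_of_ne ht.ne _ _
  · obtain ⟨M, hM⟩ := h3 a
    exact ⟨M.proj (S a) (n a), M, hM, rfl⟩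

theorem all (hS : Primrec S) (hn : Primrec n) {R : α → Env → (ℕ → ℕ) → Prop}
    (h : ER S (fun a => n a + 1) fun a v => R a v (v (n a)))
    (hR : ∀ a v v' x, (∀ t < n a, v t = v' t) → (R a v x ↔ R a v' x)) :
    ER S n fun a v => ∀ x : ℕ → ℕ, (∀ i, x i < S a) → R a v x :=
  (not hS hn (ex hS hn (not hS (by fun_prop) h) fun a v v' x e => not_congr (hR a v v' x e))).of_iff
    fun _ _ _ => by push Not; rfl

/-- Validity is certified by showing that an automaton for `R` recognizes the complement of the
empty language. -/
theorem sig1_forall (hS : Primrec S) (hn : Primrec n) (h : ER S n R) :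
    Sig1 fun a => ∀ v, InEnv (S a) (n a) v → R a v := by
  obtain ⟨D, h1, h2, h3⟩ := h
  have h4 : ∀ v, ¬ (BuchiAutomaton.mk [] [] []).At [] v := fun v ⟨q, hq, _⟩ => by simp at hq
  refine Sig1.of_eq (p := fun a => ∃ M, D (a, M) ∧
    IsNand (S a) (n a) M (⟨[], [], []⟩, []) (⟨[], [], []⟩, [])) ?_ fun a => ?_
  · refine Sig1.ex (Sig1.and (h1.comp (by fun_prop)) (sig1_isNand ?_ ?_ ?_ ?_ ?_)) <;> fun_prop
  · constructor
    · rintro ⟨M, hM, hN⟩ v hv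
      rw [← h2 a M hM v hv, hN.at_iff hv]
      exact fun h => h4 v h.1
    · intro h
      obtain ⟨M, hM⟩ := h3 a
      exact ⟨M, hM, isNand_of_at_iff fun v hv =>
        iff_of_true ((h2 a M hM v hv).2 (h v hv)) fun h => h4 v h.1⟩

theorem on₀ (hS : Primrec S) (hn : Primrec n) {M : α → BuchiAutomaton} {k : α → ℕ}
    (hM : Primrec M) (hk : Primrec k) : ER S n fun a v => (M a).On (k a) v [] :=
  (at_ hS hn hM (ρ := fun a => List.range (k a)) (by fun_prop)).of_iff fun a v _ => by
    simp [At, On]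

theorem on₁ (hS : Primrec S) (hn : Primrec n) {M : α → BuchiAutomaton} {k t : α → ℕ}
    (hM : Primrec M) (hk : Primrec k) (ht : Primrec t) :
    ER S n fun a v => (M a).On (k a) v [v (t a)] :=
  (at_ hS hn hM (ρ := fun a => List.range (k a) ++ [t a]) (by fun_prop)).of_iff fun a v _ => by
    simp [At, On, Env.col]

theorem on₂ (hS : Primrec S) (hn : Primrec n) {M : α → BuchiAutomaton} {k t t' : α → ℕ}
    (hM : Primrec M) (hk : Primrec k) (ht : Primrec t) (ht' : Primrec t') :
    ER S n fun a v => (M a).On (k a) v [v (t a), v (t' a)] :=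
  (at_ hS hn hM (ρ := fun a => List.range (k a) ++ [t a, t' a]) (by fun_prop)).of_iff
    fun a v _ => by simp [At, On, Env.col]

/-- A uniform way to write down automata that depend on a parameter: states below `K`, initial state
`0`, primitive recursive transitions and acceptance. -/
theorem run (hS : Primrec S) (hn : Primrec n) {K : α → ℕ} (hK : Primrec K) {ρ : α → List ℕ}
    (hρ : Primrec ρ) {step : α → ℕ × List ℕ × ℕ → Prop} {acc : α → ℕ → Prop}
    (hs : PrimrecPred fun x : α × ℕ × List ℕ × ℕ => step x.1 x.2)
    (ha : PrimrecPred fun x : α × ℕ => acc x.1 x.2) :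
    ER S n fun a v => ∃ q : ℕ → ℕ, q 0 = 0 ∧
      (∀ i, q i < K a ∧ step a (q i, (ρ a).map (v.col i), q (i + 1))) ∧
      ∀ N, ∃ i, N ≤ i ∧ acc a (q i) := by
  classical
  -- The alphabet bound is `S a + 1` because the tracks from `n a` on carry the letter `0`, also
  -- when `S a = 0`.
  refine (at_ hS hn (M := fun a => ofStep (K a) (S a + 1) (ρ a).length (step a) (acc a)) ?_
    hρ).of_iff fun a v hv => ?_
  · have h1 : PrimrecPred fun x : ((α × ℕ) × List ℕ) × ℕ => step x.1.1.1 (x.1.1.2, x.1.2, x.2) :=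
      hs.comp (f := fun x : ((α × ℕ) × List ℕ) × ℕ => (x.1.1.1, x.1.1.2, x.1.2, x.2)) (by fun_prop)
    have h2 : Primrec fun x : ((α × ℕ) × List ℕ) × ℕ =>
        if step x.1.1.1 (x.1.1.2, x.1.2, x.2) then [(x.1.1.2, x.1.2, x.2)] else [] :=
      Primrec.ite h1 (by fun_prop) (by fun_prop)
    have h3 : Primrec fun x : α × ℕ => if acc x.1 x.2 then [x.2] else [] :=
      Primrec.ite ha (by fun_prop) (by fun_prop)
    exact primrec_mk (Primrec.flatMap_apply (by fun_prop) (Primrec.flatMap_apply (by fun_prop)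
      (Primrec.flatMap_apply (by fun_prop) h2))) (by fun_prop)
      (Primrec.flatMap_apply (by fun_prop) h3)
  · have h1 : ∀ t i, v t i < S a + 1 := fun t i => by
      rcases Nat.lt_or_ge t (n a) with h | h
      · exact ((hv i).1 t h).trans (Nat.lt_succ_self _)
      · rw [(hv i).2 t h]; omega
    have h2 : ∀ i, (ρ a).map (v.col i) ∈ tuples (S a + 1) (ρ a).length := fun i =>
      mem_tuples.2 ⟨by simp, fun x hx => by
        obtain ⟨t, -, rfl⟩ := List.mem_map.1 hx
        exact h1 t i⟩
    simp only [At, AcceptsWord, mem_trans_ofStep, mem_acc_ofStep]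
    refine exists_congr fun q => ⟨?_, ?_⟩
    · rintro ⟨h3, h4, h5⟩
      refine ⟨by simpa [ofStep] using h3, fun i => ⟨(h4 i).1, (h4 i).2.2.2⟩, fun N => ?_⟩
      obtain ⟨i, hi, h6⟩ := h5 N
      exact ⟨i, hi, h6.2⟩
    · rintro ⟨h3, h4, h5⟩
      refine ⟨by simpa [ofStep] using h3, fun i => ⟨(h4 i).1, (h4 (i + 1)).1, h2 i, (h4 i).2⟩,
        fun N => ?_⟩
      obtain ⟨i, hi, h6⟩ := h5 N
      exact ⟨i, hi, (h4 i).1, h6⟩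

theorem forall_col (hS : Primrec S) (hn : Primrec n) {ρ : α → List ℕ} (hρ : Primrec ρ)
    {p : α → List ℕ → Prop} (hp : PrimrecPred fun x : α × List ℕ => p x.1 x.2) :
    ER S n fun a v => ∀ i, p a ((ρ a).map (v.col i)) := by
  refine (run hS hn (K := fun _ => 1) (step := fun a x => p a x.2.1) (acc := fun _ _ => True)
    (by fun_prop) hρ
    (hp.comp (f := fun x : α × ℕ × List ℕ × ℕ => (x.1, x.2.2.1)) (by fun_prop)) (PrimrecPred.of_eq (p := fun _ => (0 : ℕ) = 0)
    (by fun_prop) (by simp))).of_iff fun a v _ => ⟨fun ⟨q, h0, h1, _⟩ i => (h1 i).2, fun h =>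
      ⟨fun _ => 0, rfl, fun i => ⟨Nat.one_pos, h i⟩, fun N => ⟨N, le_rfl, trivial⟩⟩⟩

theorem frequently_col (hS : Primrec S) (hn : Primrec n) {ρ : α → List ℕ} (hρ : Primrec ρ)
    {p : α → List ℕ → Prop} (hp : PrimrecPred fun x : α × List ℕ => p x.1 x.2) :
    ER S n fun a v => ∀ N, ∃ i, N ≤ i ∧ p a ((ρ a).map (v.col i)) := by
  classical
  -- The state after a letter is `1` iff `p` holds for this letter, so visits to state `1` lag one
  -- position behind.
  refine (run hS hn (K := fun _ => 2) (step := fun a x => (x.2.2 = 1 ↔ p a x.2.1))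
    (acc := fun _ q => q = 1) (by fun_prop) hρ ?_ (by fun_prop)).of_iff fun a v _ => ⟨?_, ?_⟩
  · exact PrimrecPred.iff (by fun_prop) 
      (hp.comp (f := fun x : α × ℕ × List ℕ × ℕ => (x.1, x.2.2.1)) (by fun_prop))
  · rintro ⟨q, h0, h1, h2⟩ N
    obtain ⟨i, hi, h3⟩ := h2 (N + 1)
    obtain ⟨j, rfl⟩ := Nat.exists_eq_add_of_le' (show 1 ≤ i by omega)
    exact ⟨j, by omega, (h1 j).2.1 h3⟩
  · intro h
    refine ⟨fun i => if 0 < i ∧ p a ((ρ a).map (v.col (i - 1))) then 1 else 0, by simp,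
      fun i => ⟨?_, by simp⟩, fun N => ?_⟩
    · dsimp only
      split_ifs <;> omega
    · obtain ⟨i, hi, h3⟩ := h N
      exact ⟨i + 1, by omega, by simp [h3]⟩

end ER

/-! ### Uncountably many classes -/

open Function

/-- A set of positions (given as a word) that only changes where `H` has letter `1`. -/
def BlockConst (H A : ℕ → ℕ) : Prop := ∀ i, H (i + 1) = 1 ∨ A (i + 1) = A i

/-- The positions marked by `A` are among those marked by `B`, which has infinitely many more. -/
def InfSubset (A B : ℕ → ℕ) : Prop :=
  (∀ i, A i = 1 → B i = 1) ∧ ∀ N, ∃ i, N ≤ i ∧ A i ≠ 1 ∧ B i = 1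

/-- `u` has the letters of `y` at the positions marked by `A` and those of `x` elsewhere. -/
def IsMix (x y A u : ℕ → ℕ) : Prop := ∀ i, u i = if A i = 1 then y i else x i

/-- All words have letters below `S`; there are `x`, `y` and a division into blocks such
that all mixtures satisfy `P`, and those for sets `A ⊆ B` that differ infinitely often are
inequivalent. -/
def Pattern (S : ℕ) (P : (ℕ → ℕ) → Prop) (E : (ℕ → ℕ) → (ℕ → ℕ) → Prop) : Prop :=
  ∃ x : ℕ → ℕ, (∀ i, x i < S) ∧ ∃ y : ℕ → ℕ, (∀ i, y i < S) ∧ ∃ H : ℕ → ℕ, (∀ i, H i < S) ∧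
    ((∀ N, ∃ i, N ≤ i ∧ H (i + 1) = 1) ∧
    (∀ A : ℕ → ℕ, (∀ i, A i < S) → BlockConst H A → ∀ u : ℕ → ℕ, (∀ i, u i < S) →
      IsMix x y A u → P u) ∧
    ∀ A : ℕ → ℕ, (∀ i, A i < S) → BlockConst H A → ∀ B : ℕ → ℕ, (∀ i, B i < S) → BlockConst H B →
      InfSubset A B → ∀ u : ℕ → ℕ, (∀ i, u i < S) → IsMix x y A u →
        ∀ w : ℕ → ℕ, (∀ i, w i < S) → IsMix x y B w → ¬ E u w)

/-- The words agree from some position on. -/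
def EvEq (x y : ℕ → ℕ) : Prop := ∃ N, ∀ i, N ≤ i → x i = y i

theorem BlockConst.eq_of_le {H A : ℕ → ℕ} (h : BlockConst H A) {a b : ℕ} (hab : a ≤ b)
    (hH : ∀ i, a < i → i ≤ b → H i ≠ 1) : A b = A a := by
  induction b, hab using Nat.le_induction with
  | base => rfl
  | succ b hb ih =>
    rw [(h b).resolve_left (hH (b + 1) (by omega) le_rfl)]
    exact ih fun i h1 h2 => hH i h1 (by omega)

namespace Coloring

/-- The environment with two further words. -/
def ext₂ (n : ℕ) (z : Env) (x y : ℕ → ℕ) : Env := update (update z n x) (n + 1) y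

theorem ext₂_fst (n : ℕ) (z : Env) (x y : ℕ → ℕ) : ext₂ n z x y n = x := by simp [ext₂]

theorem ext₂_snd (n : ℕ) (z : Env) (x y : ℕ → ℕ) : ext₂ n z x y (n + 1) = y := by simp [ext₂]

theorem ext₂_of_lt {n t : ℕ} (z : Env) (x y : ℕ → ℕ) (h : t < n) : ext₂ n z x y t = z t := by
  rw [ext₂, update_of_ne (by omega), update_of_ne (by omega)]

theorem seg_ext₂_congr (c : Coloring) {n : ℕ} {z : Env} {x y x' y' : ℕ → ℕ} {a b : ℕ}
    (h1 : ∀ i, a ≤ i → i < b → x i = x' i) (h2 : ∀ i, a ≤ i → i < b → y i = y' i) :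
    c.seg (ext₂ n z x y) a b = c.seg (ext₂ n z x' y') a b := by
  refine c.seg_congr fun i hi hi' t => ?_
  unfold ext₂
  rcases eq_or_ne t (n + 1) with rfl | h
  · simp [h2 i hi hi']
  · rw [update_of_ne h, update_of_ne h]
    rcases eq_or_ne t n with rfl | h
    · simp [h1 i hi hi']
    · rw [update_of_ne h, update_of_ne h]

end Coloring

/-- `y` on the blocks in `A`, `x` on the other ones. -/
noncomputable def IsFact.mix {k : ℕ → ℕ} (hk : IsFact k) (x y : ℕ → ℕ) (A : Set ℕ) (i : ℕ) : ℕ :=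
  open Classical in if hk.blk i ∈ A then y i else x i

namespace IsFact

variable {k : ℕ → ℕ} (hk : IsFact k) {x y : ℕ → ℕ} {A : Set ℕ} {m m' i : ℕ}

include hk in
theorem blk_mem_Ico (h1 : k m ≤ i) (h2 : i < k m') : m ≤ hk.blk i ∧ hk.blk i < m' :=
  ⟨by simpa [hk.blk_apply] using hk.blk_mono h1,
    hk.1.lt_iff_lt.1 (lt_of_le_of_lt (hk.le_blk i) h2)⟩

theorem mix_of_notMem (hA : ∀ j, m ≤ j → j < m' → j ∉ A) (h1 : k m ≤ i) (h2 : i < k m') :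
    hk.mix x y A i = x i := by
  have := hk.blk_mem_Ico h1 h2
  rw [mix, if_neg (hA _ this.1 this.2)]

theorem mix_of_mem (hA : ∀ j, m ≤ j → j < m' → j ∈ A) (h1 : k m ≤ i) (h2 : i < k m') :
    hk.mix x y A i = y i := by
  have := hk.blk_mem_Ico h1 h2
  rw [mix, if_pos (hA _ this.1 this.2)]

end IsFact

/-- A factorization that is homogeneous for the pairs formed from two words, one of which
has the same colour on its blocks, paired with itself, as the other one. -/
structure HomPair (c : Coloring) (n : ℕ) (z : Env) (x y : ℕ → ℕ) (k : ℕ → ℕ) where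
  fact : IsFact k
  s : c.D
  b : c.D
  a : c.D
  start : ∀ i, 1 ≤ i → c.seg (Coloring.ext₂ n z x x) 0 (k i) = s
  xx : ∀ i j, 1 ≤ i → i < j → c.seg (Coloring.ext₂ n z x x) (k i) (k j) = b
  yy : ∀ i j, 1 ≤ i → i < j → c.seg (Coloring.ext₂ n z y y) (k i) (k j) = b
  xy : ∀ i j, 1 ≤ i → i < j → c.seg (Coloring.ext₂ n z x y) (k i) (k j) = a

namespace HomPair

variable {c : Coloring} {n : ℕ} {z : Env} {x y k : ℕ → ℕ} (h : HomPair c n z x y k)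
  {A B : Set ℕ} {m m' : ℕ}

noncomputable def pair (A B : Set ℕ) : Env := Coloring.ext₂ n z (h.fact.mix x y A) (h.fact.mix x y B)

theorem mul_bb : c.mul h.b h.b = h.b := by
  have := c.seg_mul (Coloring.ext₂ n z x x) (h.fact.1.monotone (show 1 ≤ 2 by omega))
    (h.fact.1.monotone (show 2 ≤ 3 by omega))
  rwa [h.xx 1 2 le_rfl (by omega), h.xx 2 3 (by omega) (by omega),
    h.xx 1 3 le_rfl (by omega)] at this

theorem mul_sb : c.mul h.s h.b = h.s := by
  have := c.seg_mul (Coloring.ext₂ n z x x) (Nat.zero_le _)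
    (h.fact.1.monotone (show 1 ≤ 2 by omega))
  rwa [h.start 1 le_rfl, h.xx 1 2 le_rfl (by omega), h.start 2 (by omega)] at this

theorem seg_pair_a (hm : 1 ≤ m) (hmm : m < m') (hA : ∀ j, m ≤ j → j < m' → j ∉ A)
    (hB : ∀ j, m ≤ j → j < m' → j ∈ B) : c.seg (h.pair A B) (k m) (k m') = h.a := by
  rw [← h.xy m m' hm hmm]
  exact c.seg_ext₂_congr (fun i => h.fact.mix_of_notMem hA) fun i => h.fact.mix_of_mem hB

/-- Where `A` and `B` agree, each block carries the pair `(x, x)` or `(y, y)`. Both have colour `b`,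
and `b` is idempotent. -/
theorem seg_pair_b (hm : 1 ≤ m) (hmm : m < m') (hA : ∀ j, m ≤ j → j < m' → (j ∈ A ↔ j ∈ B)) :
    c.seg (h.pair A B) (k m) (k m') = h.b := by
  induction m', hmm using Nat.le_induction with
  | base =>
    by_cases hm' : m ∈ A
    · rw [← h.yy m (m + 1) hm (by omega)]
      have h1 : ∀ j, m ≤ j → j < m + 1 → j = m := by omega
      refine c.seg_ext₂_congr (fun i => h.fact.mix_of_mem fun j h2 h3 => ?_) fun i =>
        h.fact.mix_of_mem fun j h2 h3 => ?_
      · rwa [h1 j h2 h3]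
      · rwa [h1 j h2 h3, ← hA m le_rfl (by omega)]
    · rw [← h.xx m (m + 1) hm (by omega)]
      have h1 : ∀ j, m ≤ j → j < m + 1 → j = m := by omega
      refine c.seg_ext₂_congr (fun i => h.fact.mix_of_notMem fun j h2 h3 => ?_) fun i =>
        h.fact.mix_of_notMem fun j h2 h3 => ?_
      · rwa [h1 j h2 h3]
      · rwa [h1 j h2 h3, ← hA m le_rfl (by omega)]
  | succ m' hm' ih =>
    rw [← c.seg_mul _ (h.fact.1.monotone (show m ≤ m' by omega)) (h.fact.lt_succ m').le,
      ih fun j h1 h2 => hA j h1 (by omega)]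
    nth_rewrite 2 [← h.mul_bb]
    congr 1
    by_cases hm'' : m' ∈ A
    · rw [← h.yy m' (m' + 1) (by omega) (by omega)]
      have h1 : ∀ j, m' ≤ j → j < m' + 1 → j = m' := by omega
      refine c.seg_ext₂_congr (fun i => h.fact.mix_of_mem fun j h2 h3 => ?_) fun i =>
        h.fact.mix_of_mem fun j h2 h3 => ?_
      · rwa [h1 j h2 h3]
      · rwa [h1 j h2 h3, ← hA m' (by omega) (by omega)]
    · rw [← h.xx m' (m' + 1) (by omega) (by omega)]
      have h1 : ∀ j, m' ≤ j → j < m' + 1 → j = m' := by omega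
      refine c.seg_ext₂_congr (fun i => h.fact.mix_of_notMem fun j h2 h3 => ?_) fun i =>
        h.fact.mix_of_notMem fun j h2 h3 => ?_
      · rwa [h1 j h2 h3]
      · rwa [h1 j h2 h3, ← hA m' (by omega) (by omega)]

/-- Block `0` must carry `(x, x)`, as the homogeneity data say nothing about other pairs before `k
1`. -/
theorem seg_pair_s (hm : 1 ≤ m) (h0 : 0 ∉ A) (hA : ∀ j < m, (j ∈ A ↔ j ∈ B)) :
    c.seg (h.pair A B) 0 (k m) = h.s := by
  have h1 : c.seg (h.pair A B) 0 (k 1) = h.s := by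
    rw [← h.start 1 le_rfl]
    have h3 : k 0 ≤ 0 := h.fact.2.le
    refine c.seg_ext₂_congr (fun i _ => h.fact.mix_of_notMem (m := 0) (fun j _ hj => ?_) ?_)
      fun i _ => h.fact.mix_of_notMem (m := 0) (fun j _ hj => ?_) ?_
    · rwa [show j = 0 by omega]
    · omega
    · rwa [show j = 0 by omega, ← hA 0 hm]
    · omega
  rcases hm.eq_or_lt with rfl | hm'
  · exact h1
  · rw [← c.seg_mul _ (Nat.zero_le _) (h.fact.1.monotone hm), h1,
      h.seg_pair_b le_rfl hm' fun j _ => hA j, h.mul_sb]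

/-- The sequence of block colours is `s (ab)^ω` for a factorization coarser than `k`. -/
def Alternates (A B : Set ℕ) (d : ℕ → ℕ) : Prop :=
  StrictMono d ∧ 1 ≤ d 0 ∧ c.seg (h.pair A B) 0 (k (d 0)) = h.s ∧
    ∀ j, c.seg (h.pair A B) (k (d j)) (k (d (j + 1))) = c.mul h.a h.b

/-- The factorizations with ends `0, k (d 0), k (d 1), …` and their primed counterparts have the
same block colours `s, ab, ab, …`, so a saturated relation cannot tell the two pairs apart. -/
theorem Alternates.iff {R : Env → Prop} (hc : c.Saturates R) {A B A' B' : Set ℕ} {d d' : ℕ → ℕ}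
    (h1 : h.Alternates A B d) (h2 : h.Alternates A' B' d') :
    R (h.pair A B) ↔ R (h.pair A' B') := by
  have hf : ∀ d : ℕ → ℕ, StrictMono d → 1 ≤ d 0 →
      IsFact fun i => if i = 0 then 0 else k (d (i - 1)) := fun d hd hd0 => by
    refine ⟨strictMono_nat_of_lt_succ fun i => ?_, by simp⟩
    rcases Nat.eq_zero_or_pos i with rfl | hi
    · simp only [if_true, zero_add, one_ne_zero, if_false]
      have := h.fact.1 (show 0 < d 0 by omega)
      rw [h.fact.2] at this
      exact this
    · rw [if_neg hi.ne', if_neg (by omega)]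
      exact h.fact.1 (hd (by omega))
  refine hc.iff (hf d h1.1 h1.2.1) (hf d' h2.1 h2.2.1) fun i => ?_
  rcases Nat.eq_zero_or_pos i with rfl | hi
  · simp only [if_true, zero_add, one_ne_zero, if_false]
    exact h1.2.2.1.trans h2.2.2.1.symm
  · rw [if_neg hi.ne', if_neg hi.ne', if_neg (by omega), if_neg (by omega)]
    obtain ⟨j, rfl⟩ := Nat.exists_eq_add_of_le' hi
    exact (h1.2.2.2 j).trans (h2.2.2.2 j).symm

/-- The residue condition separates the members of `B \ A`: each contributes one block of colour
`a`, followed by at least one block where `A` and `B` agree, of colour `b`. -/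
theorem alternates_of_infinite (hAB : A ⊆ B) (hB : ∀ i ∈ B, i % 3 = 2) (hinf : (B \ A).Infinite) :
    ∃ d, h.Alternates A B d := by
  have hd := Nat.nth_strictMono (p := (· ∈ B \ A)) hinf
  have hmem : ∀ j, Nat.nth (· ∈ B \ A) j ∈ B \ A := fun j => Nat.nth_mem_of_infinite hinf j
  have h3 : ∀ j, Nat.nth (· ∈ B \ A) j % 3 = 2 := fun j => hB _ (hmem j).1
  have h1 : ∀ j, 1 ≤ Nat.nth (· ∈ B \ A) j := fun j => by
    have := h3 j
    omega
  have hex : ∀ i ∈ B, i ∉ A → ∃ l, Nat.nth (· ∈ B \ A) l = i := fun i hi hi' => by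
    obtain ⟨l, -, hl⟩ := Nat.exists_lt_card_nth_eq (p := (· ∈ B \ A)) ⟨hi, hi'⟩
    exact ⟨l, hl⟩
  refine ⟨Nat.nth (· ∈ B \ A), hd, h1 0, ?_, fun j => ?_⟩
  · refine h.seg_pair_s (h1 0) (fun h0 => ?_) fun j hj => ⟨fun h => hAB h, fun hjB => ?_⟩
    · have := hB _ (hAB h0)
      omega
    · by_contra hjA
      obtain ⟨l, rfl⟩ := hex j hjB hjA
      exact Nat.not_lt_zero _ ((Nat.nth_lt_nth hinf).1 hj)
  · have h4 := hd (Nat.lt_succ_self j)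
    have h5 := h3 j
    have h6 := h3 (j + 1)
    have h7 : Nat.nth (· ∈ B \ A) j + 1 < Nat.nth (· ∈ B \ A) (j + 1) := by
      rw [Nat.succ_eq_add_one] at h4
      omega
    rw [← c.seg_mul _ (h.fact.lt_succ _).le (h.fact.1.monotone h7.le)]
    congr 1
    · refine h.seg_pair_a (h1 j) (Nat.lt_succ_self _) (fun i hi hi' => ?_) fun i hi hi' => ?_
      · rw [show i = Nat.nth (· ∈ B \ A) j by omega]; exact (hmem j).2
      · rw [show i = Nat.nth (· ∈ B \ A) j by omega]; exact (hmem j).1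
    · refine h.seg_pair_b (by omega) h7 fun i hi hi' => ⟨fun h => hAB h, fun hiB => ?_⟩
      by_contra hiA
      obtain ⟨l, rfl⟩ := hex i hiB hiA
      have h8 := (Nat.nth_lt_nth hinf).1 hi'
      have h9 := (Nat.nth_lt_nth hinf).1 (show Nat.nth (· ∈ B \ A) j < _ from hi)
      omega

/-- A second realization of `s (ab)^ω`: in each period the sets differ on two consecutive blocks,
which together have colour `a`, and agree on the third. Its right component is eventually equal to
`y`. -/
theorem alternates_last : h.Alternates {i | i % 3 = 2} {i | 2 ≤ i} fun j => 3 * j + 3 := by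
  refine ⟨strictMono_nat_of_lt_succ fun j => by omega, by simp, ?_,
    fun j => ?_⟩
  · refine h.seg_pair_s (by simp) (by simp) fun j hj => ?_
    simp only [Set.mem_ofPred_eq] at hj ⊢
    omega
  · rw [← c.seg_mul _ (h.fact.1.monotone (show 3 * j + 3 ≤ 3 * j + 5 by omega))
      (h.fact.1.monotone (show 3 * j + 5 ≤ 3 * (j + 1) + 3 by omega))]
    congr 1
    · refine h.seg_pair_a (by omega) (by omega) (fun i hi hi' => ?_) fun i hi hi' => ?_ <;>
        simp only [Set.mem_ofPred_eq] <;> omega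
    · refine h.seg_pair_b (by omega) (by omega) fun i hi hi' => ?_
      simp only [Set.mem_ofPred_eq]
      omega

theorem iff_of_diag {R : Env → Prop} (hc : c.Saturates R) (h0 : 0 ∉ A) :
    R (h.pair A A) ↔ R (h.pair ∅ ∅) := by
  refine hc.iff h.fact h.fact fun i => ?_
  rcases Nat.eq_zero_or_pos i with rfl | hi
  · rw [h.fact.2, h.seg_pair_s (m := 1) le_rfl h0 fun _ _ => Iff.rfl,
      h.seg_pair_s (m := 1) le_rfl (by simp) fun _ _ => Iff.rfl]
  · rw [h.seg_pair_b hi (Nat.lt_succ_self i) fun _ _ _ => Iff.rfl,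
      h.seg_pair_b hi (Nat.lt_succ_self i) fun _ _ _ => Iff.rfl]

end HomPair

theorem IsFact.mix_empty {k : ℕ → ℕ} (hk : IsFact k) (x y : ℕ → ℕ) : hk.mix x y ∅ = x :=
  funext fun i => by simp [IsFact.mix]

/-- If two mixtures with infinite nested difference were equivalent, their colours `s (ab)^ω` would
force two further equivalences: `x` with the mixture on the residue class `2` modulo `3`, and this
mixture with one that is eventually `y`. By transitivity `x` would be equivalent to a finite variant
of `y`, contrary to `hne`. -/
theorem HomPair.pattern {c : Coloring} {n : ℕ} {z : Env} {x y k : ℕ → ℕ}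
    (h : HomPair c n z x y k) {S : ℕ} (hS : 2 ≤ S) {P : Env → (ℕ → ℕ) → Prop}
    {E : Env → (ℕ → ℕ) → (ℕ → ℕ) → Prop} (hP : c.Saturates fun v => P v (v n))
    (hE : c.Saturates fun v => E v (v n) (v (n + 1)))
    (hP' : ∀ z z', (∀ t < n, z t = z' t) → P z = P z')
    (hE' : ∀ z z', (∀ t < n, z t = z' t) → E z = E z') (hx : ∀ i, x i < S) (hy : ∀ i, y i < S)
    (hPx : P z x) (htr : ∀ u v w, E z u v → E z v w → E z u w)
    (hne : ∀ y', EvEq y' y → ¬ E z x y') : Pattern S (P z) (E z) := by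
  classical
  have hE2 : ∀ A B, E (h.pair A B) (h.pair A B n) (h.pair A B (n + 1)) ↔
      E z (h.fact.mix x y A) (h.fact.mix x y B) := fun A B => by
    rw [pair, Coloring.ext₂_fst, Coloring.ext₂_snd,
      hE' _ z fun t ht => Coloring.ext₂_of_lt _ _ _ ht]
  have hP2 : ∀ A, P (h.pair A A) (h.pair A A n) ↔ P z (h.fact.mix x y A) := fun A => by
    rw [pair, Coloring.ext₂_fst, hP' _ z fun t ht => Coloring.ext₂_of_lt _ _ _ ht]
  have hlt : ∀ A i, h.fact.mix x y A i < S := fun A i => by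
    unfold IsFact.mix
    split_ifs
    exacts [hy i, hx i]
  -- The pattern uses the words `x` and the mixture on `U`. The letter `1` in `H` starts a group of
  -- three blocks `3m + 1, 3m + 2, 3m + 3`, of which only the middle one distinguishes the two
  -- words; `T A` collects the middle blocks that `A` marks.
  let U : Set ℕ := {i | i % 3 = 2}
  let H : ℕ → ℕ := fun i => if ∃ m, i = k (3 * m + 1) then 1 else 0
  let T : (ℕ → ℕ) → Set ℕ := fun A => {q | q % 3 = 2 ∧ A (k (q - 1)) = 1}
  have hT : ∀ A, BlockConst H A → ∀ i, h.fact.blk i ≠ 0 →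
      A i = A (k (3 * ((h.fact.blk i - 1) / 3) + 1)) := fun A hA i hi => by
    have h1 := h.fact.le_blk i
    have h2 := h.fact.lt_blk i
    refine hA.eq_of_le (le_trans (h.fact.1.monotone (by omega)) h1) fun j hj hj' => ?_
    have : ¬ ∃ m, j = k (3 * m + 1) := by
      rintro ⟨m, rfl⟩
      have h3 := h.fact.1.lt_iff_lt.1 hj
      have h4 := h.fact.1.lt_iff_lt.1 (lt_of_le_of_lt hj' h2)
      omega
    simp only [H, if_neg this]
    omega
  have hmix : ∀ A, BlockConst H A → ∀ u, IsMix x (h.fact.mix x y U) A u →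
      u = h.fact.mix x y (T A) := fun A hA u hu => by
    funext i
    rw [hu i]
    by_cases h1 : h.fact.blk i % 3 = 2
    · have h2 : h.fact.blk i ∈ T A ↔ A i = 1 := by
        rw [hT A hA i (by omega)]
        have : 3 * ((h.fact.blk i - 1) / 3) + 1 = h.fact.blk i - 1 := by omega
        rw [this]
        exact and_iff_right h1
      have h3 : h.fact.blk i ∈ U := h1
      simp only [IsFact.mix, h2, h3, if_true]
    · have h2 : h.fact.blk i ∉ T A := fun h => h1 h.1
      have h3 : h.fact.blk i ∉ U := h1
      simp only [IsFact.mix, h2, h3, if_false, ite_self]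
  refine ⟨x, hx, _, hlt U, H, fun i => ?_, fun N => ?_, fun A hA hA' u hu hu' => ?_,
    fun A hA hA' B hB hB' hAB u hu hu' w hw hw' hEuw => ?_⟩
  · simp only [H]
    split_ifs <;> omega
  · have h1 : N < k (3 * N + 1) := lt_of_lt_of_le (show N < 3 * N + 1 by omega) (h.fact.1.id_le _)
    exact ⟨k (3 * N + 1) - 1, by omega, if_pos ⟨N, by omega⟩⟩
  · rw [hmix A hA' u hu', ← hP2, h.iff_of_diag hP (by simp [T]), hP2, IsFact.mix_empty]
    exact hPx
  · rw [hmix A hA' u hu', hmix B hB' w hw', ← hE2] at hEuw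
    obtain ⟨d, hd⟩ := h.alternates_of_infinite (A := T A) (B := T B)
      (fun q hq => ⟨hq.1, hAB.1 _ hq.2⟩) (fun q hq => hq.1) (by
        refine Set.infinite_of_not_bddAbove fun ⟨N, hN⟩ => ?_
        obtain ⟨i, hi, hi1, hi2⟩ := hAB.2 (k (3 * N + 4))
        have h1 : 3 * N + 4 ≤ h.fact.blk i := by
          simpa [h.fact.blk_apply] using h.fact.blk_mono hi
        rw [hT A hA' i (by omega)] at hi1
        rw [hT B hB' i (by omega)] at hi2
        have h2 := hN (a := 3 * ((h.fact.blk i - 1) / 3) + 2)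
          ⟨⟨by omega, hi2⟩, fun h3 => hi1 h3.2⟩
        omega)
    obtain ⟨d', hd'⟩ := h.alternates_of_infinite (A := ∅) (B := U) (by simp) (fun q hq => hq) (by
        refine Set.infinite_of_not_bddAbove fun ⟨N, hN⟩ => ?_
        have h2 := hN (a := 3 * N + 2) ⟨show (3 * N + 2) % 3 = 2 by omega, by simp⟩
        omega)
    -- The two equivalences whose composition contradicts `hne`.
    have h1 := (hd.iff h hE hd').1 hEuw
    have h2 := (hd.iff h hE h.alternates_last).1 hEuw
    rw [hE2] at h1 h2
    rw [IsFact.mix_empty] at h1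
    refine hne _ ⟨k 2, fun i hi => ?_⟩ (htr _ _ _ h1 h2)
    refine if_pos ?_
    simpa [h.fact.blk_apply] using h.fact.blk_mono hi

/-- Without a pattern, boundedly many words represent all classes up to finitely many letters. -/
theorem exists_bound {n : ℕ} {P : Env → (ℕ → ℕ) → Prop}
    {E : Env → (ℕ → ℕ) → (ℕ → ℕ) → Prop} (hP : Sat fun v => P v (v n))
    (hE : Sat fun v => E v (v n) (v (n + 1)))
    (hP' : ∀ z z', (∀ t < n, z t = z' t) → P z = P z')
    (hE' : ∀ z z', (∀ t < n, z t = z' t) → E z = E z') :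
    ∃ C : ℕ, ∀ (S : ℕ) (z : Env), 2 ≤ S → (∀ x, P z x → ∀ i, x i < S) →
      (∀ u v w, E z u v → E z v w → E z u w) → ¬ Pattern S (P z) (E z) →
      ∃ l : List (ℕ → ℕ), l.length ≤ C ∧ (∀ x ∈ l, P z x) ∧
        ∀ x, P z x → ∃ y ∈ l, ∃ y', EvEq y' y ∧ E z x y' := by
  obtain ⟨c, hc⟩ := Sat.exists_common (ι := Bool) (R := fun b => cond b (fun v => P v (v n))
    fun v => E v (v n) (v (n + 1))) (fun b => by cases b <;> assumption)
  have := c.fin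
  -- The bound is the number of colours. It depends neither on the alphabet nor on `z`, so the
  -- representatives can later be coded over one finite alphabet.
  refine ⟨Nat.card c.D, fun S z hS hlt htr hpat => ?_⟩
  by_contra! hcon
  -- If no short list suffices, a list of one more word than there are colours can be built, no
  -- entry being equivalent to a finite variant of a later one.
  have h1 : ∀ j ≤ Nat.card c.D + 1, ∃ l : List (ℕ → ℕ), l.length = j ∧ (∀ x ∈ l, P z x) ∧
      l.Pairwise fun x y => ∀ y', EvEq y' y → ¬ E z x y' := fun j => by
    induction j with
    | zero => exact fun _ => ⟨[], by simp⟩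
    | succ j ih =>
      intro hj
      obtain ⟨l, hl, hlP, hlE⟩ := ih (by omega)
      obtain ⟨x, hx, hx'⟩ := hcon l (by omega) hlP
      exact ⟨x :: l, by simp [hl], by simpa using ⟨hx, hlP⟩, List.pairwise_cons.2 ⟨hx', hlE⟩⟩
  obtain ⟨l, hl, hlP, hlE⟩ := h1 _ le_rfl
  obtain ⟨k, hk, s, e, hs, he⟩ := exists_fact_homogeneous
    fun a b => fun p : Fin l.length × Fin l.length => c.seg (Coloring.ext₂ n z l[p.1] l[p.2]) a b
  -- Pigeonhole on the diagonal colours: two of the words, each paired with itself, have the same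
  -- homogeneous colour, as `HomPair` requires.
  obtain ⟨i, j, hij, hije⟩ : ∃ i j : Fin l.length, i < j ∧ e (i, i) = e (j, j) := by
    have := Fintype.ofFinite c.D
    obtain ⟨i, j, hij, h⟩ := Fintype.exists_ne_map_eq_of_card_lt
      (fun i : Fin l.length => e (i, i)) (by simp [hl])
    rcases lt_or_gt_of_ne hij with h' | h'
    · exact ⟨i, j, h', h⟩
    · exact ⟨j, i, h', h.symm⟩
  refine hpat (HomPair.pattern (x := l[i]) (y := l[j]) ⟨hk, s (i, i), e (i, i), e (i, j),
    fun m hm => congrFun (hs m hm) (i, i), fun m m' hm hm' => congrFun (he m m' hm hm') (i, i),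
    fun m m' hm hm' => (congrFun (he m m' hm hm') (j, j)).trans hije.symm,
    fun m m' hm hm' => congrFun (he m m' hm hm') (i, j)⟩ hS (hc true) (hc false) hP' hE' ?_ ?_ ?_ htr
    ?_)
  · exact hlt _ (hlP _ (List.getElem_mem _))
  · exact hlt _ (hlP _ (List.getElem_mem _))
  · exact hlP _ (List.getElem_mem _)
  · exact List.pairwise_iff_getElem.1 hlE i j i.2 j.2 hij

/-! ### Cardinalities of sets given by names -/

open Function

/-- `P` is a set of words with letters below `S` that is closed under the equivalence `E`, and `g`
names the classes. -/
structure Names {A : Type*} (S : ℕ) (P : (ℕ → ℕ) → Prop) (E : (ℕ → ℕ) → (ℕ → ℕ) → Prop)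
    (g : (ℕ → ℕ) → A) : Prop where
  lt : ∀ x, P x → ∀ i, x i < S
  iff : ∀ x y, P x → P y → (E x y ↔ g x = g y)
  closed : ∀ x y, E x y → P x → P y
  two_le : 2 ≤ S

/-- `x` witnesses that infinitely many classes contain words that are eventually equal to `x`. -/
def InfNear (S : ℕ) (P : (ℕ → ℕ) → Prop) (E : (ℕ → ℕ) → (ℕ → ℕ) → Prop) : Prop :=
  ∃ x : ℕ → ℕ, (∀ i, x i < S) ∧ ∀ T : ℕ → ℕ, (∀ i, T i < S) → (¬ ∀ N, ∃ i, N ≤ i ∧ T i ≠ 1) →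
    ∃ y : ℕ → ℕ, (∀ i, y i < S) ∧ (P y ∧ (¬ ∀ N, ∃ i, N ≤ i ∧ y i ≠ x i) ∧
      ∀ y' : ℕ → ℕ, (∀ i, y' i < S) → (∀ i, T i = 1 → y' i = x i) → ¬ E y y')

theorem evEq_iff {x y : ℕ → ℕ} : EvEq x y ↔ ¬ ∀ N, ∃ i, N ≤ i ∧ x i ≠ y i := by
  simp only [EvEq]
  push Not
  rfl

namespace Names

variable {A : Type*} {S : ℕ} {P : (ℕ → ℕ) → Prop} {E : (ℕ → ℕ) → (ℕ → ℕ) → Prop}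
  {g : (ℕ → ℕ) → A} (h : Names S P E g)

theorem infinite_rat (e : ℕ ≃ ℚ) (r r' : ℝ) (hr : r < r') :
    {k : ℕ | r ≤ (e k : ℝ) ∧ (e k : ℝ) < r'}.Infinite := by
  obtain ⟨p, hp, hp'⟩ := exists_rat_btwn hr
  obtain ⟨q, hq, hq'⟩ := exists_rat_btwn hp'
  have h1 : (Set.Ioo p q).Infinite := Set.Ioo_infinite (by exact_mod_cast hq)
  have h2 := h1.preimage (f := e) fun a _ => e.surjective a
  refine h2.mono fun k hk => ?_
  have h3 : (p : ℝ) < (e k : ℝ) := by exact_mod_cast hk.1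
  have h4 : (e k : ℝ) < (q : ℝ) := by exact_mod_cast hk.2
  exact ⟨(hp.trans h3).le, h4.trans hq'⟩

-- Dedekind cuts: blocks are numbered by rationals, and a real `r` selects those with number below
-- `r`. For `r < r'` the selections are nested with infinite difference, so distinct reals give
-- inequivalent mixtures.
include h in
theorem not_countable_of_pattern (hp : Pattern S P E) : ¬ (g '' {x | P x}).Countable := by
  classical
  obtain ⟨x, hx, y, hy, H, hH, hinf, h1, h2⟩ := hp
  have hS := h.two_le
  let e : ℕ ≃ ℚ := (Denumerable.eqv ℚ).symm
  let p : ℕ → Prop := fun i => H (i + 1) = 1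
  have hp : (Set.ofPred p).Infinite := by
    refine Set.infinite_of_not_bddAbove fun ⟨N, hN⟩ => ?_
    obtain ⟨i, hi, hi'⟩ := hinf (N + 1)
    have : i ≤ N := hN hi'
    omega
  -- `Nat.count p i` is the number of the block of `i`, since `p` holds at the last position before
  -- a new block.
  let B : ℝ → ℕ → ℕ := fun r i => if (e (Nat.count p i) : ℝ) < r then 1 else 0
  have hB1 : ∀ r i, B r i = 1 ↔ (e (Nat.count p i) : ℝ) < r := fun r i => by
    simp only [B]
    split_ifs with h
    · exact iff_of_true rfl h
    · exact iff_of_false not_false h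
  have hBS : ∀ r i, B r i < S := fun r i => by
    simp only [B]
    split_ifs <;> omega
  have hBC : ∀ r, BlockConst H (B r) := fun r i => by
    by_cases hi : p i
    · exact Or.inl hi
    · refine Or.inr ?_
      simp only [B, Nat.count_succ, if_neg hi, add_zero]
  let u : ℝ → ℕ → ℕ := fun r i => if B r i = 1 then y i else x i
  have hu : ∀ r, IsMix x y (B r) (u r) := fun r i => rfl
  have huS : ∀ r i, u r i < S := fun r i => by
    simp only [u]
    split_ifs
    exacts [hy i, hx i]
  have hPu : ∀ r, P (u r) := fun r => h1 _ (hBS r) (hBC r) _ (huS r) (hu r)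
  have hlt : ∀ r r', r < r' → g (u r) ≠ g (u r') := fun r r' hr => by
    rw [ne_eq, ← h.iff _ _ (hPu r) (hPu r')]
    refine h2 _ (hBS r) (hBC r) _ (hBS r') (hBC r') ⟨fun i hi => ?_, fun N => ?_⟩ _ (huS r) (hu r)
      _ (huS r') (hu r')
    · rw [hB1] at hi ⊢
      exact hi.trans hr
    · obtain ⟨k, hk, hk'⟩ := (infinite_rat e r r' hr).exists_gt N
      refine ⟨Nat.nth p k, hk'.le.trans ((Nat.nth_strictMono hp).id_le k), ?_, ?_⟩
      · rw [ne_eq, hB1, Nat.count_nth_of_infinite hp]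
        exact not_lt.2 hk.1
      · rw [hB1, Nat.count_nth_of_infinite hp]
        exact hk.2
  have hinj : Injective fun r => g (u r) := fun r r' hr => by
    rcases lt_trichotomy r r' with h | h | h
    · exact absurd hr (hlt r r' h)
    · exact h
    · exact absurd hr.symm (hlt r' r h)
  intro hc
  refine Cardinal.not_countable_real ((hc.preimage_of_injOn hinj.injOn).mono fun r _ => ?_)
  exact ⟨u r, hPu r, rfl⟩

theorem countable_evEq (x : ℕ → ℕ) : {y | EvEq y x}.Countable := by
  refine (Set.countable_range fun l : List ℕ => fun i => l.getD i (x i)).mono ?_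
  rintro y ⟨N, hN⟩
  refine ⟨(List.range N).map y, funext fun i => ?_⟩
  rcases Nat.lt_or_ge i N with hi | hi
  · simp [hi]
  · simp [hi, hN i hi]

include h in
theorem countable_of_list {l : List (ℕ → ℕ)}
    (hl : ∀ x, P x → ∃ y ∈ l, ∃ y', EvEq y' y ∧ E x y') : (g '' {x | P x}).Countable := by
  have h1 : (⋃ y ∈ {y | y ∈ l}, {y' | EvEq y' y}).Countable :=
    l.finite_toSet.countable.biUnion fun y _ => countable_evEq y
  refine (h1.image g).mono ?_
  rintro _ ⟨x, hx, rfl⟩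
  obtain ⟨y, hy, y', hy', hE⟩ := hl x hx
  exact ⟨y', Set.mem_biUnion hy hy', ((h.iff _ _ hx (h.closed _ _ hE hx)).1 hE).symm⟩

theorem finite_agree (S : ℕ) (x T : ℕ → ℕ) (hT : ¬ ∀ N, ∃ i, N ≤ i ∧ T i ≠ 1) :
    {y : ℕ → ℕ | (∀ i, y i < S) ∧ ∀ i, T i = 1 → y i = x i}.Finite := by
  push Not at hT
  obtain ⟨N, hN⟩ := hT
  refine Set.Finite.of_finite_image (f := fun y => fun i : Fin N => y i) ?_ ?_
  · refine (Set.Finite.pi' fun _ : Fin N => Set.finite_Iio S).subset ?_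
    rintro _ ⟨y, hy, rfl⟩ i
    exact hy.1 i
  · intro y hy y' hy' e
    funext i
    rcases Nat.lt_or_ge i N with hi | hi
    · exact congrFun e ⟨i, hi⟩
    · rw [hy.2 i (hN i hi), hy'.2 i (hN i hi)]

include h in
/-- The representatives of finitely many classes near `x` agree with `x` on a common cofinite
set. -/
theorem exists_common_agree {x : ℕ → ℕ} {Y : Set (ℕ → ℕ)} (hY : ∀ y ∈ Y, P y ∧ ∃ y', EvEq y' x ∧ E y y')
    (hfin : (g '' Y).Finite) : ∃ N, ∀ y ∈ Y, ∃ y', (∀ i, N ≤ i → y' i = x i) ∧ E y y' := by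
  have h1 : ∀ a ∈ g '' Y, ∃ N, ∀ y ∈ Y, g y = a → ∃ y', (∀ i, N ≤ i → y' i = x i) ∧ E y y' := by
    rintro _ ⟨y, hy, rfl⟩
    obtain ⟨hPy, y', ⟨N, hN⟩, hE⟩ := hY y hy
    refine ⟨N, fun w hw hwy => ⟨y', hN, ?_⟩⟩
    have hPy' := h.closed _ _ hE hPy
    rw [h.iff _ _ (hY w hw).1 hPy', hwy]
    exact (h.iff _ _ hPy hPy').1 hE
  choose! N hN using h1
  obtain ⟨B, hB⟩ := (hfin.image N).bddAbove
  refine ⟨B, fun y hy => ?_⟩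
  have h2 : g y ∈ g '' Y := ⟨y, hy, rfl⟩
  obtain ⟨y', hy', hE⟩ := hN _ h2 y hy rfl
  exact ⟨y', fun i hi => hy' i (le_trans (hB ⟨_, h2, rfl⟩) hi), hE⟩

-- With finitely many classes, the classes near `x` have representatives that agree with `x` beyond
-- a common `N`; taking `T` to be `[N, ∞)` contradicts `InfNear`.
include h in
theorem infinite_of_infNear (hi : InfNear S P E) : (g '' {x | P x}).Infinite := by
  classical
  obtain ⟨x, hx, hx'⟩ := hi
  intro hfin
  obtain ⟨N, hN⟩ := h.exists_common_agree (x := x) (Y := {y | P y ∧ ∃ y', EvEq y' x ∧ E y y'})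
    (fun y hy => hy) (hfin.subset (Set.image_mono fun y hy => hy.1))
  have hS := h.two_le
  obtain ⟨y, hy, hPy, hyx, hyE⟩ := hx' (fun i => if N ≤ i then 1 else 0)
    (fun i => by split_ifs <;> omega)
    (by push Not; exact ⟨N, fun i hi => if_pos hi⟩)
  obtain ⟨y', hy', hE⟩ := hN y ⟨hPy, y, evEq_iff.2 hyx, (h.iff _ _ hPy hPy).2 rfl⟩
  refine hyE y' (h.lt _ (h.closed _ _ hE hPy)) (fun i hi => hy' i ?_) hE
  by_contra hiN
  rw [if_neg hiN] at hi
  omega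

-- Some word `x` of the finite list has finite variants in infinitely many classes. For a cofinite
-- `T` only finitely many words agree with `x` on `T`, so they miss one of these classes.
include h in
theorem infNear_of_infinite {l : List (ℕ → ℕ)} (hlP : ∀ x ∈ l, P x)
    (hl : ∀ x, P x → ∃ y ∈ l, ∃ y', EvEq y' y ∧ E x y') (hi : (g '' {x | P x}).Infinite) :
    InfNear S P E := by
  have h1 : g '' {x | P x} ⊆ ⋃ y ∈ {y | y ∈ l}, g '' {x | P x ∧ EvEq x y} := by
    rintro _ ⟨x, hx, rfl⟩
    obtain ⟨y, hy, y', hy', hE⟩ := hl x hx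
    have hPy' := h.closed _ _ hE hx
    exact Set.mem_biUnion hy ⟨y', ⟨hPy', hy'⟩, ((h.iff _ _ hx hPy').1 hE).symm⟩
  obtain ⟨x, hx, hx'⟩ : ∃ x ∈ l, (g '' {y | P y ∧ EvEq y x}).Infinite := by
    by_contra! hcon
    exact hi ((l.finite_toSet.biUnion fun y hy => hcon y hy).subset h1)
  refine ⟨x, h.lt x (hlP x hx), fun T hT hT' => ?_⟩
  by_contra! hcon
  refine hx' (((finite_agree S x T hT').image g).subset ?_)
  rintro _ ⟨y, ⟨hPy, hy⟩, rfl⟩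
  obtain ⟨y', hy'S, hy'T, hE⟩ := hcon y (h.lt y hPy) hPy (by
    obtain ⟨N, hN⟩ := hy
    exact ⟨N, hN⟩)
  exact ⟨y', ⟨hy'S, hy'T⟩, ((h.iff _ _ hPy (h.closed _ _ hE hPy)).1 hE).symm⟩

end Names

/-! ### Effectivity of the cardinality conditions -/

open Function BuchiAutomaton

namespace ER

variable {α : Type*} [Primcodable α] {S n : α → ℕ}

theorem forall_lt (hS : Primrec S) (hn : Primrec n) {s t : α → ℕ} (hs : Primrec s)
    (ht : Primrec t) : ER S n fun a v => ∀ i, v (t a) i < s a :=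
  (forall_col hS hn (ρ := fun a => [t a]) (p := fun a l => l.getD 0 0 < s a) (by fun_prop)
    (by fun_prop)).of_iff fun a v _ => by simp [Env.col]

theorem isMix (hS : Primrec S) (hn : Primrec n) {x y A u : α → ℕ} (hx : Primrec x)
    (hy : Primrec y) (hA : Primrec A) (hu : Primrec u) :
    ER S n fun a v => IsMix (v (x a)) (v (y a)) (v (A a)) (v (u a)) :=
  (forall_col hS hn (ρ := fun a => [x a, y a, A a, u a])
    (p := fun a l => l.getD 3 0 = if l.getD 2 0 = 1 then l.getD 1 0 else l.getD 0 0) (by fun_prop)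
    (by fun_prop)).of_iff fun a v _ => by simp [Env.col, IsMix]

theorem infSubset (hS : Primrec S) (hn : Primrec n) {A B : α → ℕ} (hA : Primrec A)
    (hB : Primrec B) : ER S n fun a v => InfSubset (v (A a)) (v (B a)) :=
  ((forall_col hS hn (ρ := fun a => [A a, B a])
    (p := fun a l => l.getD 0 0 = 1 → l.getD 1 0 = 1) (by fun_prop)
    (by fun_prop)).and hS hn (frequently_col hS hn (ρ := fun a => [A a, B a])
    (p := fun a l => ¬ l.getD 0 0 = 1 ∧ l.getD 1 0 = 1) (by fun_prop)
    (by fun_prop))).of_iff fun a v _ => by simp [Env.col, InfSubset]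

theorem eq (hS : Primrec S) (hn : Primrec n) {x y : α → ℕ} (hx : Primrec x) (hy : Primrec y) :
    ER S n fun a v => v (x a) = v (y a) :=
  (forall_col hS hn (ρ := fun a => [x a, y a])
    (p := fun a l => l.getD 0 0 = l.getD 1 0) (by fun_prop)
    (by fun_prop)).of_iff fun a v _ => by simp [Env.col, funext_iff]

theorem agreeOn (hS : Primrec S) (hn : Primrec n) {x y T : α → ℕ} (hx : Primrec x)
    (hy : Primrec y) (hT : Primrec T) :
    ER S n fun a v => ∀ i, v (T a) i = 1 → v (y a) i = v (x a) i :=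
  (forall_col hS hn (ρ := fun a => [x a, y a, T a])
    (p := fun a l => l.getD 2 0 = 1 → l.getD 1 0 = l.getD 0 0) (by fun_prop)
    (by fun_prop)).of_iff fun a v _ => by simp [Env.col]

theorem frequently_ne (hS : Primrec S) (hn : Primrec n) {x y : α → ℕ} (hx : Primrec x)
    (hy : Primrec y) : ER S n fun a v => ∀ N, ∃ i, N ≤ i ∧ v (x a) i ≠ v (y a) i :=
  (frequently_col hS hn (ρ := fun a => [x a, y a])
    (p := fun a l => ¬ l.getD 0 0 = l.getD 1 0) (by fun_prop)
    (by fun_prop)).of_iff fun a v _ => by simp [Env.col]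

theorem frequently_ne_one (hS : Primrec S) (hn : Primrec n) {x : α → ℕ} (hx : Primrec x) :
    ER S n fun a v => ∀ N, ∃ i, N ≤ i ∧ v (x a) i ≠ 1 :=
  (frequently_col hS hn (ρ := fun a => [x a])
    (p := fun a l => ¬ l.getD 0 0 = 1) (by fun_prop)
    (by fun_prop)).of_iff fun a v _ => by simp [Env.col]

theorem frequently_succ_eq_one (hS : Primrec S) (hn : Primrec n) {x : α → ℕ} (hx : Primrec x) :
    ER S n fun a v => ∀ N, ∃ i, N ≤ i ∧ v (x a) (i + 1) = 1 :=
  (frequently_col hS hn (ρ := fun a => [x a])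
    (p := fun a l => l.getD 0 0 = 1) (by fun_prop)
    (by fun_prop)).of_iff fun a v _ => by
      simp only [List.map_cons, List.map_nil, List.getD_cons_zero, Env.col]
      refine ⟨fun h N => ?_, fun h N => ?_⟩
      · obtain ⟨i, hi, h⟩ := h (N + 1)
        exact ⟨i - 1, by omega, by rwa [Nat.sub_add_cancel (by omega)]⟩
      · obtain ⟨i, hi, h⟩ := h N
        exact ⟨i + 1, by omega, h⟩

theorem blockConst (hS : Primrec S) (hn : Primrec n) {H A : α → ℕ} (hH : Primrec H)
    (hA : Primrec A) : ER S n fun a v => BlockConst (v (H a)) (v (A a)) := by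
  -- The state stores the previous letter of `A` plus one, and `0` means that nothing has been read.
  -- Letters are at most `S a`, hence `S a + 2` states.
  refine (run hS hn (K := fun a => S a + 2) (ρ := fun a => [H a, A a])
    (step := fun a x => x.2.2 = x.2.1.getD 1 0 + 1 ∧
      (x.1 = 0 ∨ x.2.1.getD 0 0 = 1 ∨ x.1 = x.2.1.getD 1 0 + 1)) (acc := fun _ _ => (0 : ℕ) = 0)
    (by fun_prop) (by fun_prop) (by fun_prop) (by fun_prop)).of_iff fun a v hv => ?_
  simp only [List.map_cons, List.map_nil, List.getD_cons_zero, List.getD_cons_succ, Env.col]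
  constructor
  · rintro ⟨q, h0, h1, -⟩ i
    have h2 := (h1 i).2.1
    rcases (h1 (i + 1)).2.2 with h | h | h
    · omega
    · exact Or.inl h
    · exact Or.inr (by omega)
  · intro h
    refine ⟨fun i => if i = 0 then 0 else v (A a) (i - 1) + 1, by simp, fun i => ⟨?_, by simp, ?_⟩,
      fun N => ⟨N, le_rfl, trivial⟩⟩
    · have : ∀ j, v (A a) j ≤ S a := fun j => by
        rcases Nat.lt_or_ge (A a) (n a) with h | h
        · exact ((hv j).1 _ h).le
        · rw [(hv j).2 _ h]
          exact Nat.zero_le _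
      dsimp only
      split_ifs
      · omega
      · have := this (i - 1)
        omega
    · rcases Nat.eq_zero_or_pos i with rfl | hi
      · exact Or.inl rfl
      · obtain ⟨j, rfl⟩ := Nat.exists_eq_add_of_le' hi
        rcases h j with h | h
        · exact Or.inr (Or.inl h)
        · exact Or.inr (Or.inr (by simp [h]))

theorem lexLt (hS : Primrec S) (hn : Primrec n) {x y : α → ℕ} (hx : Primrec x) (hy : Primrec y) :
    ER S n fun a v => LexLt (v (x a)) (v (y a)) := by
  classical
  -- State `0` is kept while the words agree; the first difference must lead upwards to the
  -- absorbing state `1`.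
  refine (run hS hn (K := fun a => 2) (ρ := fun a => [x a, y a])
    (step := fun a x => (x.1 = 0 ∧ x.2.1.getD 0 0 = x.2.1.getD 1 0 ∧ x.2.2 = 0) ∨
      (x.1 = 0 ∧ x.2.1.getD 0 0 < x.2.1.getD 1 0 ∧ x.2.2 = 1) ∨ (x.1 = 1 ∧ x.2.2 = 1))
    (acc := fun _ q => q = 1)
    (by fun_prop) (by fun_prop) (by fun_prop) (by fun_prop)).of_iff fun a v hv => ?_
  simp only [List.map_cons, List.map_nil, List.getD_cons_zero, List.getD_cons_succ, Env.col]
  constructor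
  · rintro ⟨q, h0, h1, h2⟩
    have h3 : ∃ i, q i = 1 := by
      obtain ⟨i, -, hi⟩ := h2 0
      exact ⟨i, hi⟩
    have h4 : Nat.find h3 ≠ 0 := fun h => by
      have := Nat.find_spec h3
      rw [h, h0] at this
      omega
    obtain ⟨j, hj⟩ := Nat.exists_eq_succ_of_ne_zero h4
    have h5 : ∀ i ≤ j, q i = 0 := fun i hi => by
      have := Nat.find_min h3 (m := i) (by omega)
      have := (h1 i).1
      omega
    have h6 := Nat.find_spec h3
    rw [hj, Nat.succ_eq_add_one] at h6
    refine ⟨j, ?_, fun i hi => ?_⟩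
    · have := h5 j le_rfl
      rcases (h1 j).2 with h | h | h <;> omega
    · have := h5 i hi.le
      have := h5 (i + 1) hi
      rcases (h1 i).2 with h | h | h <;> omega
  · rintro ⟨j, hj, hj'⟩
    refine ⟨fun i => if i ≤ j then 0 else 1, by simp, fun i => ⟨?_, ?_⟩, fun N =>
      ⟨N + j + 1, by omega, if_neg (by omega)⟩⟩
    · dsimp only
      split_ifs <;> omega
    · dsimp only
      rcases lt_trichotomy i j with h | rfl | h
      · exact Or.inl ⟨if_pos h.le, hj' i h, if_pos h⟩
      · exact Or.inr (Or.inl ⟨if_pos le_rfl, hj, if_neg (by omega)⟩)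
      · exact Or.inr (Or.inr ⟨if_neg (by omega), if_neg (by omega)⟩)

variable {P : α → Env → (ℕ → ℕ) → Prop} {E : α → (ℕ → ℕ) → (ℕ → ℕ) → Prop}

/-- The words `x, y, H` are on the tracks `n, n + 1, n + 2`. The later tracks hold `A, u` in the
first condition and `A, B, u, w` in the second. -/
theorem pattern (hS : Primrec S) (hn : Primrec n)
    (hP : ∀ m t : α → ℕ, Primrec m → Primrec t → ER S m fun a v => P a v (v (t a)))
    (hP' : ∀ a v v', (∀ t < n a, v t = v' t) → P a v = P a v')
    (hE : ∀ m t t' : α → ℕ, Primrec m → Primrec t → Primrec t' →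
      ER S m fun a v => E a (v (t a)) (v (t' a))) :
    ER S n fun a v => Pattern (S a) (P a v) (E a) := by
  unfold Pattern
  have hP'' : ∀ k a v v', (∀ t < n a + k, v t = v' t) → P a v = P a v' :=
    fun k a v v' h => hP' a v v' fun t ht => h t (by omega)
  have hN : ∀ k : ℕ, Primrec fun a => n a + k := fun k => by fun_prop
  refine ex hS hn ?_ fun a v v' x h => by rw [hP' a v v' h]
  refine ex hS (hN 1) ?_ fun a v v' x h => by
    rw [hP'' 1 a v v' h, h (n a) (by omega)]
  refine ex hS (hN 2) ?_ fun a v v' x h => by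
    rw [hP'' 2 a v v' h, h (n a) (by omega), h (n a + 1) (by omega)]
  refine and hS (hN 3) (frequently_succ_eq_one hS (hN 3) (hN 2)) (and hS (hN 3) ?_ ?_)
  · refine all hS (hN 3) ?_ fun a v v' x h => by
      rw [hP'' 3 a v v' h, h (n a) (by omega), h (n a + 1) (by omega), h (n a + 2) (by omega)]
    refine imp hS (hN 4) (blockConst hS (hN 4) (hN 2) (hN 3)) ?_
    refine all hS (hN 4) ?_ fun a v v' x h => by
      rw [hP'' 4 a v v' h, h (n a) (by omega), h (n a + 1) (by omega), h (n a + 3) (by omega)]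
    exact imp hS (hN 5) (isMix hS (hN 5) hn (hN 1) (hN 3) (hN 4)) (hP _ _ (hN 5) (hN 4))
  · refine all hS (hN 3) ?_ fun a v v' x h => by
      rw [h (n a) (by omega), h (n a + 1) (by omega), h (n a + 2) (by omega)]
    refine imp hS (hN 4) (blockConst hS (hN 4) (hN 2) (hN 3)) ?_
    refine all hS (hN 4) ?_ fun a v v' x h => by
      rw [h (n a) (by omega), h (n a + 1) (by omega), h (n a + 2) (by omega),
        h (n a + 3) (by omega)]
    refine imp hS (hN 5) (blockConst hS (hN 5) (hN 2) (hN 4)) ?_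
    refine imp hS (hN 5) (infSubset hS (hN 5) (hN 3) (hN 4)) ?_
    refine all hS (hN 5) ?_ fun a v v' x h => by
      rw [h (n a) (by omega), h (n a + 1) (by omega), h (n a + 3) (by omega),
        h (n a + 4) (by omega)]
    refine imp hS (hN 6) (isMix hS (hN 6) hn (hN 1) (hN 3) (hN 5)) ?_
    refine all hS (hN 6) ?_ fun a v v' x h => by
      rw [h (n a) (by omega), h (n a + 1) (by omega), h (n a + 4) (by omega),
        h (n a + 5) (by omega)]
    exact imp hS (hN 7) (isMix hS (hN 7) hn (hN 1) (hN 4) (hN 6))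
      (not hS (hN 7) (hE _ _ _ (hN 7) (hN 5) (hN 6)))

theorem infNear (hS : Primrec S) (hn : Primrec n)
    (hP : ∀ m t : α → ℕ, Primrec m → Primrec t → ER S m fun a v => P a v (v (t a)))
    (hP' : ∀ a v v', (∀ t < n a, v t = v' t) → P a v = P a v')
    (hE : ∀ m t t' : α → ℕ, Primrec m → Primrec t → Primrec t' →
      ER S m fun a v => E a (v (t a)) (v (t' a))) :
    ER S n fun a v => InfNear (S a) (P a v) (E a) := by
  unfold InfNear
  have hP'' : ∀ k a v v', (∀ t < n a + k, v t = v' t) → P a v = P a v' :=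
    fun k a v v' h => hP' a v v' fun t ht => h t (by omega)
  have hN : ∀ k : ℕ, Primrec fun a => n a + k := fun k => by fun_prop
  refine ex hS hn ?_ fun a v v' x h => by rw [hP' a v v' h]
  refine all hS (hN 1) ?_ fun a v v' x h => by
    rw [hP'' 1 a v v' h, h (n a) (by omega)]
  refine imp hS (hN 2) (not hS (hN 2) (frequently_ne_one hS (hN 2) (hN 1))) ?_
  refine ex hS (hN 2) ?_ fun a v v' x h => by
    rw [hP'' 2 a v v' h, h (n a) (by omega), h (n a + 1) (by omega)]
  refine and hS (hN 3) (hP _ _ (hN 3) (hN 2)) (and hS (hN 3)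
    (not hS (hN 3) (frequently_ne hS (hN 3) (hN 2) hn)) ?_)
  refine all hS (hN 3) ?_ fun a v v' x h => by
    rw [h (n a) (by omega), h (n a + 1) (by omega), h (n a + 2) (by omega)]
  exact imp hS (hN 4) (agreeOn hS (hN 4) hn (hN 3) (hN 1))
    (not hS (hN 4) (hE _ _ _ (hN 4) (hN 2) (hN 3)))

end ER

/-! ### Counting modulo `m` preserves regularity -/

open Function

/-- Finitely many words are determined by their prefixes of a common length. -/
theorem exists_determined {X : Set (ℕ → ℕ)} (hX : X.Finite) :
    ∃ N, ∀ y ∈ X, ∀ y' ∈ X, (∀ i < N, y i = y' i) → y = y' := by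
  have h6 : ∀ p : (ℕ → ℕ) × (ℕ → ℕ), ∃ N, p.1 ≠ p.2 → ∃ i < N, p.1 i ≠ p.2 i := fun p => by
    by_cases h : p.1 = p.2
    · exact ⟨0, fun h' => absurd h h'⟩
    · obtain ⟨i, hi⟩ := ne_iff.1 h
      exact ⟨i + 1, fun _ => ⟨i, by omega, hi⟩⟩
  choose N hN using h6
  obtain ⟨B, hB⟩ := ((hX.prod hX).image N).bddAbove
  refine ⟨B, fun y hy y' hy' h => ?_⟩
  by_contra hne
  obtain ⟨i, hi, hne'⟩ := hN (y, y') hne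
  have := hB (Set.mem_image_of_mem N (Set.mk_mem_prod hy hy'))
  exact hne' (h i (by omega))

/-- Finiteness of projections. -/
theorem Sat.finite_projection {L : Env → Prop} (hL : Sat L) (j s : ℕ)
    (hs : ∀ v, L v → ∀ i, v j i < s) : Sat fun v => {y | L (update v j y)}.Finite := by
  -- Finiteness becomes the statement that some finite set `T` of positions separates any two words
  -- of the projection. Tracks `0, 1, 2` hold `T` and the two words; the given environment is
  -- shifted by three tracks.
  have h1 : ∀ a : ℕ, Sat fun v => L (update (fun t => v (t + 3)) j (v a)) := fun a =>
    (hL.comap fun f t => if t = j then f a else f (t + 3)).of_iff fun v => by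
      refine iff_of_eq (congrArg L (funext fun t => ?_))
      rcases eq_or_ne t j with rfl | h
      · simp [Env.col]
      · simp [Env.col, h]
  have h2 : Sat fun v => ¬ ∀ N, ∃ i, N ≤ i ∧ v 0 i = 1 :=
    (Sat.frequently_col fun f => f 0 = 1).not
  have h3 : Sat fun v => ∀ i, v 0 i = 1 → v 1 i = v 2 i :=
    Sat.forall_col fun f => f 0 = 1 → f 1 = f 2
  have h4 : Sat fun v => ∀ i, v 1 i = v 2 i := Sat.forall_col fun f => f 1 = f 2
  have h5 := ((h2.and ((((h1 1).and (h1 2)).imp (h3.imp h4)).all 2 |>.all 1)).ex 0).comap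
    fun f t => f (t - 3)
  refine h5.of_iff fun v => ?_
  have e : ∀ T y y' : ℕ → ℕ, (fun t => update (update (update (fun t i => v.col i (t - 3)) 0 T) 1 y) 2 y'
      (t + 3)) = v := fun T y y' => funext fun t => by
    rw [update_of_ne (by omega), update_of_ne (by omega), update_of_ne (by omega)]
    rfl
  have e0 : ∀ (w : Env) (T y y' : ℕ → ℕ), update (update (update w 0 T) 1 y) 2 y' 0 = T :=
    fun w T y y' => by simp [update_of_ne]
  have e1 : ∀ (w : Env) (T y y' : ℕ → ℕ), update (update (update w 0 T) 1 y) 2 y' 1 = y :=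
    fun w T y y' => by simp [update_of_ne]
  simp only [e, e0, e1, update_self, and_imp]
  constructor
  · rintro ⟨T, hT, h⟩
    push Not at hT
    obtain ⟨N, hN⟩ := hT
    refine Set.Finite.of_finite_image (f := fun y => fun i : Fin N => y i) ?_ ?_
    · refine (Set.Finite.pi' fun _ : Fin N => Set.finite_Iio s).subset ?_
      rintro _ ⟨y, hy, rfl⟩ i
      simpa using hs _ hy i
    · intro y hy y' hy' e
      refine funext (h y y' hy hy' fun i hi => ?_)
      rcases Nat.lt_or_ge i N with hi' | hi'
      · exact congrFun e ⟨i, hi'⟩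
      · exact absurd hi (hN i hi')
  · intro hfin
    obtain ⟨B, hB⟩ := exists_determined hfin
    refine ⟨fun i => if i < B then 1 else 0, ?_, fun y y' hy hy' h i => ?_⟩
    · push Not
      exact ⟨B, fun i hi => by rw [if_neg (by omega)]; omega⟩
    · exact congrFun (hB y hy y' hy' fun i hi => h i (if_pos hi)) i

namespace Coloring

variable (c : Coloring) (j s m : ℕ)

/-- Replace the letters of track `j`. -/
def decorate (u : List (ℕ → ℕ)) (ys : List ℕ) : List (ℕ → ℕ) :=
  List.zipWith (fun f y => update f j y) u ys

theorem decorate_seg (v : Env) (y : ℕ → ℕ) (a b : ℕ) :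
    decorate j (_root_.seg v.col a b) (_root_.seg y a b) =
      _root_.seg (Env.col (update v j y)) a b := by
  refine List.ext_getElem (by simp [decorate]) fun i h1 h2 => ?_
  simp only [decorate, List.getElem_zipWith, getElem_seg]
  funext t
  rcases eq_or_ne t j with rfl | h
  · simp [Env.col]
  · simp [Env.col, h]

/-- The decorations of a word with letters below `s` that lead to a given colour. -/
noncomputable def decorations (u : List (ℕ → ℕ)) (d : c.D) : Finset (List ℕ) :=
  open Classical in (tuples s u.length).toFinset.filter fun ys => c.h (decorate j u ys) = d

variable {c j s m}

theorem mem_decorations {u : List (ℕ → ℕ)} {d : c.D} {ys : List ℕ} :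
    ys ∈ c.decorations j s u d ↔
      (ys.length = u.length ∧ ∀ y ∈ ys, y < s) ∧ c.h (decorate j u ys) = d := by
  simp [decorations, mem_tuples]

/-- Cutting a decoration at the length of `u` is a bijection onto pairs of decorations, so the
counts multiply by convolution along `c.mul`. -/
theorem card_decorations_append [Fintype c.D] [DecidableEq c.D] (u w : List (ℕ → ℕ)) (d : c.D) :
    (c.decorations j s (u ++ w) d).card =
      ∑ p : c.D × c.D with c.mul p.1 p.2 = d,
        (c.decorations j s u p.1).card * (c.decorations j s w p.2).card := by
  classical
  have h1 : ∀ ys zs : List ℕ, ys.length = u.length →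
      decorate j (u ++ w) (ys ++ zs) = decorate j u ys ++ decorate j w zs := fun ys zs h => by
    rw [decorate, List.zipWith_append h.symm]
    rfl
  have h2 : ∀ ys ∈ c.decorations j s (u ++ w) d,
      (c.h (decorate j u (ys.take u.length)), c.h (decorate j w (ys.drop u.length))) ∈
        (Finset.univ.filter fun p : c.D × c.D => c.mul p.1 p.2 = d) := fun ys hys => by
    rw [mem_decorations] at hys
    simp only [Finset.mem_filter, Finset.mem_univ, true_and]
    rw [← c.h_append, ← h1 _ _ (by simp [hys.1.1]), List.take_append_drop]
    exact hys.2
  rw [Finset.card_eq_sum_card_fiberwise h2]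
  refine Finset.sum_congr rfl fun p hp => ?_
  rw [← Finset.card_product]
  refine Finset.card_bij' (fun ys _ => (ys.take u.length, ys.drop u.length))
    (fun q _ => q.1 ++ q.2) (fun ys hys => ?_) (fun q hq => ?_) (fun ys _ => ?_) fun q hq => ?_
  · simp only [Finset.mem_filter, mem_decorations, Finset.mem_product, List.length_append] at hys ⊢
    obtain ⟨⟨⟨h3, h4⟩, h5⟩, rfl⟩ := hys
    exact ⟨⟨⟨by simp [h3], fun y hy => h4 y (List.mem_of_mem_take hy)⟩, rfl⟩,
      ⟨by simp [h3], fun y hy => h4 y (List.mem_of_mem_drop hy)⟩, rfl⟩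
  · simp only [Finset.mem_filter, mem_decorations, Finset.mem_product, List.length_append,
      Finset.mem_univ, true_and] at hq hp ⊢
    obtain ⟨⟨⟨h3, h4⟩, h5⟩, ⟨h6, h7⟩, h8⟩ := hq
    refine ⟨⟨⟨by simp [h3, h6], fun y hy => ?_⟩, ?_⟩, ?_⟩
    · rcases List.mem_append.1 hy with h | h
      exacts [h4 y h, h7 y h]
    · rw [h1 _ _ h3, c.h_append, h5, h8, hp]
    · rw [← h3, List.take_left, List.drop_left, h5, h8]
  · simp
  · simp only [mem_decorations, Finset.mem_product] at hq
    rw [← hq.1.1.1]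
    simp

/-- The colouring that records the numbers of decorations of each colour modulo `m` and whether
they are positive. -/
noncomputable def counting (c : Coloring) [Fintype c.D] [DecidableEq c.D] (j s m : ℕ) [NeZero m] :
    Coloring where
  D := c.D → ZMod m × Prop
  fin := by
    have := Fintype.ofFinite (ZMod m)
    infer_instance
  mul f g d := (∑ p : c.D × c.D with c.mul p.1 p.2 = d, (f p.1).1 * (g p.2).1,
    ∃ p : c.D × c.D, c.mul p.1 p.2 = d ∧ (f p.1).2 ∧ (g p.2).2)
  -- Positivity is recorded separately because a positive count may vanish modulo `m`; it is what
  -- allows the transfer of individual words.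
  h u d := ((c.decorations j s u d).card, 0 < (c.decorations j s u d).card)
  h_append u v := funext fun d => by
    refine Prod.ext ?_ (propext ?_)
    · simp only
      rw [card_decorations_append]
      push_cast
      rfl
    · simp only
      rw [card_decorations_append]
      simp [Finset.sum_pos_iff]

end Coloring

open Coloring in
/-- If blocks have equal counting colours, words on track `j` can be transferred. -/
theorem Coloring.exists_transfer {c : Coloring} [Fintype c.D] [DecidableEq c.D] {j s m : ℕ}
    [NeZero m] {v v' : Env} {k k' : ℕ → ℕ} (hk' : IsFact k')
    (h : ∀ i, (c.counting j s m).seg v (k i) (k (i + 1)) =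
      (c.counting j s m).seg v' (k' i) (k' (i + 1))) {y : ℕ → ℕ} (hy : ∀ i, y i < s) :
    ∃ y' : ℕ → ℕ, ∀ i, c.seg (update v j y) (k i) (k (i + 1)) =
      c.seg (update v' j y') (k' i) (k' (i + 1)) := by
  have h1 : ∀ i, ∃ ys, ys ∈ c.decorations j s (_root_.seg v'.col (k' i) (k' (i + 1)))
      (c.seg (update v j y) (k i) (k (i + 1))) := fun i => by
    have h2 := congrArg Prod.snd (congrFun (h i) (c.seg (update v j y) (k i) (k (i + 1))))
    have h3 : 0 < (c.decorations j s (_root_.seg v.col (k i) (k (i + 1)))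
        (c.seg (update v j y) (k i) (k (i + 1)))).card := by
      refine Finset.card_pos.2 ⟨_root_.seg y (k i) (k (i + 1)), mem_decorations.2 ⟨⟨by simp, ?_⟩, ?_⟩⟩
      · intro z hz
        obtain ⟨l, -, rfl⟩ := List.mem_map.1 hz
        exact hy l
      · rw [decorate_seg]
        rfl
    exact Finset.card_pos.1 ((iff_of_eq h2).1 h3)
  choose ys hys using h1
  obtain ⟨y', hy'⟩ := exists_glue hk' ys fun i => by
    rw [(mem_decorations.1 (hys i)).1.1]
    simp
  refine ⟨y', fun i => ?_⟩
  rw [← (mem_decorations.1 (hys i)).2, ← hy' i, decorate_seg]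
  rfl

open Coloring in
/-- The number of words on track `j` that satisfy `L`, if these are determined by their prefixes
of length `k p`. -/
theorem Coloring.ncard_eq {c : Coloring} [Fintype c.D] [DecidableEq c.D] {j s : ℕ} {L : Env → Prop}
    (hc : c.Saturates L) (hs : ∀ v, L v → ∀ i, v j i < s) {v : Env} {k : ℕ → ℕ} (hk : IsFact k)
    {p : ℕ} (hp : 1 ≤ p)
    (hdet : ∀ y y', L (update v j y) → L (update v j y') → (∀ i < k p, y i = y' i) → y = y')
    (X : Finset c.D) (hX : ∀ d, d ∈ X ↔ ∃ y, L (update v j y) ∧ c.seg (update v j y) 0 (k p) = d) :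
    {y | L (update v j y)}.ncard =
      ∑ d ∈ X, (c.decorations j s (_root_.seg v.col 0 (k p)) d).card := by
  have h1 : (X.biUnion fun d => c.decorations j s (_root_.seg v.col 0 (k p)) d).card =
      ∑ d ∈ X, (c.decorations j s (_root_.seg v.col 0 (k p)) d).card :=
    Finset.card_biUnion fun d _ d' _ hdd => Finset.disjoint_left.2 fun ys hys hys' =>
      hdd ((mem_decorations.1 hys).2.symm.trans (mem_decorations.1 hys').2)
  rw [← h1, ← Set.ncard_coe_finset]
  refine Set.ncard_congr (fun y _ => _root_.seg y 0 (k p)) (fun y hy => ?_) (fun y y' hy hy' e => ?_)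
    fun ys hys => ?_
  · simp only [Finset.coe_biUnion, Set.mem_iUnion, Finset.mem_coe]
    refine ⟨_, (hX _).2 ⟨y, hy, rfl⟩, mem_decorations.2 ⟨⟨by simp, fun z hz => ?_⟩, ?_⟩⟩
    · obtain ⟨l, -, rfl⟩ := List.mem_map.1 hz
      simpa using hs _ hy l
    · rw [decorate_seg]
      rfl
  · exact hdet y y' hy hy' fun i hi => eq_of_seg_eq e (Nat.zero_le i) hi
  · simp only [Finset.coe_biUnion, Set.mem_iUnion, Finset.mem_coe] at hys
    obtain ⟨d, hd, hys⟩ := hys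
    obtain ⟨y, hy, rfl⟩ := (hX d).1 hd
    obtain ⟨⟨hlen, hlt⟩, hcol⟩ := mem_decorations.1 hys
    have hlen' : ys.length = k p := by simpa using hlen
    -- Grafting: the prefix of a member `y` is replaced by a prefix of the same colour, and
    -- saturation keeps the result in `L`. So every decoration with an admissible colour is the
    -- prefix of a member.
    let y' : ℕ → ℕ := fun i => if i < k p then ys.getD i 0 else y i
    have e1 : _root_.seg y' 0 (k p) = ys := by
      refine List.ext_getElem (by simp [hlen']) fun i h2 h3 => ?_
      rw [getElem_seg]
      simp only [y', zero_add]
      rw [if_pos (by omega), List.getD_eq_getElem _ _ h3]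
    refine ⟨y', ?_, e1⟩
    have hκ : IsFact fun i => if i = 0 then 0 else k (p + (i - 1)) := by
      refine ⟨strictMono_nat_of_lt_succ fun i => ?_, by simp⟩
      rcases Nat.eq_zero_or_pos i with rfl | hi
      · simpa [hk.2] using hk.1 hp
      · rw [if_neg hi.ne', if_neg (by omega)]
        exact hk.1 (by omega)
    refine hc (update v j y) _ _ _ hκ hκ (fun i => ?_) hy
    rcases Nat.eq_zero_or_pos i with rfl | hi
    · simp only [if_true, zero_add, one_ne_zero, if_false, Nat.sub_self, add_zero]
      rw [← hcol, ← e1, decorate_seg]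
      rfl
    · rw [if_neg hi.ne', if_neg (by omega)]
      refine c.seg_congr fun l hl hl' t => ?_
      rcases eq_or_ne t j with rfl | ht
      · have := hk.1.monotone (show p ≤ p + (i - 1) by omega)
        simp [y', show ¬ l < k p by omega]
      · simp [ht]

theorem Coloring.seg_zero_congr {c : Coloring} {v v' : Env} {k k' : ℕ → ℕ} (hk : IsFact k)
    (hk' : IsFact k') (h : ∀ i, c.seg v (k i) (k (i + 1)) = c.seg v' (k' i) (k' (i + 1)))
    {p : ℕ} (hp : 1 ≤ p) : c.seg v 0 (k p) = c.seg v' 0 (k' p) := by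
  induction p, hp using Nat.le_induction with
  | base => simpa [hk.2, hk'.2] using h 0
  | succ p hp ih =>
    rw [← c.seg_mul v (Nat.zero_le _) (hk.lt_succ p).le,
      ← c.seg_mul v' (Nat.zero_le _) (hk'.lt_succ p).le, ih, h p]

/-- Counting modulo `m`. -/
theorem Sat.ncard_modEq {L : Env → Prop} (hL : Sat L) (j s r m : ℕ) (hm : 0 < m)
    (hs : ∀ v, L v → ∀ i, v j i < s) :
    Sat fun v => {y | L (update v j y)}.Finite ∧ {y | L (update v j y)}.ncard ≡ r [MOD m] := by
  classical
  have : NeZero m := ⟨hm.ne'⟩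
  have hF := hL.finite_projection j s hs
  obtain ⟨c, hc⟩ := hL
  have := c.fin
  have := Fintype.ofFinite c.D
  obtain ⟨c', hc'⟩ := hF
  have hc'' : Coloring.Saturates (Coloring.pi fun b : Bool => cond b (c.counting j s m) c')
      fun v => {y | L (update v j y)}.Finite ∧ {y | L (update v j y)}.ncard ≡ r [MOD m] := by
    intro v v' k k' hk hk' h hv
    have h1 : ∀ i, (c.counting j s m).seg v (k i) (k (i + 1)) =
      (c.counting j s m).seg v' (k' i) (k' (i + 1)) := fun i => congrFun (h i) true
    have hfin' := hc' v v' k k' hk hk' (fun i => congrFun (h i) false) hv.1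
    refine ⟨hfin', ?_⟩
    obtain ⟨N, hN⟩ := exists_determined hv.1
    obtain ⟨N', hN'⟩ := exists_determined hfin'
    -- Block number `N + N' + 1` starts beyond both `N` and `N'`, so the members of either
    -- projection are determined by their prefixes up to this block.
    have hp : 1 ≤ N + N' + 1 := by omega
    have hpk := hk.1.id_le (N + N' + 1)
    have hpk' := hk'.1.id_le (N + N' + 1)
    dsimp only [id] at hpk hpk'
    let X : Finset c.D := Finset.univ.filter fun d =>
      ∃ y, L (update v j y) ∧ c.seg (update v j y) 0 (k (N + N' + 1)) = d
    -- The prefixes of members have the same colours on both sides, by transferring words in both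
    -- directions. What remains are the counts for these colours, which agree modulo `m`.
    have hX' : ∀ d, d ∈ X ↔ ∃ y, L (update v' j y) ∧
        c.seg (update v' j y) 0 (k' (N + N' + 1)) = d := fun d => by
      simp only [X, Finset.mem_filter, Finset.mem_univ, true_and]
      constructor
      · rintro ⟨y, hy, rfl⟩
        obtain ⟨y', hy'⟩ := Coloring.exists_transfer hk' h1 (y := y)
          (fun i => by simpa using hs _ hy i)
        exact ⟨y', hc _ _ _ _ hk hk' hy' hy, (Coloring.seg_zero_congr hk hk' hy' hp).symm⟩
      · rintro ⟨y, hy, rfl⟩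
        obtain ⟨y', hy'⟩ := Coloring.exists_transfer hk (fun i => (h1 i).symm) (y := y)
          (fun i => by simpa using hs _ hy i)
        exact ⟨y', hc _ _ _ _ hk' hk hy' hy, (Coloring.seg_zero_congr hk' hk hy' hp).symm⟩
    have h2 := hv.2
    rw [Coloring.ncard_eq hc hs hk hp (fun y y' hy hy' e => hN y hy y' hy' fun i hi => e i (by omega))
      X (fun d => by simp [X]), ← ZMod.natCast_eq_natCast_iff] at h2
    rw [Coloring.ncard_eq hc hs hk' hp (fun y y' hy hy' e => hN' y hy y' hy' fun i hi =>
      e i (by omega)) X hX', ← ZMod.natCast_eq_natCast_iff]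
    rw [← h2]
    push_cast
    refine Finset.sum_congr rfl fun d _ => ?_
    exact (congrArg Prod.fst (congrFun (Coloring.seg_zero_congr hk hk' h1 hp) d)).symm
  exact ⟨_, hc''⟩

/-! ### Certificates for counting classes modulo `m` -/

open Function

section Certificate

variable (S m : ℕ) (P : (ℕ → ℕ) → Prop) (E : (ℕ → ℕ) → (ℕ → ℕ) → Prop) (U : (ℕ → ℕ) → Prop)
  (G : ℕ → (ℕ → ℕ) → Prop)

/-- `U` contains exactly one word of each class. -/
def IsTransversal : Prop :=
  (∀ y : ℕ → ℕ, (∀ i, y i < S) → U y → P y) ∧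
  (∀ y : ℕ → ℕ, (∀ i, y i < S) → P y → ∃ y' : ℕ → ℕ, (∀ i, y' i < S) ∧ (U y' ∧ E y y')) ∧
  ∀ y : ℕ → ℕ, (∀ i, y i < S) → ∀ y' : ℕ → ℕ, (∀ i, y' i < S) → U y → U y' → E y y' → y = y'

/-- `CountZero`, `CountSucc` and `CountExclusive` axiomatize counting by recursion along the
lexicographic order of `U`. They mention only words and regular relations, and on a finite `U` they
determine which `G r` with `r < m` holds. -/
def CountZero : Prop :=
  ∀ y : ℕ → ℕ, (∀ i, y i < S) → U y →
    (∀ y' : ℕ → ℕ, (∀ i, y' i < S) → U y' → ¬ LexLt y' y) → G 0 y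

def CountSucc (r : ℕ) : Prop :=
  ∀ y : ℕ → ℕ, (∀ i, y i < S) → ∀ y' : ℕ → ℕ, (∀ i, y' i < S) → U y → U y' → LexLt y y' →
    (∀ w : ℕ → ℕ, (∀ i, w i < S) → U w → ¬ (LexLt y w ∧ LexLt w y')) →
      G r y → G ((r + 1) % m) y'

def CountExclusive (r r' : ℕ) : Prop :=
  ∀ y : ℕ → ℕ, (∀ i, y i < S) → U y → ¬ (G r y ∧ G r' y)

/-- `G r y` states that the number of words in `U` below `y` is congruent to `r`. -/
def IsCount : Prop :=
  CountZero S U G ∧ (∀ r < m, CountSucc S m U G r) ∧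
    ∀ r < m, ∀ r' < m, ¬ r = r' → CountExclusive S U G r r'

/-- The number of words in `U` is congruent to `r`, expressed by means of `G`. -/
def ModCount (r : ℕ) : Prop :=
  (r % m = 0 ∧ ∀ y : ℕ → ℕ, (∀ i, y i < S) → ¬ U y) ∨
  ∃ y : ℕ → ℕ, (∀ i, y i < S) ∧ (U y ∧
    (∀ y' : ℕ → ℕ, (∀ i, y' i < S) → U y' → ¬ LexLt y y') ∧ G ((r + m - 1) % m) y)

end Certificate

theorem exists_lexLt_minimal {V : Set (ℕ → ℕ)} (hV : V.Finite) (hne : V.Nonempty) :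
    ∃ y ∈ V, ∀ y' ∈ V, ¬ LexLt y' y := by
  have := hV.to_subtype
  let r : V → V → Prop := fun a b => LexLt a b
  have : IsTrans V r := ⟨fun _ _ _ => LexLt.trans⟩
  have : Std.Irrefl r := ⟨fun a => LexLt.irrefl _⟩
  obtain ⟨y, -, hy⟩ := (Finite.wellFounded_of_trans_of_irrefl r).has_min Set.univ
    ⟨⟨_, hne.some_mem⟩, trivial⟩
  exact ⟨y, y.2, fun y' hy' => hy ⟨y', hy'⟩ trivial⟩

theorem exists_lexLt_maximal {V : Set (ℕ → ℕ)} (hV : V.Finite) (hne : V.Nonempty) :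
    ∃ y ∈ V, ∀ y' ∈ V, ¬ LexLt y y' := by
  have := hV.to_subtype
  let r : V → V → Prop := fun a b => LexLt b a
  have : IsTrans V r := ⟨fun _ _ _ h h' => LexLt.trans h' h⟩
  have : Std.Irrefl r := ⟨fun a => LexLt.irrefl _⟩
  obtain ⟨y, -, hy⟩ := (Finite.wellFounded_of_trans_of_irrefl r).has_min Set.univ
    ⟨⟨_, hne.some_mem⟩, trivial⟩
  exact ⟨y, y.2, fun y' hy' => hy ⟨y', hy'⟩ trivial⟩

/-- The predecessor of `y` splits the set of elements below `y`. -/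
theorem ncard_below_succ {V : Set (ℕ → ℕ)} (hV : V.Finite) {y y' : ℕ → ℕ} (hy : y ∈ V)
    (hlt : LexLt y y') (hb : ∀ w ∈ V, ¬ (LexLt y w ∧ LexLt w y')) :
    {w ∈ V | LexLt w y'}.ncard = {w ∈ V | LexLt w y}.ncard + 1 := by
  rw [← Set.ncard_insert_of_notMem (a := y) (s := {w ∈ V | LexLt w y})
    (fun h => LexLt.irrefl _ h.2) (hV.subset (Set.sep_subset _ _))]
  congr 1
  ext w
  simp only [Set.mem_ofPred_eq, Set.mem_insert_iff]
  constructor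
  · rintro ⟨hw, hwy⟩
    by_cases e : w = y
    · exact Or.inl e
    · rcases LexLt.total e with h | h
      · exact Or.inr ⟨hw, h⟩
      · exact absurd ⟨h, hwy⟩ (hb w hw)
  · rintro (rfl | ⟨hw, h⟩)
    · exact ⟨hy, hlt⟩
    · exact ⟨hw, h.trans hlt⟩

section Certificate

variable {S m : ℕ} {U : (ℕ → ℕ) → Prop} {G : ℕ → (ℕ → ℕ) → Prop}

/-- Induction on the number of smaller words of `U`; by finiteness there is a greatest smaller one,
to which `CountSucc` applies. -/
theorem IsCount.holds (hm : 0 < m) (h : IsCount S m U G)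
    (hfin : {y : ℕ → ℕ | (∀ i, y i < S) ∧ U y}.Finite) {y : ℕ → ℕ} (hy : ∀ i, y i < S) (hU : U y) :
    G ({w ∈ {y : ℕ → ℕ | (∀ i, y i < S) ∧ U y} | LexLt w y}.ncard % m) y := by
  generalize hN : {w ∈ {y : ℕ → ℕ | (∀ i, y i < S) ∧ U y} | LexLt w y}.ncard = N
  induction N generalizing y with
  | zero =>
    rw [Set.ncard_eq_zero (hfin.subset (Set.sep_subset _ _))] at hN
    rw [Nat.zero_mod]
    exact h.1 y hy hU fun y' hy' hU' hlt =>
      (Set.mem_empty_iff_false y').1 (hN ▸ ⟨⟨hy', hU'⟩, hlt⟩)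
  | succ N ih =>
    obtain ⟨y', ⟨⟨hy', hU'⟩, hlt⟩, hmax⟩ := exists_lexLt_maximal
      (V := {w ∈ {y : ℕ → ℕ | (∀ i, y i < S) ∧ U y} | LexLt w y})
      (hfin.subset (Set.sep_subset _ _)) (Set.nonempty_of_ncard_ne_zero (by omega))
    have hb : ∀ w ∈ {y : ℕ → ℕ | (∀ i, y i < S) ∧ U y}, ¬ (LexLt y' w ∧ LexLt w y) :=
      fun w hw h => hmax w ⟨hw, h.2⟩ h.1
    rw [ncard_below_succ hfin ⟨hy', hU'⟩ hlt hb] at hN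
    have h1 := h.2.1 _ (Nat.mod_lt N hm) y' hy' y hy hU' hU hlt
      (fun w hw hUw => hb w ⟨hw, hUw⟩) (ih hy' hU' (by omega))
    rwa [Nat.mod_add_mod] at h1

/-- The total is one more than the number of words below the greatest one. Exclusivity ensures that
the residue asserted by `G` there is the true one. -/
theorem modCount_iff (hm : 0 < m) (h : IsCount S m U G)
    (hfin : {y : ℕ → ℕ | (∀ i, y i < S) ∧ U y}.Finite) (r : ℕ) :
    ModCount S m U G r ↔ {y : ℕ → ℕ | (∀ i, y i < S) ∧ U y}.ncard ≡ r [MOD m] := by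
  have key : ∀ y, (∀ i, y i < S) → U y → (∀ y' : ℕ → ℕ, (∀ i, y' i < S) → U y' → ¬ LexLt y y') →
      {y : ℕ → ℕ | (∀ i, y i < S) ∧ U y}.ncard =
        {w ∈ {y : ℕ → ℕ | (∀ i, y i < S) ∧ U y} | LexLt w y}.ncard + 1 := fun y hy hU hmax => by
    rw [← Set.ncard_insert_of_notMem (a := y)
      (s := {w ∈ {y : ℕ → ℕ | (∀ i, y i < S) ∧ U y} | LexLt w y})
      (fun h => LexLt.irrefl _ h.2) (hfin.subset (Set.sep_subset _ _))]
    congr 1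
    ext w
    simp only [Set.mem_ofPred_eq, Set.mem_insert_iff]
    constructor
    · rintro hw
      by_cases e : w = y
      · exact Or.inl e
      · exact Or.inr ⟨hw, (LexLt.total e).resolve_right (hmax w hw.1 hw.2)⟩
    · rintro (rfl | ⟨hw, -⟩)
      exacts [⟨hy, hU⟩, hw]
  -- Adding `m` before subtracting one avoids truncated subtraction at `r = 0`.
  have arith : ∀ c : ℕ, c % m = (r + m - 1) % m ↔ c + 1 ≡ r [MOD m] := fun c => by
    have h1 : c + 1 ≡ r [MOD m] ↔ c + 1 ≡ (r + m - 1) + 1 [MOD m] := by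
      rw [Nat.sub_add_cancel (by omega)]
      simp [Nat.ModEq]
    rw [h1]
    exact ⟨fun h => Nat.ModEq.add_right 1 h, fun h => Nat.ModEq.add_right_cancel' 1 h⟩
  constructor
  · rintro (⟨hr, hU⟩ | ⟨y, hy, hU, hmax, hG⟩)
    · rw [(Set.ncard_eq_zero hfin).2 (Set.eq_empty_iff_forall_notMem.2 fun y hy => hU y hy.1 hy.2)]
      exact ((Nat.zero_mod m).trans hr.symm)
    · rw [key y hy hU hmax, ← arith]
      by_contra hne
      exact h.2.2 _ (Nat.mod_lt _ hm) _ (Nat.mod_lt _ hm) hne y hy hU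
        ⟨h.holds hm hfin hy hU, hG⟩
  · intro hc
    rcases Set.eq_empty_or_nonempty {y : ℕ → ℕ | (∀ i, y i < S) ∧ U y} with he | hne
    · left
      rw [he, Set.ncard_empty] at hc
      refine ⟨?_, fun y hy hU => ?_⟩
      · rw [← Nat.zero_mod m]
        exact hc.symm
      · exact (Set.mem_empty_iff_false y).1 (he ▸ ⟨hy, hU⟩)
    · right
      obtain ⟨y, ⟨hy, hU⟩, hmax⟩ := exists_lexLt_maximal hfin hne
      refine ⟨y, hy, hU, fun y' hy' hU' => hmax y' ⟨hy', hU'⟩, ?_⟩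
      have h1 := h.holds hm hfin hy hU
      rw [key y hy hU fun y' hy' hU' => hmax y' ⟨hy', hU'⟩, ← arith] at hc
      rwa [hc] at h1

theorem isCount_of_iff (hfin : {y : ℕ → ℕ | (∀ i, y i < S) ∧ U y}.Finite)
    (h : ∀ r y, (∀ i, y i < S) →
      (G r y ↔ {w ∈ {y : ℕ → ℕ | (∀ i, y i < S) ∧ U y} | LexLt w y}.ncard ≡ r [MOD m])) :
    IsCount S m U G := by
  refine ⟨fun y hy hU hmin => ?_, fun r hr y hy y' hy' hU hU' hlt hb hG => ?_,
    fun r hr r' hr' hne y hy hU hG => ?_⟩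
  · have he : {w ∈ {y : ℕ → ℕ | (∀ i, y i < S) ∧ U y} | LexLt w y} = ∅ :=
      Set.eq_empty_iff_forall_notMem.2 fun w hw => hmin w hw.1.1 hw.1.2 hw.2
    rw [h 0 y hy, he, Set.ncard_empty]
  · rw [h _ y' hy', ncard_below_succ hfin ⟨hy, hU⟩ hlt fun w hw => hb w hw.1 hw.2]
    rw [h _ y hy] at hG
    exact (hG.add_right 1).trans (Nat.mod_modEq _ _).symm
  · rw [h _ y hy, h _ y hy] at hG
    have := hG.1.symm.trans hG.2
    rw [Nat.ModEq, Nat.mod_eq_of_lt hr, Nat.mod_eq_of_lt hr'] at this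
    exact hne this

theorem Names.finite_transversal {A : Type*} {P : (ℕ → ℕ) → Prop}
    {E : (ℕ → ℕ) → (ℕ → ℕ) → Prop} {g : (ℕ → ℕ) → A} (h : Names S P E g)
    (hU : IsTransversal S P E U) :
    Set.BijOn g {y : ℕ → ℕ | (∀ i, y i < S) ∧ U y} (g '' {y | P y}) := by
  refine ⟨fun y hy => ⟨y, hU.1 y hy.1 hy.2, rfl⟩, fun y hy y' hy' e => ?_, ?_⟩
  · exact hU.2.2 y hy.1 y' hy'.1 hy.2 hy'.2
      ((h.iff _ _ (hU.1 y hy.1 hy.2) (hU.1 y' hy'.1 hy'.2)).2 e)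
  · rintro _ ⟨y, hy, rfl⟩
    obtain ⟨y', hy', hUy', hE⟩ := hU.2.1 y (h.lt y hy) hy
    exact ⟨y', ⟨hy', hUy'⟩, ((h.iff _ _ hy (h.closed _ _ hE hy)).1 hE).symm⟩

theorem Names.modCount_iff {A : Type*} {P : (ℕ → ℕ) → Prop}
    {E : (ℕ → ℕ) → (ℕ → ℕ) → Prop} {g : (ℕ → ℕ) → A} (h : Names S P E g)
    (hfin : (g '' {y | P y}).Finite) (hU : IsTransversal S P E U) (hm : 0 < m)
    (hG : IsCount S m U G) (r : ℕ) :
    ModCount S m U G r ↔ (g '' {y | P y}).ncard ≡ r [MOD m] := by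
  have hb := h.finite_transversal hU
  have hfin' : {y : ℕ → ℕ | (∀ i, y i < S) ∧ U y}.Finite :=
    Set.Finite.of_finite_image (hb.image_eq ▸ hfin) hb.injOn
  rw [_root_.modCount_iff hm hG hfin', ← hb.image_eq, hb.injOn.ncard_image]

end Certificate

/-! ### Existence of certificates -/

open Function BuchiAutomaton

theorem BuchiAutomaton.at_ext₂ (M : BuchiAutomaton) (n : ℕ) (z : Env) (x y : ℕ → ℕ) :
    M.At (List.range (n + 2)) (Coloring.ext₂ n z x y) ↔ M.On n z [x, y] := by
  have h : ∀ i, (List.range (n + 2)).map (Env.col (Coloring.ext₂ n z x y) i) =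
      (List.range n).map (z.col i) ++ [x i, y i] := fun i => by
    rw [List.range_succ, List.range_succ, List.map_append, List.map_append, List.append_assoc]
    congr 1
    · exact List.map_congr_left fun t ht => by
        rw [Env.col, Coloring.ext₂_of_lt _ _ _ (List.mem_range.1 ht), Env.col]
    · simp [Env.col, Coloring.ext₂_fst, Coloring.ext₂_snd]
  simp only [At, On, h, List.map_cons, List.map_nil]

theorem InEnv.ext₂ {S n : ℕ} {z : Env} (hz : InEnv S n z) {x y : ℕ → ℕ} (hx : ∀ i, x i < S)
    (hy : ∀ i, y i < S) : InEnv S (n + 2) (Coloring.ext₂ n z x y) :=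
  (hz.update hx).update hy

/-- The condition that has to be checked for the certificate `U`, `G` at the parameters `z`. -/
def Certifies (S m : ℕ) (P : (ℕ → ℕ) → Prop) (E : (ℕ → ℕ) → (ℕ → ℕ) → Prop)
    (U : (ℕ → ℕ) → (ℕ → ℕ) → Prop) (G : ℕ → (ℕ → ℕ) → (ℕ → ℕ) → Prop) : Prop :=
  (∀ y : ℕ → ℕ, (∀ i, y i < S) → ∀ y' : ℕ → ℕ, (∀ i, y' i < S) → E y y' → P y → P y') →
    ¬ Pattern S P E → ¬ InfNear S P E →
    (∃ t : ℕ → ℕ, (∀ i, t i < S) ∧ IsTransversal S P E (U t)) ∧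
    ∀ t : ℕ → ℕ, (∀ i, t i < S) → IsTransversal S P E (U t) → IsCount S m (U t) fun r => G r t

/-- Up to a finite prefix, `y` is one of the words coded by `t`. -/
def NearCode {C s N : ℕ} (e : Fin N ≃ (Fin C → Fin (s + 1)) × Bool) (t y : ℕ → ℕ) : Prop :=
  ∃ i : Fin C, ∀ p, ∀ h : t p < N, (e ⟨t p, h⟩).2 = true → y p = (e ⟨t p, h⟩).1 i

/-- The lexicographically least words of the classes among those near the words coded by `t`. -/
def LeastNear {C s N : ℕ} (e : Fin N ≃ (Fin C → Fin (s + 1)) × Bool) (P : (ℕ → ℕ) → Prop)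
    (E : (ℕ → ℕ) → (ℕ → ℕ) → Prop) (t y : ℕ → ℕ) : Prop :=
  P y ∧ NearCode e t y ∧ ∀ y', E y y' → NearCode e t y' → ¬ LexLt y' y

theorem Sat.nearCode {C s N : ℕ} (e : Fin N ≃ (Fin C → Fin (s + 1)) × Bool) (a b : ℕ) :
    Sat fun v => NearCode e (v a) (v b) :=
  Sat.exists_finite fun i => Sat.forall_col fun f =>
    ∀ h : f a < N, (e ⟨f a, h⟩).2 = true → f b = (e ⟨f a, h⟩).1 i

section

variable {n s : ℕ} {P : Env → (ℕ → ℕ) → Prop} {E : (ℕ → ℕ) → (ℕ → ℕ) → Prop}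
  (hP : ∀ t, Sat fun v => P v (v t)) (hE : ∀ t t', Sat fun v => E (v t) (v t'))
  (hP' : ∀ z z', (∀ t < n, z t = z' t) → P z = P z')

include hP hE

theorem Sat.leastNear {C s N : ℕ} (e : Fin N ≃ (Fin C → Fin (s + 1)) × Bool) {a b : ℕ} 
    (ha : a ≤ n + 2) (hb : b ≤ n + 2) : Sat fun v => LeastNear e (P v) E (v a) (v b) := by
  have h1 := ((hE b (n + 3)).imp ((Sat.nearCode e a (n + 3)).imp (Sat.lexLt (n + 3) b).not)).all
    (n + 3)
  refine ((hP b).and ((Sat.nearCode e a b).and h1)).of_iff fun v => ?_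
  simp only [update_self, update_of_ne (show a ≠ n + 3 by omega),
    update_of_ne (show b ≠ n + 3 by omega)]
  rfl

include hP'

/-- The word `t` codes the boundedly many representatives from `exists_bound` and a cofinite set of
positions. `MU` selects in each class the lexicographically least word that agrees with a coded one
on this set, and `MG r` counts the smaller selected words modulo `m`, which is regular by
`Sat.ncard_modEq`. Only existence is claimed; correctness is checked separately. -/
theorem exists_certificate (hlt : ∀ z x, P z x → ∀ i, x i < s)
    (hrefl : ∀ z x, P z x → E x x) (hsymm : ∀ x y, E x y → E y x)
    (htr : ∀ x y w, E x y → E y w → E x w) (hElt : ∀ x y, E x y → ∀ i, y i < s) {m : ℕ}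
    (hm : 0 < m) :
    ∃ S, s + 2 ≤ S ∧ ∃ (MU : BuchiAutomaton) (MG : ℕ → BuchiAutomaton), ∀ z, InEnv S n z →
      Certifies S m (P z) E (fun t y => MU.On n z [t, y]) fun r t y => (MG r).On n z [t, y] := by
  classical
  obtain ⟨C, hC⟩ := exists_bound (E := fun _ => E) (hP n) (hE n (n + 1)) hP' fun _ _ _ => rfl
  -- A letter of the code carries one letter of each of the `C` words and a mark. With `s + 1`
  -- letters the filler `0` is available even if `s = 0`.
  let T := (Fin C → Fin (s + 1)) × Bool
  let e : Fin (Fintype.card T) ≃ T := (Fintype.equivFin T).symm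
  obtain ⟨MU, hMU⟩ := (Sat.leastNear hP hE (n := n) e (a := n) (b := n + 1) (by omega)
    (by omega)).exists_automaton (s + 2 + Fintype.card T) (n + 2)
  -- Track `n` holds `t`, track `n + 1` holds `y`, and the words on track `n + 2` are counted.
  have hG : ∀ r, Sat fun v => {y | LeastNear e (P v) E (v n) y ∧ LexLt y (v (n + 1))}.Finite ∧
      {y | LeastNear e (P v) E (v n) y ∧ LexLt y (v (n + 1))}.ncard ≡ r [MOD m] := fun r => by
    refine (((Sat.leastNear hP hE (n := n) e (a := n) (b := n + 2) (by omega) le_rfl).and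
      (Sat.lexLt (n + 2) (n + 1))).ncard_modEq (n + 2) s r m hm fun v hv =>
        hlt v _ hv.1.1).of_iff fun v => ?_
    simp only [update_self, update_of_ne (show n ≠ n + 2 by omega),
      update_of_ne (show n + 1 ≠ n + 2 by omega)]
    have : ∀ y, P (update v (n + 2) y) = P v := fun y =>
      hP' _ _ fun t ht => update_of_ne (by omega) _ _
    simp only [this]
  choose MG hMG using fun r => (hG r).exists_automaton (s + 2 + Fintype.card T) (n + 2)
  refine ⟨s + 2 + Fintype.card T, by omega, MU, MG, fun z hz hinv hpat hnear => ?_⟩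
  have hclosed : ∀ x y, E x y → P z x → P z y := fun x y hxy hx =>
    hinv x (fun i => (hlt z x hx i).trans_le (by omega)) y
      (fun i => (hElt x y hxy i).trans_le (by omega)) hxy hx
  have hnames : Names (s + 2 + Fintype.card T) (P z) E fun x => {y | E x y} :=
    ⟨fun x hx i => (hlt z x hx i).trans_le (by omega), fun x y hx hy => by
      constructor
      · intro hxy
        ext w
        exact ⟨fun h => htr _ _ _ (hsymm _ _ hxy) h, fun h => htr _ _ _ hxy h⟩
      · intro hxy
        have : y ∈ {w | E y w} := hrefl z y hy
        rw [← hxy] at this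
        exact this, hclosed, by omega⟩
  obtain ⟨l, hlC, hlP, hl⟩ := hC _ z hnames.two_le hnames.lt (fun u v w => htr u v w) hpat
  have hfin : ((fun x => {y | E x y}) '' {x | P z x}).Finite := by
    by_contra hcon
    exact hnear (hnames.infNear_of_infinite hlP hl hcon)
  have hU : ∀ t y : ℕ → ℕ, (∀ i, t i < s + 2 + Fintype.card T) →
      (∀ i, y i < s + 2 + Fintype.card T) → (MU.On n z [t, y] ↔ LeastNear e (P z) E t y) :=
    fun t y ht hy => by
      rw [← at_ext₂, hMU _ (hz.ext₂ ht hy), Coloring.ext₂_fst, Coloring.ext₂_snd,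
        hP' _ z fun i hi => Coloring.ext₂_of_lt _ _ _ hi]
  constructor
  -- As there are finitely many classes and finitely many representatives, one position `N` serves
  -- for all of them: each class near a listed word contains a word equal to it from `N` on.
  · obtain ⟨N, hN⟩ : ∃ N, ∀ x ∈ l, ∀ w, P z w → (∃ y', EvEq y' x ∧ E w y') →
        ∃ y', (∀ i, N ≤ i → y' i = x i) ∧ E w y' := by
      choose N hN using fun x => hnames.exists_common_agree (x := x)
        (Y := {w | P z w ∧ ∃ y', EvEq y' x ∧ E w y'}) (fun _ h => h)
        (hfin.subset (Set.image_mono fun y hy => hy.1))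
      obtain ⟨B, hB⟩ := (l.finite_toSet.image N).bddAbove
      refine ⟨B, fun x hx w hw hw' => ?_⟩
      obtain ⟨y', h1, h2⟩ := hN x w ⟨hw, hw'⟩
      exact ⟨y', fun i hi => h1 i ((hB (Set.mem_image_of_mem N hx)).trans hi), h2⟩
    let xs : ℕ → ℕ → ℕ := fun i => l.getD i fun _ => 0
    have hxs : ∀ i p, xs i p < s + 1 := fun i p => by
      rcases Nat.lt_or_ge i l.length with h | h
      · simp only [xs, List.getD_eq_getElem _ _ h]
        exact (hlt z _ (hlP _ (List.getElem_mem _)) p).trans (Nat.lt_succ_self s)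
      · simp only [xs, List.getD_eq_default _ _ h]
        omega
    -- The marked positions are those from `N` on, so `NearCode` means agreement with one of the `C`
    -- words beyond `N`.
    let t : ℕ → ℕ := fun p => e.symm (fun i => ⟨xs i p, hxs i p⟩, decide (N ≤ p))
    have htlt : ∀ p, t p < Fintype.card T := fun p => Fin.is_lt _
    have ht : ∀ p, t p < s + 2 + Fintype.card T := fun p => (htlt p).trans_le (by omega)
    have hnear : ∀ y, NearCode e t y ↔ ∃ i : Fin C, ∀ p, N ≤ p → y p = xs i p := fun y => by
      refine exists_congr fun i => forall_congr' fun p => ?_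
      have : ∀ h : t p < Fintype.card T,
          e ⟨t p, h⟩ = (fun i => ⟨xs i p, hxs i p⟩, decide (N ≤ p)) := fun h =>
        e.apply_symm_apply _
      simp only [this, decide_eq_true_eq]
      exact ⟨fun h => h (htlt p), fun h _ => h⟩
    refine ⟨t, ht, fun y hy h => ((hU t y ht hy).1 h).1, fun y hy hPy => ?_,
      fun y hy y' hy' h h' hE => ?_⟩
    · obtain ⟨x, hx, y₀, hy₀⟩ := hl y hPy
      obtain ⟨y₁, hy₁, hE₁⟩ := hN x hx y hPy ⟨y₀, hy₀⟩
      obtain ⟨i, hi, rfl⟩ := List.getElem_of_mem hx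
      have hne : {w | E y w ∧ NearCode e t w}.Nonempty := by
        refine ⟨y₁, hE₁, (hnear _).2 ⟨⟨i, by omega⟩, fun p hp => ?_⟩⟩
        simp only [xs, List.getD_eq_getElem _ _ hi]
        exact hy₁ p hp
      -- The lexicographic order on infinite words is not well-founded. A least element exists
      -- because only finitely many words over `s` letters have one of the prescribed tails.
      have hfin₁ : {w | E y w ∧ NearCode e t w}.Finite := by
        have h1 : ∀ i : Fin C, {w : ℕ → ℕ | (∀ p, w p < s) ∧
            ∀ p, (if N ≤ p then 1 else 0) = 1 → w p = xs i p}.Finite := fun i =>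
          Names.finite_agree s (xs i) _ (by push Not; exact ⟨N, fun p hp => if_pos hp⟩)
        refine (Set.finite_iUnion h1).subset fun w hw => ?_
        obtain ⟨i, hi⟩ := (hnear w).1 hw.2
        refine Set.mem_iUnion.2 ⟨i, hElt _ _ hw.1, fun p hp => hi p ?_⟩
        by_contra h
        rw [if_neg h] at hp
        omega
      obtain ⟨y', ⟨hE', hn'⟩, hmin⟩ := exists_lexLt_minimal hfin₁ hne
      have hPy' := hclosed _ _ hE' hPy
      have hy' := hnames.lt y' hPy'
      exact ⟨y', hy', (hU t y' ht hy').2 ⟨hPy', hn', fun w hw hw' =>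
        hmin w ⟨htr _ _ _ hE' hw, hw'⟩⟩, hE'⟩
    · beta_reduce at h h'
      rw [hU t _ ht hy] at h
      rw [hU t _ ht hy'] at h'
      by_contra hne
      rcases LexLt.total hne with h1 | h1
      · exact h'.2.2 y (hsymm _ _ hE) h.2.1 h1
      · exact h.2.2 y' hE h'.2.1 h1
  -- Here `t` is arbitrary: whenever it yields a transversal, this set is finite, and `MG` counts in
  -- exactly this set.
  · intro t ht htrans
    have hb := hnames.finite_transversal htrans
    have hfin' := Set.Finite.of_finite_image (hb.image_eq ▸ hfin) hb.injOn
    refine isCount_of_iff hfin' fun r y hy => ?_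
    beta_reduce
    rw [← at_ext₂, hMG _ _ (hz.ext₂ ht hy), Coloring.ext₂_fst, Coloring.ext₂_snd,
        hP' _ z fun i hi => Coloring.ext₂_of_lt _ _ _ hi]
    have h1 : {w ∈ {y : ℕ → ℕ | (∀ i, y i < s + 2 + Fintype.card T) ∧ MU.On n z [t, y]} |
        LexLt w y} = {w | LeastNear e (P z) E t w ∧ LexLt w y} := by
      ext w
      constructor
      · rintro ⟨⟨hw, hw'⟩, h⟩
        exact ⟨(hU t w ht hw).1 hw', h⟩
      · rintro ⟨hw, h⟩
        have hw' := hnames.lt w hw.1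
        exact ⟨⟨hw', (hU t w ht hw').2 hw⟩, h⟩
    rw [← h1]
    exact and_iff_right (hfin'.subset (Set.sep_subset _ _))

end

/-! ### Effectivity of certificates -/

open Function BuchiAutomaton

/-- `y` is a word with letters below `s` accepted by `Md`, and `M` accepts `z` extended by `y`. -/
def PRel (s : ℕ) (Md : BuchiAutomaton) (n : ℕ) (M : BuchiAutomaton) (z : Env) (y : ℕ → ℕ) : Prop :=
  (∀ i, y i < s) ∧ (Md.AcceptsWord (fun i => [y i]) ∧ M.On n z [y])

/-- Words with letters below `s`, as a pair accepted by `Me`. -/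
def EqvRel (s : ℕ) (Me : BuchiAutomaton) (x y : ℕ → ℕ) : Prop :=
  (∀ i, x i < s) ∧ ((∀ i, y i < s) ∧ Me.AcceptsWord fun i => [x i, y i])

theorem PRel.congr {n : ℕ} {v v' : Env} (h : ∀ t < n, v t = v' t) (s : ℕ)
    (Md M : BuchiAutomaton) : PRel s Md n M v = PRel s Md n M v' := by
  unfold PRel
  rw [On.congr h]

namespace ER

variable {α : Type*} [Primcodable α] {S n : α → ℕ}

theorem acc₁ (hS : Primrec S) (hn : Primrec n) {M : α → BuchiAutomaton} {t : α → ℕ}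
    (hM : Primrec M) (ht : Primrec t) :
    ER S n fun a v => (M a).AcceptsWord fun i => [v (t a) i] :=
  at_ hS hn hM (ρ := fun a => [t a]) (by fun_prop)

theorem acc₂ (hS : Primrec S) (hn : Primrec n) {M : α → BuchiAutomaton} {t t' : α → ℕ}
    (hM : Primrec M) (ht : Primrec t) (ht' : Primrec t') :
    ER S n fun a v => (M a).AcceptsWord fun i => [v (t a) i, v (t' a) i] :=
  at_ hS hn hM (ρ := fun a => [t a, t' a]) (by fun_prop)

variable {s k : α → ℕ} {Md Me M : α → BuchiAutomaton}

theorem pRel (hS : Primrec S) (hs : Primrec s) (hk : Primrec k) (hMd : Primrec Md)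
    (hM : Primrec M) {m t : α → ℕ} (hm : Primrec m) (ht : Primrec t) :
    ER S m fun a v => PRel (s a) (Md a) (k a) (M a) v (v (t a)) :=
  and hS hm (forall_lt hS hm hs ht) (and hS hm (acc₁ hS hm hMd ht) (on₁ hS hm hM hk ht))

theorem eqvRel (hS : Primrec S) (hs : Primrec s) (hMe : Primrec Me) {m t t' : α → ℕ}
    (hm : Primrec m) (ht : Primrec t) (ht' : Primrec t') :
    ER S m fun a v => EqvRel (s a) (Me a) (v (t a)) (v (t' a)) :=
  and hS hm (forall_lt hS hm hs ht) (and hS hm (forall_lt hS hm hs ht') (acc₂ hS hm hMe ht ht'))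

section

variable {P : α → Env → (ℕ → ℕ) → Prop} {E : α → (ℕ → ℕ) → (ℕ → ℕ) → Prop}
  (hS : Primrec S) (hn : Primrec n)
  (hP : ∀ m t : α → ℕ, Primrec m → Primrec t → ER S m fun a v => P a v (v (t a)))
  (hP' : ∀ a v v', (∀ t < n a, v t = v' t) → P a v = P a v')
  (hE : ∀ m t t' : α → ℕ, Primrec m → Primrec t → Primrec t' →
    ER S m fun a v => E a (v (t a)) (v (t' a)))

include hS hn hP hP' hE

theorem invariant : ER S n fun a v => ∀ y : ℕ → ℕ, (∀ i, y i < S a) →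
    ∀ y' : ℕ → ℕ, (∀ i, y' i < S a) → E a y y' → P a v y → P a v y' := by
  have hN : ∀ k : ℕ, Primrec fun a => n a + k := fun k => by fun_prop
  refine all hS hn ?_ fun a v v' x h => by rw [hP' a v v' h]
  refine all hS (hN 1) ?_ fun a v v' x h => by
    rw [hP' a v v' fun t ht => h t (by omega), h (n a) (by omega)]
  exact imp hS (hN 2) (hE _ _ _ (hN 2) hn (hN 1))
    (imp hS (hN 2) (hP _ _ (hN 2) hn) (hP _ _ (hN 2) (hN 1)))

/-- The assumptions under which a certificate has to be correct. -/
theorem finitelyMany : ER S n fun a v => (∀ y : ℕ → ℕ, (∀ i, y i < S a) →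
    ∀ y' : ℕ → ℕ, (∀ i, y' i < S a) → E a y y' → P a v y → P a v y') ∧
      (¬ Pattern (S a) (P a v) (E a) ∧ ¬ InfNear (S a) (P a v) (E a)) :=
  and hS hn (invariant hS hn hP hP' hE) (and hS hn (not hS hn (pattern hS hn hP hP' hE))
    (not hS hn (infNear hS hn hP hP' hE)))

variable {MU : α → BuchiAutomaton} (hMU : Primrec MU)

include hMU

theorem isTransversal : ER S (fun a => n a + 1) fun a v =>
    IsTransversal (S a) (P a v) (E a) fun y => (MU a).On (n a) v [v (n a), y] := by
  have hN : ∀ k : ℕ, Primrec fun a => n a + k := fun k => by fun_prop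
  unfold IsTransversal
  refine and hS (hN 1) ?_ (and hS (hN 1) ?_ ?_)
  · refine all hS (hN 1) ?_ fun a v v' x h => by
      rw [hP' a v v' fun t ht => h t (by omega), h (n a) (by omega),
        On.congr fun t ht => h t (by omega)]
    exact imp hS (hN 2) (on₂ hS (hN 2) hMU hn hn (hN 1)) (hP _ _ (hN 2) (hN 1))
  · refine all hS (hN 1) ?_ fun a v v' x h => by
      rw [hP' a v v' fun t ht => h t (by omega), h (n a) (by omega),
        On.congr fun t ht => h t (by omega)]
    refine imp hS (hN 2) (hP _ _ (hN 2) (hN 1)) ?_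
    refine ex hS (hN 2) ?_ fun a v v' x h => by
      rw [h (n a) (by omega), h (n a + 1) (by omega), On.congr fun t ht => h t (by omega)]
    exact and hS (hN 3) (on₂ hS (hN 3) hMU hn hn (hN 2)) (hE _ _ _ (hN 3) (hN 1) (hN 2))
  · refine all hS (hN 1) ?_ fun a v v' x h => by
      rw [h (n a) (by omega), On.congr fun t ht => h t (by omega)]
    refine all hS (hN 2) ?_ fun a v v' x h => by
      rw [h (n a) (by omega), h (n a + 1) (by omega), On.congr fun t ht => h t (by omega)]
    exact imp hS (hN 3) (on₂ hS (hN 3) hMU hn hn (hN 1)) (imp hS (hN 3)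
      (on₂ hS (hN 3) hMU hn hn (hN 2)) (imp hS (hN 3) (hE _ _ _ (hN 3) (hN 1) (hN 2))
      (eq hS (hN 3) (hN 1) (hN 2))))

omit hP hP' hE

theorem countZero {MG : α → BuchiAutomaton} (hMG : Primrec MG) :
    ER S (fun a => n a + 1) fun a v =>
      CountZero (S a) (fun y => (MU a).On (n a) v [v (n a), y])
        fun _ y => (MG a).On (n a) v [v (n a), y] := by
  have hN : ∀ k : ℕ, Primrec fun a => n a + k := fun k => by fun_prop
  unfold CountZero
  refine all hS (hN 1) ?_ fun a v v' x h => by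
    rw [h (n a) (by omega), On.congr fun t ht => h t (by omega),
      On.congr (fun t ht => h t (by omega)) (MG a)]
  refine imp hS (hN 2) (on₂ hS (hN 2) hMU hn hn (hN 1)) (imp hS (hN 2) ?_
    (on₂ hS (hN 2) hMG hn hn (hN 1)))
  refine all hS (hN 2) ?_ fun a v v' x h => by
    rw [h (n a) (by omega), h (n a + 1) (by omega), On.congr fun t ht => h t (by omega)]
  exact imp hS (hN 3) (on₂ hS (hN 3) hMU hn hn (hN 2)) (not hS (hN 3)
    (lexLt hS (hN 3) (hN 2) (hN 1)))

theorem countSucc {MG MG' : α → BuchiAutomaton} (hMG : Primrec MG) (hMG' : Primrec MG') :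
    ER S (fun a => n a + 1) fun a v =>
      ∀ y : ℕ → ℕ, (∀ i, y i < S a) → ∀ y' : ℕ → ℕ, (∀ i, y' i < S a) →
        (MU a).On (n a) v [v (n a), y] → (MU a).On (n a) v [v (n a), y'] → LexLt y y' →
        (∀ w : ℕ → ℕ, (∀ i, w i < S a) → (MU a).On (n a) v [v (n a), w] →
          ¬ (LexLt y w ∧ LexLt w y')) →
        (MG a).On (n a) v [v (n a), y] → (MG' a).On (n a) v [v (n a), y'] := by
  have hN : ∀ k : ℕ, Primrec fun a => n a + k := fun k => by fun_prop
  refine all hS (hN 1) ?_ fun a v v' x h => by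
    rw [h (n a) (by omega), On.congr fun t ht => h t (by omega),
      On.congr (fun t ht => h t (by omega)) (MG a), On.congr (fun t ht => h t (by omega)) (MG' a)]
  refine all hS (hN 2) ?_ fun a v v' x h => by
    rw [h (n a) (by omega), h (n a + 1) (by omega), On.congr fun t ht => h t (by omega),
      On.congr (fun t ht => h t (by omega)) (MG a), On.congr (fun t ht => h t (by omega)) (MG' a)]
  refine imp hS (hN 3) (on₂ hS (hN 3) hMU hn hn (hN 1)) (imp hS (hN 3)
    (on₂ hS (hN 3) hMU hn hn (hN 2)) (imp hS (hN 3) (lexLt hS (hN 3) (hN 1) (hN 2))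
    (imp hS (hN 3) ?_ (imp hS (hN 3) (on₂ hS (hN 3) hMG hn hn (hN 1))
    (on₂ hS (hN 3) hMG' hn hn (hN 2))))))
  refine all hS (hN 3) ?_ fun a v v' x h => by
    rw [h (n a) (by omega), h (n a + 1) (by omega), h (n a + 2) (by omega),
      On.congr fun t ht => h t (by omega)]
  exact imp hS (hN 4) (on₂ hS (hN 4) hMU hn hn (hN 3)) (not hS (hN 4) (and hS (hN 4)
    (lexLt hS (hN 4) (hN 1) (hN 3)) (lexLt hS (hN 4) (hN 3) (hN 2))))

theorem countExclusive {MG MG' : α → BuchiAutomaton} (hMG : Primrec MG) (hMG' : Primrec MG') :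
    ER S (fun a => n a + 1) fun a v =>
      ∀ y : ℕ → ℕ, (∀ i, y i < S a) → (MU a).On (n a) v [v (n a), y] →
        ¬ ((MG a).On (n a) v [v (n a), y] ∧ (MG' a).On (n a) v [v (n a), y]) := by
  have hN : ∀ k : ℕ, Primrec fun a => n a + k := fun k => by fun_prop
  refine all hS (hN 1) ?_ fun a v v' x h => by
    rw [h (n a) (by omega), On.congr fun t ht => h t (by omega),
      On.congr (fun t ht => h t (by omega)) (MG a), On.congr (fun t ht => h t (by omega)) (MG' a)]
  exact imp hS (hN 2) (on₂ hS (hN 2) hMU hn hn (hN 1)) (not hS (hN 2) (and hS (hN 2)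
    (on₂ hS (hN 2) hMG hn hn (hN 1)) (on₂ hS (hN 2) hMG' hn hn (hN 1))))

theorem modCount {MG : α → BuchiAutomaton} (hMG : Primrec MG) {p : α → Prop}
    (hp : PrimrecPred p) :
    ER S (fun a => n a + 1) fun a v =>
      (p a ∧ ∀ y : ℕ → ℕ, (∀ i, y i < S a) → ¬ (MU a).On (n a) v [v (n a), y]) ∨
      ∃ y : ℕ → ℕ, (∀ i, y i < S a) ∧ ((MU a).On (n a) v [v (n a), y] ∧
        (∀ y' : ℕ → ℕ, (∀ i, y' i < S a) → (MU a).On (n a) v [v (n a), y'] → ¬ LexLt y y') ∧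
          (MG a).On (n a) v [v (n a), y]) := by
  have hN : ∀ k : ℕ, Primrec fun a => n a + k := fun k => by fun_prop
  refine or hS (hN 1) (and hS (hN 1) ?_ ?_) ?_
  · exact (forall_col hS (hN 1) (ρ := fun _ => []) (p := fun a _ => p a) (by fun_prop)
      (hp.comp Primrec.fst)).of_iff fun a v _ => by simp
  · refine all hS (hN 1) ?_ fun a v v' x h => by
      rw [h (n a) (by omega), On.congr fun t ht => h t (by omega)]
    exact not hS (hN 2) (on₂ hS (hN 2) hMU hn hn (hN 1))
  · refine ex hS (hN 1) ?_ fun a v v' x h => by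
      rw [h (n a) (by omega), On.congr fun t ht => h t (by omega),
        On.congr (fun t ht => h t (by omega)) (MG a)]
    refine and hS (hN 2) (on₂ hS (hN 2) hMU hn hn (hN 1)) (and hS (hN 2) ?_
      (on₂ hS (hN 2) hMG hn hn (hN 1)))
    refine all hS (hN 2) ?_ fun a v v' x h => by
      rw [h (n a) (by omega), h (n a + 1) (by omega), On.congr fun t ht => h t (by omega)]
    exact imp hS (hN 3) (on₂ hS (hN 3) hMU hn hn (hN 2)) (not hS (hN 3)
      (lexLt hS (hN 3) (hN 1) (hN 2)))

end

end ER

/-! ### Checking certificates -/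

open Function BuchiAutomaton

/-- The empty automaton, as a default value. -/
def BuchiAutomaton.none : BuchiAutomaton := ⟨[], [], []⟩

/-- There are finitely many classes at the parameters `v`, as far as this can be expressed. -/
def FinitelyMany (S s n : ℕ) (Md Me M : BuchiAutomaton) (v : Env) : Prop :=
  (∀ y : ℕ → ℕ, (∀ i, y i < S) → ∀ y' : ℕ → ℕ, (∀ i, y' i < S) → EqvRel s Me y y' →
    PRel s Md n M v y → PRel s Md n M v y') ∧
  (¬ Pattern S (PRel s Md n M v) (EqvRel s Me) ∧ ¬ InfNear S (PRel s Md n M v) (EqvRel s Me))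

/-- `X` holds for all codes `t` of transversals. -/
def ForTransversals (S s n : ℕ) (Md Me M MU : BuchiAutomaton) (X : Env → (ℕ → ℕ) → Prop) : Prop :=
  ∀ v, InEnv S n v → FinitelyMany S s n Md Me M v → ∀ t : ℕ → ℕ, (∀ i, t i < S) →
    IsTransversal S (PRel s Md n M v) (EqvRel s Me) (fun y => MU.On n v [t, y]) → X v t

namespace ER

variable {α : Type*} [Primcodable α] {S n s m : α → ℕ} {Md Me M MU : α → BuchiAutomaton}

theorem underCertificate (hS : Primrec S) (hn : Primrec n) (hs : Primrec s) (hMd : Primrec Md)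
    (hMe : Primrec Me) (hM : Primrec M) (hMU : Primrec MU) {X : α → Env → (ℕ → ℕ) → Prop}
    (hX : ER S (fun a => n a + 1) fun a v => X a v (v (n a)))
    (hX' : ∀ a v v' x, (∀ t < n a, v t = v' t) → (X a v x ↔ X a v' x)) :
    Sig1 fun a => ForTransversals (S a) (s a) (n a) (Md a) (Me a) (M a) (MU a) (X a) := by
  have hN : Primrec fun a => n a + 1 := by fun_prop
  have hP := fun (m t : α → ℕ) (hm : Primrec m) (ht : Primrec t) =>
    pRel hS hs hn hMd hM hm ht
  have hE := fun (m t t' : α → ℕ) (hm : Primrec m) (ht : Primrec t) (ht' : Primrec t') =>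
    eqvRel hS hs hMe hm ht ht'
  have hP' : ∀ a v v', (∀ t < n a, v t = v' t) →
      PRel (s a) (Md a) (n a) (M a) v = PRel (s a) (Md a) (n a) (M a) v' :=
    fun a v v' h => PRel.congr h _ _ _
  refine sig1_forall hS hn (imp hS hn (finitelyMany hS hn hP hP' hE) ?_)
  refine all hS hn ?_ fun a v v' x h => by rw [hX' a v v' x h, hP' a v v' h, On.congr h]
  exact imp hS hN (isTransversal hS hn hP hP' hE hMU) hX

theorem existsTransversal (hS : Primrec S) (hn : Primrec n) (hs : Primrec s) (hMd : Primrec Md)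
    (hMe : Primrec Me) (hM : Primrec M) (hMU : Primrec MU) :
    Sig1 fun a => ∀ v, InEnv (S a) (n a) v → FinitelyMany (S a) (s a) (n a) (Md a) (Me a) (M a) v →
      ∃ t : ℕ → ℕ, (∀ i, t i < S a) ∧ IsTransversal (S a) (PRel (s a) (Md a) (n a) (M a) v)
        (EqvRel (s a) (Me a)) (fun y => (MU a).On (n a) v [t, y]) := by
  have hP := fun (m t : α → ℕ) (hm : Primrec m) (ht : Primrec t) =>
    pRel hS hs hn hMd hM hm ht
  have hE := fun (m t t' : α → ℕ) (hm : Primrec m) (ht : Primrec t) (ht' : Primrec t') =>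
    eqvRel hS hs hMe hm ht ht'
  have hP' : ∀ a v v', (∀ t < n a, v t = v' t) →
      PRel (s a) (Md a) (n a) (M a) v = PRel (s a) (Md a) (n a) (M a) v' :=
    fun a v v' h => PRel.congr h _ _ _
  refine sig1_forall hS hn (imp hS hn (finitelyMany hS hn hP hP' hE) ?_)
  refine ex hS hn ?_ fun a v v' x h => by rw [hP' a v v' h, On.congr h]
  exact isTransversal hS hn hP hP' hE hMU

/-- Since `m` is part of the input, the conditions for residues below `m` cannot be combined into
one fixed formula. The residues become additional parameters, and bounded quantification takes place
among Σ₁ predicates. -/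
theorem sig1_certifies (hS : Primrec S) (hn : Primrec n) (hs : Primrec s) (hMd : Primrec Md)
    (hMe : Primrec Me) (hM : Primrec M) (hMU : Primrec MU) {MG : α → List BuchiAutomaton}
    (hMG : Primrec MG) (hm : Primrec m) :
    Sig1 fun a => ∀ v, InEnv (S a) (n a) v → Certifies (S a) (m a)
      (PRel (s a) (Md a) (n a) (M a) v) (EqvRel (s a) (Me a))
      (fun t y => (MU a).On (n a) v [t, y])
      fun r t y => ((MG a).getD r BuchiAutomaton.none).On (n a) v [t, y] := by
  have h1 := existsTransversal hS hn hs hMd hMe hM hMU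
  have h2 := underCertificate hS hn hs hMd hMe hM hMU (X := fun a v t =>
      CountZero (S a) (fun y => (MU a).On (n a) v [t, y])
        fun _ y => ((MG a).getD 0 BuchiAutomaton.none).On (n a) v [t, y])
    (countZero hS hn hMU (by fun_prop)) fun a v v' x h => by
      rw [On.congr h, On.congr h ((MG a).getD 0 BuchiAutomaton.none)]
  have h3 := underCertificate (α := α × ℕ) (hS.comp Primrec.fst) (hn.comp Primrec.fst)
    (hs.comp Primrec.fst) (hMd.comp Primrec.fst) (hMe.comp Primrec.fst) (hM.comp Primrec.fst)
    (hMU.comp Primrec.fst) (X := fun a v t => ∀ y : ℕ → ℕ, (∀ i, y i < S a.1) →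
      ∀ y' : ℕ → ℕ, (∀ i, y' i < S a.1) →
        (MU a.1).On (n a.1) v [t, y] → (MU a.1).On (n a.1) v [t, y'] → LexLt y y' →
        (∀ w : ℕ → ℕ, (∀ i, w i < S a.1) → (MU a.1).On (n a.1) v [t, w] →
          ¬ (LexLt y w ∧ LexLt w y')) →
        ((MG a.1).getD a.2 BuchiAutomaton.none).On (n a.1) v [t, y] →
          ((MG a.1).getD ((a.2 + 1) % m a.1) BuchiAutomaton.none).On (n a.1) v [t, y'])
    (countSucc (α := α × ℕ) (hS.comp Primrec.fst) (hn.comp Primrec.fst) (hMU.comp Primrec.fst)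
      (MG := fun a => (MG a.1).getD a.2 BuchiAutomaton.none)
      (MG' := fun a => (MG a.1).getD ((a.2 + 1) % m a.1) BuchiAutomaton.none)
      (by fun_prop) (by fun_prop)) fun a v v' x h => by
      rw [On.congr h, On.congr h ((MG a.1).getD a.2 BuchiAutomaton.none),
        On.congr h ((MG a.1).getD ((a.2 + 1) % m a.1) BuchiAutomaton.none)]
  have hf : Primrec fun a : (α × ℕ) × ℕ => a.1.1 := by fun_prop
  have h4 := underCertificate (α := (α × ℕ) × ℕ) (hS.comp hf) (hn.comp hf)
    (hs.comp hf) (hMd.comp hf) (hMe.comp hf) (hM.comp hf)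
    (hMU.comp hf) (X := fun a v t => ∀ y : ℕ → ℕ, (∀ i, y i < S a.1.1) →
        (MU a.1.1).On (n a.1.1) v [t, y] →
        ¬ (((MG a.1.1).getD a.1.2 BuchiAutomaton.none).On (n a.1.1) v [t, y] ∧
          ((MG a.1.1).getD a.2 BuchiAutomaton.none).On (n a.1.1) v [t, y]))
    (countExclusive (α := (α × ℕ) × ℕ) (hS.comp hf) (hn.comp hf) (hMU.comp hf)
      (MG := fun a => (MG a.1.1).getD a.1.2 BuchiAutomaton.none)
      (MG' := fun a => (MG a.1.1).getD a.2 BuchiAutomaton.none)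
      (by fun_prop) (by fun_prop)) fun a v v' x h => by
      rw [On.congr h, On.congr h ((MG a.1.1).getD a.1.2 BuchiAutomaton.none),
        On.congr h ((MG a.1.1).getD a.2 BuchiAutomaton.none)]
  have h5 := Sig1.forall_lt (p := fun a r => ForTransversals (S a) (s a) (n a) (Md a) (Me a) (M a)
    (MU a) fun v t => CountSucc (S a) (m a) (fun y => (MU a).On (n a) v [t, y])
      (fun r y => ((MG a).getD r BuchiAutomaton.none).On (n a) v [t, y]) r) h3 hm
  have hne : Sig1 fun a : (α × ℕ) × ℕ => a.1.2 = a.2 :=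
    Sig1.of_primrecPred (PrimrecPred.eq (by fun_prop) (by fun_prop))
  have h6 := Sig1.forall_lt (α := α × ℕ) (p := fun a r' => a.2 = r' ∨
    ForTransversals (S a.1) (s a.1) (n a.1) (Md a.1) (Me a.1) (M a.1)
    (MU a.1) fun v t => CountExclusive (S a.1) (fun y => (MU a.1).On (n a.1) v [t, y])
      (fun r y => ((MG a.1).getD r BuchiAutomaton.none).On (n a.1) v [t, y]) a.2 r')
      (hne.or h4) (hm.comp Primrec.fst)
  have h7 := Sig1.forall_lt (p := fun (a : α) r => ∀ r' < m a, r = r' ∨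
    ForTransversals (S a) (s a) (n a) (Md a) (Me a) (M a)
    (MU a) fun v t => CountExclusive (S a) (fun y => (MU a).On (n a) v [t, y])
      (fun r y => ((MG a).getD r BuchiAutomaton.none).On (n a) v [t, y]) r r') h6 hm
  refine (h1.and (h2.and (h5.and h7))).of_eq fun a => ?_
  constructor
  · rintro ⟨h1, h2, h3, h4⟩ v hv hinv hpat hinf
    refine ⟨h1 v hv ⟨hinv, hpat, hinf⟩, fun t ht hU => ⟨h2 v hv ⟨hinv, hpat, hinf⟩ t ht hU,
      fun r hr => h3 r hr v hv ⟨hinv, hpat, hinf⟩ t ht hU, fun r hr r' hr' hne =>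
        ((h4 r hr r' hr').resolve_left hne) v hv ⟨hinv, hpat, hinf⟩ t ht hU⟩⟩
  · intro h
    refine ⟨fun v hv hf => (h v hv hf.1 hf.2.1 hf.2.2).1,
      fun v hv hf t ht hU => ((h v hv hf.1 hf.2.1 hf.2.2).2 t ht hU).1,
      fun r hr v hv hf t ht hU => ((h v hv hf.1 hf.2.1 hf.2.2).2 t ht hU).2.1 r hr,
      fun r hr r' hr' => or_iff_not_imp_left.2 fun hne v hv hf t ht hU =>
        ((h v hv hf.1 hf.2.1 hf.2.2).2 t ht hU).2.2 r hr r' hr' hne⟩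

/-- The number of classes is finite and congruent to `r` modulo `m`, by means of a certificate. -/
def _root_.ModRel (S s n m r : ℕ) (Md Me M MU : BuchiAutomaton) (MG : List BuchiAutomaton)
    (v : Env) : Prop :=
  ¬ Pattern S (PRel s Md n M v) (EqvRel s Me) ∧ (¬ InfNear S (PRel s Md n M v) (EqvRel s Me) ∧
    ∃ t : ℕ → ℕ, (∀ i, t i < S) ∧
      (IsTransversal S (PRel s Md n M v) (EqvRel s Me) (fun y => MU.On n v [t, y]) ∧
        ModCount S m (fun y => MU.On n v [t, y])
          (fun r y => (MG.getD r BuchiAutomaton.none).On n v [t, y]) r))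

theorem modRel (hS : Primrec S) (hn : Primrec n) (hs : Primrec s) (hMd : Primrec Md)
    (hMe : Primrec Me) (hM : Primrec M) (hMU : Primrec MU) {MG : α → List BuchiAutomaton}
    (hMG : Primrec MG) (hm : Primrec m) {r : α → ℕ} (hr : Primrec r) :
    ER S n fun a v =>
      ModRel (S a) (s a) (n a) (m a) (r a) (Md a) (Me a) (M a) (MU a) (MG a) v := by
  have hN : Primrec fun a => n a + 1 := by fun_prop
  have hP := fun (m t : α → ℕ) (hm : Primrec m) (ht : Primrec t) =>
    pRel hS hs hn hMd hM hm ht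
  have hE := fun (m t t' : α → ℕ) (hm : Primrec m) (ht : Primrec t) (ht' : Primrec t') =>
    eqvRel hS hs hMe hm ht ht'
  have hP' : ∀ a v v', (∀ t < n a, v t = v' t) →
      PRel (s a) (Md a) (n a) (M a) v = PRel (s a) (Md a) (n a) (M a) v' :=
    fun a v v' h => PRel.congr h _ _ _
  refine and hS hn (not hS hn (pattern hS hn hP hP' hE)) (and hS hn
    (not hS hn (infNear hS hn hP hP' hE)) ?_)
  refine ex hS hn ?_ fun a v v' x h => by
    simp only [ModCount]
    rw [hP' a v v' h, On.congr h, On.congr h ((MG a).getD _ BuchiAutomaton.none)]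
  refine and hS hN (isTransversal hS hn hP hP' hE hMU) ?_
  exact modCount (p := fun a => r a % m a = 0)
    (MG := fun a => (MG a).getD ((r a + m a - 1) % m a) BuchiAutomaton.none)
    hS hn hMU (by fun_prop) (by fun_prop)

end ER

section

variable (s : ℕ) (Md Me M : BuchiAutomaton) (n : ℕ)

theorem sat_pRel (t : ℕ) : Sat fun v => PRel s Md n M v (v t) := by
  refine (Sat.forall_col fun f => f t < s).and ((sat_at Md [t]).and
    ((sat_at M (List.range n ++ [t])).of_iff fun v => ?_))
  simp [At, On, Env.col]

theorem sat_eqvRel (t t' : ℕ) : Sat fun v => EqvRel s Me (v t) (v t') :=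
  (Sat.forall_col fun f => f t < s).and ((Sat.forall_col fun f => f t' < s).and
    (sat_at Me [t, t']))

end

/-! ### Presentations -/

open Function BuchiAutomaton

/-- A tuple of infinite words as an environment. -/
def toEnv {s n : ℕ} (w : Fin n → OmegaWord s) : Env := fun t i => if h : t < n then w ⟨t, h⟩ i else 0

theorem toEnv_of_lt {s n : ℕ} (w : Fin n → OmegaWord s) {t : ℕ} (h : t < n) :
    toEnv w t = fun i => (w ⟨t, h⟩ i : ℕ) := by
  funext i
  rw [toEnv, dif_pos h]

theorem inEnv_toEnv {s n S : ℕ} (w : Fin n → OmegaWord s) (h : s ≤ S) : InEnv S n (toEnv w) :=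
  fun i => ⟨fun t ht => by
    rw [toEnv_of_lt _ ht]
    exact (w _ i).2.trans_le h, fun t ht => by rw [toEnv, dif_neg (by omega)]⟩

theorem BuchiAutomaton.accepts_iff_on (M : BuchiAutomaton) {s n : ℕ} (w : Fin n → OmegaWord s) :
    M.Accepts w ↔ M.On n (toEnv w) [] := by
  have : ∀ i, List.ofFn (fun j => (w j i : ℕ)) = (List.range n).map ((toEnv w).col i) := fun i =>
    List.ext_getElem (by simp) fun t h1 h2 => by
      have : t < n := by simpa using h1
      simp [Env.col, toEnv, this]
  simp only [Accepts, On, AcceptsWord, this, List.map_nil, List.append_nil]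

theorem BuchiAutomaton.accepts_snoc_iff (M : BuchiAutomaton) {s n : ℕ} (w : Fin n → OmegaWord s)
    (y : OmegaWord s) :
    M.Accepts (Fin.snoc w y : Fin (n + 1) → OmegaWord s) ↔
      M.On n (toEnv w) [fun i => (y i : ℕ)] := by
  have : ∀ i, List.ofFn (fun j => ((Fin.snoc w y : Fin (n + 1) → OmegaWord s) j i : ℕ)) =
      (List.range n).map ((toEnv w).col i) ++ [(y i : ℕ)] := fun i => by
    rw [List.ofFn_succ', List.concat_eq_append]
    simp only [Fin.snoc_castSucc, Fin.snoc_last]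
    congr 1
    exact List.ext_getElem (by simp) fun t h1 h2 => by
      have : t < n := by simpa using h1
      simp [Env.col, toEnv, this]
  simp only [Accepts, On, AcceptsWord, this, List.map_cons, List.map_nil]

theorem BuchiAutomaton.accepts_one_iff (M : BuchiAutomaton) {s : ℕ} (y : OmegaWord s) :
    M.Accepts ![y] ↔ M.AcceptsWord fun i => [(y i : ℕ)] := by
  simp [Accepts, AcceptsWord]

theorem BuchiAutomaton.accepts_two_iff (M : BuchiAutomaton) {s : ℕ} (x y : OmegaWord s) :
    M.Accepts ![x, y] ↔ M.AcceptsWord fun i => [(x i : ℕ), (y i : ℕ)] := by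
  simp [Accepts, AcceptsWord]

namespace OmegaPresentation

variable {ι A : Type*} {ar : ι → ℕ} {d : OmegaPresentation ι} {R : RelStructure ar A}
  {f : d.Dom → A}

open Classical in
/-- The element named by a word of natural numbers, if any. -/
noncomputable def name (f : d.Dom → A) (y : ℕ → ℕ) : Option A :=
  if h : ∃ w : d.Dom, ∀ i, (w.1 i : ℕ) = y i then some (f h.choose) else none

theorem name_eq_some {y : ℕ → ℕ} {a : A} :
    name f y = some a ↔ ∃ w : d.Dom, (∀ i, (w.1 i : ℕ) = y i) ∧ f w = a := by
  unfold name
  split_ifs with h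
  · rw [Option.some_inj]
    refine ⟨fun e => ⟨_, h.choose_spec, e⟩, ?_⟩
    rintro ⟨w, hw, rfl⟩
    congr 1
    exact Subtype.ext (funext fun i => Fin.ext ((h.choose_spec i).trans (hw i).symm))
  · simp only [false_iff]
    rintro ⟨w, hw, -⟩
    exact h ⟨w, hw⟩

/-- The automaton recognizes the relation that the formula defines, on names. -/
def Spec (R : RelStructure ar A) (f : d.Dom → A) {n : ℕ} (φ : FOC ar n) (M : BuchiAutomaton) :
    Prop :=
  ∀ w : Fin n → d.Dom, M.Accepts (fun j => (w j).1) ↔ φ.Realize R fun j => f (w j)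

section

variable {n : ℕ} {φ : FOC ar (n + 1)} {M : BuchiAutomaton}

/-- `Spec` constrains `M` on tuples of names only; therefore `PRel` also tests the new word against
the domain automaton. -/
theorem pRel_iff (hM : Spec R f φ M) (w : Fin n → d.Dom) (y : ℕ → ℕ) :
    PRel d.alphabet d.dom n M (toEnv fun j => (w j).1) y ↔
      ∃ a, name f y = some a ∧ φ.Realize R (Fin.snoc (fun j => f (w j)) a : Fin (n + 1) → A) := by
  have key : ∀ x : d.Dom, M.On n (toEnv fun j => (w j).1) [fun i => (x.1 i : ℕ)] ↔
      φ.Realize R (Fin.snoc (fun j => f (w j)) (f x) : Fin (n + 1) → A) := fun x => by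
    rw [← accepts_snoc_iff]
    have h1 := hM (Fin.snoc w x : Fin (n + 1) → d.Dom)
    have e1 : (fun j => ((Fin.snoc w x : Fin (n + 1) → d.Dom) j).1) =
        (Fin.snoc (fun j => (w j).1) x.1 : Fin (n + 1) → OmegaWord d.alphabet) := by
      funext j
      refine Fin.lastCases ?_ (fun j => ?_) j <;> simp
    have e2 : (fun j => f ((Fin.snoc w x : Fin (n + 1) → d.Dom) j)) =
        (Fin.snoc (fun j => f (w j)) (f x) : Fin (n + 1) → A) := by
      funext j
      refine Fin.lastCases ?_ (fun j => ?_) j <;> simp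
    rwa [e1, e2] at h1
  constructor
  · rintro ⟨hy, hd, hMy⟩
    let x : d.Dom := ⟨fun i => ⟨y i, hy i⟩, (accepts_one_iff _ _).2 hd⟩
    exact ⟨f x, name_eq_some.2 ⟨x, fun _ => rfl, rfl⟩, (key x).1 hMy⟩
  · rintro ⟨a, ha, hφ⟩
    obtain ⟨x, hx, rfl⟩ := name_eq_some.1 ha
    obtain rfl : (fun i => (x.1 i : ℕ)) = y := funext hx
    exact ⟨fun i => (x.1 i).2, (accepts_one_iff _ _).1 x.2, (key x).2 hφ⟩

theorem eqvRel_iff (h : d.Presents R f) (x y : ℕ → ℕ) :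
    EqvRel d.alphabet d.eqv x y ↔ ∃ a, name f x = some a ∧ name f y = some a := by
  constructor
  · rintro ⟨hx, hy, he⟩
    obtain ⟨h1, h2, e⟩ := (h.eqv_iff (fun i => ⟨x i, hx i⟩) fun i => ⟨y i, hy i⟩).1
      ((accepts_two_iff _ _ _).2 he)
    exact ⟨_, name_eq_some.2 ⟨⟨_, h1⟩, fun _ => rfl, rfl⟩,
      name_eq_some.2 ⟨⟨_, h2⟩, fun _ => rfl, e.symm⟩⟩
  · rintro ⟨a, h1, h2⟩
    obtain ⟨u, hu, rfl⟩ := name_eq_some.1 h1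
    obtain ⟨w, hw, e⟩ := name_eq_some.1 h2
    obtain rfl : (fun i => (u.1 i : ℕ)) = x := funext hu
    obtain rfl : (fun i => (w.1 i : ℕ)) = y := funext hw
    exact ⟨fun i => (u.1 i).2, fun i => (w.1 i).2, (accepts_two_iff _ _ _).1
      ((h.eqv_iff _ _).2 ⟨u.2, w.2, e.symm⟩)⟩

theorem names (h : d.Presents R f) (hM : Spec R f φ M) (w : Fin n → d.Dom) {S : ℕ}
    (hS : d.alphabet + 2 ≤ S) :
    Names S (PRel d.alphabet d.dom n M (toEnv fun j => (w j).1)) (EqvRel d.alphabet d.eqv)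
      (name f) where
  lt x hx i := (hx.1 i).trans_le (by omega)
  two_le := by omega
  iff x y hx hy := by
    obtain ⟨a, ha, -⟩ := (pRel_iff hM w x).1 hx
    obtain ⟨b, hb, -⟩ := (pRel_iff hM w y).1 hy
    rw [eqvRel_iff h, ha, hb]
    simp [eq_comm]
  closed x y hxy hx := by
    obtain ⟨a, ha, hφ⟩ := (pRel_iff hM w x).1 hx
    obtain ⟨b, hb, hb'⟩ := (eqvRel_iff h x y).1 hxy
    obtain rfl : a = b := Option.some_inj.1 (ha.symm.trans hb)
    exact (pRel_iff hM w y).2 ⟨a, hb', hφ⟩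

theorem image_name (h : d.Presents R f) (hM : Spec R f φ M) (w : Fin n → d.Dom) :
    name f '' {y | PRel d.alphabet d.dom n M (toEnv fun j => (w j).1) y} =
      some '' {a | φ.Realize R (Fin.snoc (fun j => f (w j)) a : Fin (n + 1) → A)} := by
  ext o
  constructor
  · rintro ⟨y, hy, rfl⟩
    obtain ⟨a, ha, hφ⟩ := (pRel_iff hM w y).1 hy
    exact ⟨a, hφ, ha.symm⟩
  · rintro ⟨a, hφ, rfl⟩
    obtain ⟨x, rfl⟩ := h.surjective a
    have h1 : name f (fun i => (x.1 i : ℕ)) = some (f x) := name_eq_some.2 ⟨x, fun _ => rfl, rfl⟩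
    exact ⟨_, (pRel_iff hM w _).2 ⟨_, h1, hφ⟩, h1⟩

/-- The dichotomy for presentations. Without a pattern, `exists_bound` gives finitely many
representatives up to finite changes, hence countably many elements, and these can be infinitely
many only by accumulating near a representative. The two extra letters leave room for the marks `0`
and `1`. -/
theorem pattern_iff (h : d.Presents R f) (hM : Spec R f φ M) (w : Fin n → d.Dom) {S : ℕ}
    (hS : d.alphabet + 2 ≤ S) :
    (Pattern S (PRel d.alphabet d.dom n M (toEnv fun j => (w j).1)) (EqvRel d.alphabet d.eqv) ↔
      ¬ {a | φ.Realize R (Fin.snoc (fun j => f (w j)) a : Fin (n + 1) → A)}.Countable) ∧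
    (Pattern S (PRel d.alphabet d.dom n M (toEnv fun j => (w j).1)) (EqvRel d.alphabet d.eqv) ∨
      InfNear S (PRel d.alphabet d.dom n M (toEnv fun j => (w j).1)) (EqvRel d.alphabet d.eqv) ↔
      {a | φ.Realize R (Fin.snoc (fun j => f (w j)) a : Fin (n + 1) → A)}.Infinite) := by
  have hn := names h hM w hS
  obtain ⟨C, hC⟩ := exists_bound (E := fun _ => EqvRel d.alphabet d.eqv)
    (sat_pRel d.alphabet d.dom M n n) (sat_eqvRel d.alphabet d.eqv n (n + 1))
    (fun z z' hz => PRel.congr hz _ _ _) fun _ _ _ => rfl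
  have htr : ∀ u v w, EqvRel d.alphabet d.eqv u v → EqvRel d.alphabet d.eqv v w →
      EqvRel d.alphabet d.eqv u w := fun u v w h1 h2 => by
    rw [eqvRel_iff h] at h1 h2 ⊢
    obtain ⟨a, ha, ha'⟩ := h1
    obtain ⟨b, hb, hb'⟩ := h2
    obtain rfl : a = b := Option.some_inj.1 (ha'.symm.trans hb)
    exact ⟨a, ha, hb'⟩
  have hl := hC S (toEnv fun j => (w j).1) hn.two_le hn.lt htr
  have hc : {a | φ.Realize R (Fin.snoc (fun j => f (w j)) a : Fin (n + 1) → A)}.Countable ↔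
      (name f '' {y | PRel d.alphabet d.dom n M (toEnv fun j => (w j).1) y}).Countable := by
    rw [image_name h hM]
    exact ⟨fun h => h.image _, fun h => Set.countable_of_injective_of_countable_image
      (Option.some_injective A).injOn h⟩
  have hi : {a | φ.Realize R (Fin.snoc (fun j => f (w j)) a : Fin (n + 1) → A)}.Infinite ↔
      (name f '' {y | PRel d.alphabet d.dom n M (toEnv fun j => (w j).1) y}).Infinite := by
    rw [image_name h hM, Set.infinite_image_iff (Option.some_injective A).injOn]
  rw [hc, hi]
  refine ⟨⟨hn.not_countable_of_pattern, fun hnc => ?_⟩, ⟨?_, fun hinf => ?_⟩⟩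
  · by_contra hp
    obtain ⟨l, -, -, hl⟩ := hl hp
    exact hnc (hn.countable_of_list hl)
  · rintro (hp | hp)
    · exact fun hfin => hn.not_countable_of_pattern hp hfin.countable
    · exact hn.infinite_of_infNear hp
  · by_contra! hcon
    obtain ⟨l, -, hlP, hl⟩ := hl hcon.1
    exact hcon.2 (hn.infNear_of_infinite hlP hl hinf)

/-- The automata certify the counting of classes modulo `m`. -/
def IsCertificate (d : OmegaPresentation ι) (n m : ℕ) (M : BuchiAutomaton) (S : ℕ)
    (MU : BuchiAutomaton) (MG : List BuchiAutomaton) : Prop :=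
  d.alphabet + 2 ≤ S ∧ ∀ v, InEnv S n v → Certifies S m (PRel d.alphabet d.dom n M v)
    (EqvRel d.alphabet d.eqv) (fun t y => MU.On n v [t, y])
    fun r t y => (MG.getD r BuchiAutomaton.none).On n v [t, y]

/-- Any verified certificate may be used: for finitely many elements its conditions force `ModCount`
to give the true residue, and for infinitely many one of the first two conjuncts of `ModRel` fails.
-/
theorem modRel_iff (h : d.Presents R f) (hM : Spec R f φ M) (w : Fin n → d.Dom) {S m : ℕ}
    (hm : 0 < m) {MU : BuchiAutomaton} {MG : List BuchiAutomaton}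
    (hc : IsCertificate d n m M S MU MG) (r : ℕ) :
    ModRel S d.alphabet n m r d.dom d.eqv M MU MG (toEnv fun j => (w j).1) ↔
      (FOC.exMod r m hm φ).Realize R fun j => f (w j) := by
  have hn := names h hM w hc.1
  have hpat := (pattern_iff h hM w hc.1).2
  have hcert := hc.2 (toEnv fun j => (w j).1) (inEnv_toEnv _ (by have := hc.1; omega))
    fun x _ y _ => hn.closed x y
  have hncard : {a | φ.Realize R (Fin.snoc (fun j => f (w j)) a : Fin (n + 1) → A)}.ncard =
      (name f '' {y | PRel d.alphabet d.dom n M (toEnv fun j => (w j).1) y}).ncard := by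
    rw [image_name h hM, Set.ncard_image_of_injective _ (Option.some_injective A)]
  have hfin : {a | φ.Realize R (Fin.snoc (fun j => f (w j)) a : Fin (n + 1) → A)}.Finite ↔
      (name f '' {y | PRel d.alphabet d.dom n M (toEnv fun j => (w j).1) y}).Finite := by
    rw [image_name h hM, Set.finite_image_iff (Option.some_injective A).injOn]
  simp only [FOC.Realize]
  rw [hncard]
  constructor
  · rintro ⟨h1, h2, t, ht, hU, hcnt⟩
    have hf : {a | φ.Realize R (Fin.snoc (fun j => f (w j)) a : Fin (n + 1) → A)}.Finite := by
      by_contra hcon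
      rcases hpat.2 hcon with h | h
      exacts [h1 h, h2 h]
    refine ⟨hf, (hn.modCount_iff (hfin.1 hf) hU hm ((hcert h1 h2).2 t ht hU) r).1 hcnt⟩
  · rintro ⟨hf, hr⟩
    have h1 := fun h => hpat.1 (Or.inl h) hf
    have h2 := fun h => hpat.1 (Or.inr h) hf
    obtain ⟨⟨t, ht, hU⟩, hcount⟩ := hcert h1 h2
    exact ⟨h1, h2, t, ht, hU, (hn.modCount_iff (hfin.1 hf) hU hm (hcount t ht hU) r).2 hr⟩

theorem exists_isCertificate (h : d.Presents R f) (n : ℕ) (M : BuchiAutomaton) {m : ℕ}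
    (hm : 0 < m) : ∃ S MU MG, IsCertificate d n m M S MU MG := by
  have hsome : ∀ x y, EqvRel d.alphabet d.eqv x y ↔ _ := eqvRel_iff h
  obtain ⟨S, hS, MU, MG, hcert⟩ := exists_certificate (n := n) (s := d.alphabet)
    (P := fun z y => PRel d.alphabet d.dom n M z y) (E := EqvRel d.alphabet d.eqv)
    (sat_pRel d.alphabet d.dom M n) (sat_eqvRel d.alphabet d.eqv)
    (fun z z' hz => PRel.congr hz _ _ _) (fun z x hx => hx.1) (fun z x hx => by
      let y : d.Dom := ⟨fun i => ⟨x i, hx.1 i⟩, (accepts_one_iff _ _).2 hx.2.1⟩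
      have := name_eq_some (f := f) (y := x).2 ⟨y, fun _ => rfl, rfl⟩
      exact (hsome _ _).2 ⟨_, this, this⟩)
    (fun x y hxy => by
      obtain ⟨a, h1, h2⟩ := (hsome _ _).1 hxy
      exact (hsome _ _).2 ⟨a, h2, h1⟩)
    (fun u v w h1 h2 => by
      rw [hsome] at h1 h2 ⊢
      obtain ⟨a, ha, ha'⟩ := h1
      obtain ⟨b, hb, hb'⟩ := h2
      obtain rfl : a = b := Option.some_inj.1 (ha'.symm.trans hb)
      exact ⟨a, ha, hb'⟩) (fun x y hxy => hxy.2.1) hm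
  refine ⟨S, MU, (List.range m).map MG, hS, fun v hv hinv hpat hinf => ?_⟩
  obtain ⟨h1, h2⟩ := hcert v hv hinv hpat hinf
  refine ⟨h1, fun t ht hU => ?_⟩
  have h3 := h2 t ht hU
  have e : ∀ r < m, ((List.range m).map MG).getD r BuchiAutomaton.none = MG r := fun r hr => by
    simp [hr]
  refine ⟨?_, fun r hr => ?_, fun r hr r' hr' hne => ?_⟩
  · intro y hy hUy hmin
    beta_reduce
    rw [e 0 hm]
    exact h3.1 y hy hUy hmin
  · intro y hy y' hy' hUy hUy' hlt hb hG
    beta_reduce at hG ⊢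
    rw [e r hr] at hG
    rw [e _ (Nat.mod_lt _ hm)]
    exact h3.2.1 r hr y hy y' hy' hUy hUy' hlt hb hG
  · intro y hy hUy hG
    beta_reduce at hG
    rw [e r hr, e r' hr'] at hG
    exact h3.2.2 r hr r' hr' hne y hy hUy hG

end

end OmegaPresentation

/-! ### Automata for the logical operations -/

open Function BuchiAutomaton

/-- All words in the domain extend `z` to a tuple that is accepted. -/
def AllRel (S s n : ℕ) (Md M : BuchiAutomaton) (z : Env) : Prop :=
  ∀ y : ℕ → ℕ, (∀ i, y i < S) → (∀ i, y i < s) ∧ Md.AcceptsWord (fun i => [y i]) →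
    PRel s Md n M z y

namespace ER

variable {α : Type*} [Primcodable α] {S n s : α → ℕ} {Md Me M : α → BuchiAutomaton}

theorem allRel (hS : Primrec S) (hn : Primrec n) (hs : Primrec s) (hMd : Primrec Md)
    (hM : Primrec M) : ER S n fun a v => AllRel (S a) (s a) (n a) (Md a) (M a) v := by
  have hN : Primrec fun a => n a + 1 := by fun_prop
  unfold AllRel
  refine all hS hn ?_ fun a v v' x h => by rw [PRel.congr h]
  exact imp hS hN (and hS hN (forall_lt hS hN hs hn) (acc₁ hS hN hMd hn))
    (pRel hS hs hn hMd hM hN hn)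

theorem patternRel (hS : Primrec S) (hn : Primrec n) (hs : Primrec s) (hMd : Primrec Md)
    (hMe : Primrec Me) (hM : Primrec M) :
    ER S n fun a v => Pattern (S a) (PRel (s a) (Md a) (n a) (M a) v) (EqvRel (s a) (Me a)) :=
  pattern hS hn (fun _ _ hm ht => pRel hS hs hn hMd hM hm ht)
    (fun _ _ _ h => PRel.congr h _ _ _) fun _ _ _ hm ht ht' => eqvRel hS hs hMe hm ht ht'

theorem infNearRel (hS : Primrec S) (hn : Primrec n) (hs : Primrec s) (hMd : Primrec Md)
    (hMe : Primrec Me) (hM : Primrec M) :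
    ER S n fun a v => InfNear (S a) (PRel (s a) (Md a) (n a) (M a) v) (EqvRel (s a) (Me a)) :=
  infNear hS hn (fun _ _ hm ht => pRel hS hs hn hMd hM hm ht)
    (fun _ _ _ h => PRel.congr h _ _ _) fun _ _ _ hm ht ht' => eqvRel hS hs hMe hm ht ht'

/-- An effectively recognizable relation is recognized for each value of the parameter. -/
theorem exists_at {R : α → Env → Prop} (h : ER S n R) (a : α) :
    ∃ M : BuchiAutomaton, ∀ v, InEnv (S a) (n a) v → (M.At (List.range (n a)) v ↔ R a v) := by
  obtain ⟨D, -, h2, h3⟩ := h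
  obtain ⟨M, hM⟩ := h3 a
  exact ⟨M, h2 a M hM⟩

end ER

namespace OmegaPresentation

variable {ι A : Type*} {ar : ι → ℕ} {d : OmegaPresentation ι} {R : RelStructure ar A}
  {f : d.Dom → A} {n : ℕ}

theorem spec_of_iff {φ : FOC ar n} {M : BuchiAutomaton} {S : ℕ} {Q : Env → Prop}
    (hS : d.alphabet ≤ S) (hM : ∀ v, InEnv S n v → (M.At (List.range n) v ↔ Q v))
    (hQ : ∀ w : Fin n → d.Dom, Q (toEnv fun j => (w j).1) ↔ φ.Realize R fun j => f (w j)) :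
    Spec R f φ M := fun w => by
  rw [accepts_iff_on, ← hQ, ← hM _ (inEnv_toEnv _ hS)]
  simp [On, At]

theorem at_equal_iff (h : d.Presents R f) (w : Fin n → d.Dom) (i j : Fin n) :
    d.eqv.At [(i : ℕ), j] (toEnv fun j => (w j).1) ↔
      (FOC.equal i j : FOC ar n).Realize R fun j => f (w j) := by
  have h1 := h.eqv_iff (w i).1 (w j).1
  rw [accepts_two_iff] at h1
  have h2 : d.eqv.At [(i : ℕ), j] (toEnv fun j => (w j).1) ↔
      d.eqv.AcceptsWord fun l => [((w i).1 l : ℕ), ((w j).1 l : ℕ)] := by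
    simp [At, Env.col, toEnv]
  rw [h2, h1]
  exact ⟨fun ⟨_, _, e⟩ => e, fun e => ⟨(w i).2, (w j).2, e⟩⟩

theorem at_rel_iff (h : d.Presents R f) (w : Fin n → d.Dom) (i : ι) (t : Fin (ar i) → Fin n) :
    (d.rel i).At (List.ofFn fun j => (t j : ℕ)) (toEnv fun j => (w j).1) ↔
      (FOC.rel i t : FOC ar n).Realize R fun j => f (w j) := by
  have h1 := h.rel_iff i fun j => (w (t j)).1
  have h2 : (d.rel i).At (List.ofFn fun j => (t j : ℕ)) (toEnv fun j => (w j).1) ↔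
      (d.rel i).Accepts fun j => (w (t j)).1 := by
    simp [At, Env.col, toEnv, Accepts, AcceptsWord, List.map_ofFn, Function.comp_def]
  rw [h2, h1]
  exact ⟨fun ⟨_, e⟩ => e, fun e => ⟨fun j => (w (t j)).2, e⟩⟩

theorem imp_iff {φ ψ : FOC ar n} {M N : BuchiAutomaton} (hM : Spec R f φ M) (hN : Spec R f ψ N)
    (w : Fin n → d.Dom) : (M.On n (toEnv fun j => (w j).1) [] → N.On n (toEnv fun j => (w j).1) []) ↔
      (FOC.imp φ ψ).Realize R fun j => f (w j) := by
  rw [← accepts_iff_on, ← accepts_iff_on, hM w, hN w]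
  rfl

theorem allRel_iff {φ : FOC ar (n + 1)} {M : BuchiAutomaton} (h : d.Presents R f)
    (hM : Spec R f φ M) (w : Fin n → d.Dom) {S : ℕ} (hS : d.alphabet ≤ S) :
    AllRel S d.alphabet n d.dom M (toEnv fun j => (w j).1) ↔
      (FOC.all φ).Realize R fun j => f (w j) := by
  constructor
  · intro hall a
    obtain ⟨x, rfl⟩ := h.surjective a
    obtain ⟨a, ha, hφ⟩ := (pRel_iff hM w _).1 (hall (fun i => x.1 i)
      (fun i => (x.1 i).2.trans_le hS) ⟨fun i => (x.1 i).2, (accepts_one_iff _ _).1 x.2⟩)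
    rw [name_eq_some (f := f).2 ⟨x, fun _ => rfl, rfl⟩, Option.some_inj] at ha
    rwa [ha]
  · rintro hall y - ⟨hy, hd⟩
    exact (pRel_iff hM w _).2 ⟨_, name_eq_some.2 ⟨⟨fun i => ⟨y i, hy i⟩,
      (accepts_one_iff _ _).2 hd⟩, fun _ => rfl, rfl⟩, hall _⟩

/-- Every formula defines a regular relation on names. -/
theorem exists_spec (h : d.Presents R f) {n : ℕ} (φ : FOC ar n) : ∃ M, Spec R f φ M := by
  have e1 : d.alphabet ≤ d.alphabet + 2 := by omega
  -- Uniformity is not needed here, so the parameter type is `Unit` and the signature may be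
  -- infinite.
  induction φ with
  | falsum =>
    obtain ⟨M, hM⟩ := (Sat.const False).exists_automaton d.alphabet _
    exact ⟨M, spec_of_iff le_rfl hM fun w => Iff.rfl⟩
  | equal i j =>
    obtain ⟨M, hM⟩ := (sat_at d.eqv [(i : ℕ), j]).exists_automaton d.alphabet _
    exact ⟨M, spec_of_iff le_rfl hM fun w => at_equal_iff h w i j⟩
  | rel i t =>
    obtain ⟨M, hM⟩ := (sat_at (d.rel i) (List.ofFn fun j => (t j : ℕ))).exists_automaton d.alphabet _
    exact ⟨M, spec_of_iff le_rfl hM fun w => at_rel_iff h w i t⟩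
  | @imp n φ ψ ih ih' =>
    obtain ⟨M, hM⟩ := ih
    obtain ⟨N, hN⟩ := ih'
    obtain ⟨M', hM'⟩ := (ER.imp (S := fun _ : Unit => d.alphabet) (n := fun _ => n) (by fun_prop)
      (by fun_prop) (ER.on₀ (by fun_prop) (by fun_prop) (M := fun _ => M) (k := fun _ => n)
      (by fun_prop) (by fun_prop)) (ER.on₀ (by fun_prop) (by fun_prop) (M := fun _ => N)
      (k := fun _ => n) (by fun_prop) (by fun_prop))).exists_at ()
    exact ⟨M', spec_of_iff le_rfl hM' fun w => imp_iff hM hN w⟩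
  | @all n φ ih =>
    obtain ⟨M, hM⟩ := ih
    obtain ⟨M', hM'⟩ := (ER.allRel (S := fun _ : Unit => d.alphabet) (s := fun _ => d.alphabet)
      (n := fun _ => n) (Md := fun _ => d.dom) (M := fun _ => M) (by fun_prop) (by fun_prop)
      (by fun_prop) (by fun_prop) (by fun_prop)).exists_at ()
    exact ⟨M', spec_of_iff le_rfl hM' fun w => allRel_iff h hM w le_rfl⟩
  | @exMod n r m hm φ ih =>
    obtain ⟨M, hM⟩ := ih
    obtain ⟨S, MU, MG, hc⟩ := exists_isCertificate h n M hm
    obtain ⟨M', hM'⟩ := (ER.modRel (S := fun _ : Unit => S) (s := fun _ => d.alphabet)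
      (n := fun _ => n) (Md := fun _ => d.dom) (Me := fun _ => d.eqv) (M := fun _ => M)
      (MU := fun _ => MU) (MG := fun _ => MG) (m := fun _ => m) (r := fun _ => r) (by fun_prop)
      (by fun_prop) (by fun_prop) (by fun_prop) (by fun_prop) (by fun_prop) (by fun_prop)
      (by fun_prop) (by fun_prop) (by fun_prop)).exists_at ()
    exact ⟨M', spec_of_iff (by have := hc.1; omega) hM' fun w => modRel_iff h hM w hm hc r⟩
  | @exInf n φ ih =>
    obtain ⟨M, hM⟩ := ih
    obtain ⟨M', hM'⟩ := (ER.or (S := fun _ : Unit => d.alphabet + 2) (n := fun _ => n)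
      (by fun_prop) (by fun_prop)
      (ER.patternRel (s := fun _ => d.alphabet) (Md := fun _ => d.dom)
        (Me := fun _ => d.eqv) (M := fun _ => M) (by fun_prop)
      (by fun_prop) (by fun_prop) (by fun_prop) (by fun_prop) (by fun_prop))
      (ER.infNearRel (s := fun _ => d.alphabet) (Md := fun _ => d.dom)
        (Me := fun _ => d.eqv) (M := fun _ => M) (by fun_prop)
      (by fun_prop) (by fun_prop) (by fun_prop) (by fun_prop) (by fun_prop))).exists_at ()
    exact ⟨M', spec_of_iff e1 hM' fun w => (pattern_iff h hM w le_rfl).2⟩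
  | @exCountable n φ ih =>
    obtain ⟨M, hM⟩ := ih
    obtain ⟨M', hM'⟩ := (ER.not (S := fun _ : Unit => d.alphabet + 2) (n := fun _ => n)
      (by fun_prop) (by fun_prop)
      (ER.patternRel (s := fun _ => d.alphabet) (Md := fun _ => d.dom)
        (Me := fun _ => d.eqv) (M := fun _ => M) (by fun_prop)
      (by fun_prop) (by fun_prop) (by fun_prop) (by fun_prop) (by fun_prop))).exists_at ()
    exact ⟨M', spec_of_iff e1 hM' fun w => not_iff_comm.1 (pattern_iff h hM w le_rfl).1.symm⟩
  | @exUncountable n φ ih =>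
    obtain ⟨M, hM⟩ := ih
    obtain ⟨M', hM'⟩ := (ER.patternRel (S := fun _ : Unit => d.alphabet + 2) (n := fun _ => n)
        (s := fun _ => d.alphabet) (Md := fun _ => d.dom)
        (Me := fun _ => d.eqv) (M := fun _ => M) (by fun_prop)
      (by fun_prop) (by fun_prop) (by fun_prop) (by fun_prop) (by fun_prop)).exists_at ()
    exact ⟨M', spec_of_iff e1 hM' fun w => (pattern_iff h hM w le_rfl).1⟩

end OmegaPresentation

/-! ### Effective construction of automata from formulas -/

open Function BuchiAutomaton

theorem Sig1.exists_mem_list {α β : Type*} [Primcodable α] [Primcodable β] {p : α → β → Prop}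
    {f : α → List β} (hp : Sig1 fun x : α × β => p x.1 x.2) (hf : Primrec f) :
    Sig1 fun a => ∃ b ∈ f a, p a b := by
  have h : Sig1 fun x : α × β => x.2 ∈ f x.1 :=
    Sig1.of_primrecPred (PrimrecPred.mem (by fun_prop) (by fun_prop))
  exact Sig1.ex (h.and hp)

/-- Closure of a set of facts under a rule with at most two premises. -/
def Derivable {α β : Type*} (rule : α × β × β × β → Prop) (x : α × β) : Prop :=
  ∃ L : List β, x.2 ∈ L ∧ ∀ e ∈ L, ∃ e₁ ∈ L, ∃ e₂ ∈ L, rule (x.1, e₁, e₂, e)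

namespace Derivable

variable {α β : Type*} {rule : α × β × β × β → Prop} {a : α} {e e₁ e₂ : β}

theorem sig1 [Primcodable α] [Primcodable β] (h : Sig1 rule) : Sig1 (Derivable rule) := by
  refine Sig1.ex (Sig1.and (Sig1.of_primrecPred (PrimrecPred.mem (by fun_prop) (by fun_prop))) ?_)
  refine Sig1.forall_mem_list ?_ (by fun_prop)
  refine Sig1.exists_mem_list ?_ (by fun_prop)
  refine Sig1.exists_mem_list ?_ (by fun_prop)
  exact h.comp (by fun_prop)

/-- Derivations may be circular, so there is no induction on them. Soundness is proved by induction
on formulas or their codes, inverting one rule at a time. -/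
theorem cases (h : Derivable rule (a, e)) :
    ∃ e₁ e₂, Derivable rule (a, e₁) ∧ Derivable rule (a, e₂) ∧ rule (a, e₁, e₂, e) := by
  obtain ⟨L, hL, hr⟩ := h
  obtain ⟨e₁, h₁, e₂, h₂, h⟩ := hr e hL
  exact ⟨e₁, e₂, ⟨L, h₁, hr⟩, ⟨L, h₂, hr⟩, h⟩

theorem intro (h₁ : Derivable rule (a, e₁)) (h₂ : Derivable rule (a, e₂))
    (h : rule (a, e₁, e₂, e)) : Derivable rule (a, e) := by
  obtain ⟨L₁, hL₁, hr₁⟩ := h₁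
  obtain ⟨L₂, hL₂, hr₂⟩ := h₂
  refine ⟨e :: (L₁ ++ L₂), List.mem_cons_self, fun x hx => ?_⟩
  simp only [List.mem_cons, List.mem_append] at hx
  rcases hx with rfl | hx | hx
  · exact ⟨e₁, by simp_all, e₂, by simp_all, h⟩
  · obtain ⟨y, hy, z, hz, h'⟩ := hr₁ x hx
    exact ⟨y, by simp_all, z, by simp_all, h'⟩
  · obtain ⟨y, hy, z, hz, h'⟩ := hr₂ x hx
    exact ⟨y, by simp_all, z, by simp_all, h'⟩

theorem intro₁ (h₁ : Derivable rule (a, e₁)) (h : rule (a, e₁, e₁, e)) :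
    Derivable rule (a, e) := h₁.intro h₁ h

/-- Circularity lets an axiom serve as its own premises, so that all rules formally have two. -/
theorem intro₀ (h : rule (a, e, e, e)) : Derivable rule (a, e) :=
  ⟨[e], by simp, by simpa using h⟩

end Derivable

/-- The automata of a presentation over a finite signature. -/
abbrev PresentationData : Type := ℕ × BuchiAutomaton × BuchiAutomaton × List BuchiAutomaton

/-- The alphabet and automata of a certificate are not known in advance: the specification guesses
them, demands the Σ₁ verification, and then asks for an automaton for `ModRel` built from them. -/
theorem ER.exists_certified_modRel :
    ∃ D : (PresentationData × ℕ × BuchiAutomaton) × (ℕ × ℕ) × BuchiAutomaton → Prop, Sig1 D ∧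
      ∀ {ι : Type} (d : OmegaPresentation ι) l n M r m,
        (∀ N, D (((d.alphabet, d.dom, d.eqv, l), n, M), (r, m), N) → ∃ S MU MG,
          d.IsCertificate n m M S MU MG ∧ ∀ v, InEnv S n v → (N.At (List.range n) v ↔
            ModRel S d.alphabet n m r d.dom d.eqv M MU MG v)) ∧
        ((∃ S MU MG, d.IsCertificate n m M S MU MG) →
          ∃ N, D (((d.alphabet, d.dom, d.eqv, l), n, M), (r, m), N)) := by
  let α := ((PresentationData × ℕ × BuchiAutomaton) × ℕ × ℕ) ×
    ℕ × BuchiAutomaton × List BuchiAutomaton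
  obtain ⟨D, h1, h2, h3⟩ := ER.modRel (α := α) (S := fun a => a.2.1) (s := fun a => a.1.1.1.1)
    (n := fun a => a.1.1.2.1) (Md := fun a => a.1.1.1.2.1) (Me := fun a => a.1.1.1.2.2.1)
    (M := fun a => a.1.1.2.2) (MU := fun a => a.2.2.1) (MG := fun a => a.2.2.2)
    (m := fun a => a.1.2.2) (r := fun a => a.1.2.1) (by fun_prop) (by fun_prop) (by fun_prop)
    (by fun_prop) (by fun_prop) (by fun_prop) (by fun_prop) (by fun_prop) (by fun_prop)
    (by fun_prop)
  have h4 := ER.sig1_certifies (α := α) (S := fun a => a.2.1) (s := fun a => a.1.1.1.1)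
    (n := fun a => a.1.1.2.1) (Md := fun a => a.1.1.1.2.1) (Me := fun a => a.1.1.1.2.2.1)
    (M := fun a => a.1.1.2.2) (MU := fun a => a.2.2.1) (MG := fun a => a.2.2.2)
    (m := fun a => a.1.2.2) (by fun_prop) (by fun_prop) (by fun_prop)
    (by fun_prop) (by fun_prop) (by fun_prop) (by fun_prop) (by fun_prop) (by fun_prop)
  have h5 : Sig1 fun a : α => a.1.1.1.1 + 2 ≤ a.2.1 :=
    Sig1.of_primrecPred (PrimrecPred.le (by fun_prop) (by fun_prop))
  have h6 : ∀ Q : α → Prop, Sig1 Q → Sig1 fun x : (PresentationData × ℕ × BuchiAutomaton) ×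
      (ℕ × ℕ) × BuchiAutomaton => ∃ c, Q ((x.1, x.2.1), c) ∧ D (((x.1, x.2.1), c), x.2.2) :=
    fun Q hQ => Sig1.ex ((hQ.comp (by fun_prop)).and (h1.comp (by fun_prop)))
  refine ⟨_, h6 _ (h5.and h4), ?_⟩
  intro ι d l n M r m
  constructor
  · rintro N ⟨⟨S, MU, MG⟩, hc, hD⟩
    exact ⟨S, MU, MG, hc, h2 _ _ hD⟩
  · rintro ⟨S, MU, MG, hc⟩
    obtain ⟨N, hN⟩ := h3 (((((d.alphabet, d.dom, d.eqv, l), n, M), (r, m)), (S, MU, MG)) : α)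
    exact ⟨N, ⟨S, MU, MG⟩, hc, hN⟩

namespace OmegaPresentation

/-- Automata for the subformulas can be combined to an automaton for the formula effectively. -/
theorem exists_derivation.{u} : ∃ D : PresentationData × ℕ × ℕ × BuchiAutomaton → Prop, Sig1 D ∧
    ∀ {A : Type u} {r : ℕ} {ar : Fin r → ℕ} {R : RelStructure ar A} {d : OmegaPresentation (Fin r)}
      {f : d.Dom → A}, d.Presents R f → ∀ {n : ℕ} (φ : FOC ar n),
      (∃ M, D (d.data, n, φ.code, M)) ∧ ∀ M, D (d.data, n, φ.code, M) → Spec R f φ M := by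
  -- The empty relation, written as the negation of `X → X`.
  obtain ⟨D0, s0, u0, t0⟩ := ER.not (α := ℕ × ℕ) (S := fun a => a.1) (n := fun a => a.2)
    (by fun_prop) (by fun_prop) (ER.imp (by fun_prop) (by fun_prop)
      (ER.at_ (by fun_prop) (by fun_prop) (M := fun _ => BuchiAutomaton.none)
        (ρ := fun _ => []) (by fun_prop) (by fun_prop))
      (ER.at_ (by fun_prop) (by fun_prop) (M := fun _ => BuchiAutomaton.none)
        (ρ := fun _ => []) (by fun_prop) (by fun_prop)))
  obtain ⟨D1, s1, u1, t1⟩ := ER.at_ (α := (ℕ × ℕ) × BuchiAutomaton × List ℕ)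
    (S := fun a => a.1.1) (n := fun a => a.1.2) (M := fun a => a.2.1) (ρ := fun a => a.2.2)
    (by fun_prop) (by fun_prop) (by fun_prop) (by fun_prop)
  obtain ⟨D3, s3, u3, t3⟩ := ER.imp (α := (ℕ × ℕ) × BuchiAutomaton × BuchiAutomaton)
    (S := fun a => a.1.1) (n := fun a => a.1.2) (by fun_prop) (by fun_prop)
    (ER.on₀ (by fun_prop) (by fun_prop) (M := fun a => a.2.1) (k := fun a => a.1.2)
      (by fun_prop) (by fun_prop))
    (ER.on₀ (by fun_prop) (by fun_prop) (M := fun a => a.2.2) (k := fun a => a.1.2)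
      (by fun_prop) (by fun_prop))
  obtain ⟨D4, s4, u4, t4⟩ := ER.allRel (α := PresentationData × ℕ × BuchiAutomaton)
    (S := fun a => a.1.1) (s := fun a => a.1.1) (n := fun a => a.2.1) (Md := fun a => a.1.2.1)
    (M := fun a => a.2.2) (by fun_prop) (by fun_prop) (by fun_prop) (by fun_prop) (by fun_prop)
  obtain ⟨D5, s5, ut5⟩ := ER.exists_certified_modRel
  have hp := ER.patternRel (α := PresentationData × ℕ × BuchiAutomaton)
    (S := fun a => a.1.1 + 2) (s := fun a => a.1.1) (n := fun a => a.2.1) (Md := fun a => a.1.2.1)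
    (Me := fun a => a.1.2.2.1) (M := fun a => a.2.2)
    (by fun_prop) (by fun_prop) (by fun_prop) (by fun_prop) (by fun_prop) (by fun_prop)
  obtain ⟨D6, s6, u6, t6⟩ := ER.or (by fun_prop) (by fun_prop) hp
    (ER.infNearRel (α := PresentationData × ℕ × BuchiAutomaton)
    (S := fun a => a.1.1 + 2) (s := fun a => a.1.1) (n := fun a => a.2.1) (Md := fun a => a.1.2.1)
    (Me := fun a => a.1.2.2.1) (M := fun a => a.2.2)
    (by fun_prop) (by fun_prop) (by fun_prop) (by fun_prop) (by fun_prop) (by fun_prop))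
  obtain ⟨D7, s7, u7, t7⟩ := ER.not (by fun_prop) (by fun_prop) hp
  obtain ⟨D8, s8, u8, t8⟩ := hp
  -- A fact consists of the number of free variables, the code of a formula and an automaton for it.
  -- There is one disjunct for each constructor, with the numbers used in `FOC.code`.
  let rule : PresentationData × (ℕ × ℕ × BuchiAutomaton) × (ℕ × ℕ × BuchiAutomaton) ×
      (ℕ × ℕ × BuchiAutomaton) → Prop := fun x =>
    (x.2.2.2.2.1 = Nat.pair 0 0 + 1 ∧ D0 ((x.1.1, x.2.2.2.1), x.2.2.2.2.2)) ∨
    (∃ i : ℕ × ℕ, x.2.2.2.2.1 = Nat.pair 1 (Nat.pair i.1 i.2) + 1 ∧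
      D1 (((x.1.1, x.2.2.2.1), x.1.2.2.1, [i.1, i.2]), x.2.2.2.2.2)) ∨
    (∃ i : ℕ × List ℕ, x.2.2.2.2.1 = Nat.pair 2 (Nat.pair i.1 (Encodable.encode i.2)) + 1 ∧
      D1 (((x.1.1, x.2.2.2.1), x.1.2.2.2.getD i.1 BuchiAutomaton.none, i.2), x.2.2.2.2.2)) ∨
    ((x.2.1.1 = x.2.2.2.1 ∧ x.2.2.1.1 = x.2.2.2.1 ∧
      x.2.2.2.2.1 = Nat.pair 3 (Nat.pair x.2.1.2.1 x.2.2.1.2.1) + 1) ∧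
      D3 (((x.1.1, x.2.2.2.1), x.2.1.2.2, x.2.2.1.2.2), x.2.2.2.2.2)) ∨
    ((x.2.1.1 = x.2.2.2.1 + 1 ∧ x.2.2.2.2.1 = Nat.pair 4 x.2.1.2.1 + 1) ∧
      D4 ((x.1, x.2.2.2.1, x.2.1.2.2), x.2.2.2.2.2)) ∨
    (∃ i : ℕ × ℕ, (x.2.1.1 = x.2.2.2.1 + 1 ∧
      x.2.2.2.2.1 = Nat.pair 5 (Nat.pair i.1 (Nat.pair i.2 x.2.1.2.1)) + 1) ∧
      D5 ((x.1, x.2.2.2.1, x.2.1.2.2), i, x.2.2.2.2.2)) ∨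
    ((x.2.1.1 = x.2.2.2.1 + 1 ∧ x.2.2.2.2.1 = Nat.pair 6 x.2.1.2.1 + 1) ∧
      D6 ((x.1, x.2.2.2.1, x.2.1.2.2), x.2.2.2.2.2)) ∨
    ((x.2.1.1 = x.2.2.2.1 + 1 ∧ x.2.2.2.2.1 = Nat.pair 7 x.2.1.2.1 + 1) ∧
      D7 ((x.1, x.2.2.2.1, x.2.1.2.2), x.2.2.2.2.2)) ∨
    ((x.2.1.1 = x.2.2.2.1 + 1 ∧ x.2.2.2.2.1 = Nat.pair 8 x.2.1.2.1 + 1) ∧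
      D8 ((x.1, x.2.2.2.1, x.2.1.2.2), x.2.2.2.2.2))
  have hrule : Sig1 rule := by
    refine .or (.and (.of_primrecPred (by fun_prop)) (s0.comp (by fun_prop))) <|
      .or (.ex (.and (.of_primrecPred (by fun_prop)) (s1.comp (by fun_prop)))) <|
      .or (.ex (.and (.of_primrecPred (by fun_prop)) (s1.comp (by fun_prop)))) <|
      .or (.and (.of_primrecPred (by fun_prop)) (s3.comp (by fun_prop))) <|
      .or (.and (.of_primrecPred (by fun_prop)) (s4.comp (by fun_prop))) <|
      .or (.ex (.and (.of_primrecPred (by fun_prop)) (s5.comp (by fun_prop)))) <|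
      .or (.and (.of_primrecPred (by fun_prop)) (s6.comp (by fun_prop))) <|
      .or (.and (.of_primrecPred (by fun_prop)) (s7.comp (by fun_prop)))
        (.and (.of_primrecPred (by fun_prop)) (s8.comp (by fun_prop)))
  refine ⟨Derivable rule, Derivable.sig1 hrule, fun {A r ar R d f} h => ?_⟩
  have hrel : ∀ i : Fin r, (List.ofFn d.rel).getD i BuchiAutomaton.none = d.rel i := fun i => by
    simp
  have e1 : d.alphabet ≤ d.alphabet + 2 := by omega
  intro n φ
  induction φ with
  | @falsum n =>
    constructor
    · obtain ⟨M, hM⟩ := t0 (d.alphabet, n)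
      exact ⟨M, .intro₀ (Or.inl ⟨rfl, hM⟩)⟩
    · intro M hM
      obtain ⟨e₁, e₂, -, -, hr⟩ := hM.cases
      simp [rule, FOC.code, OmegaPresentation.data] at hr
      exact spec_of_iff le_rfl (u0 _ _ hr) fun w => by simp [FOC.Realize]
  | @equal n i j =>
    constructor
    · obtain ⟨M, hM⟩ := t1 ((d.alphabet, n), d.eqv, [(i : ℕ), j])
      exact ⟨M, .intro₀ (Or.inr (Or.inl ⟨(i, j), rfl, hM⟩))⟩
    · intro M hM
      obtain ⟨e₁, e₂, -, -, hr⟩ := hM.cases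
      simp [rule, FOC.code, OmegaPresentation.data] at hr
      exact spec_of_iff le_rfl (u1 _ _ hr) fun w => at_equal_iff h w i j
  | @rel n i t =>
    constructor
    · obtain ⟨M, hM⟩ := t1 ((d.alphabet, n), (List.ofFn d.rel).getD i BuchiAutomaton.none,
        List.ofFn fun j => (t j : ℕ))
      exact ⟨M, .intro₀ (Or.inr (Or.inr (Or.inl ⟨(i, _), rfl, hM⟩)))⟩
    · intro M hM
      obtain ⟨e₁, e₂, -, -, hr⟩ := hM.cases
      simp [rule, FOC.code, OmegaPresentation.data] at hr
      exact spec_of_iff le_rfl (u1 _ _ hr) fun w => at_rel_iff h w i t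
  | @imp n φ ψ ih ih' =>
    constructor
    · obtain ⟨M₁, h₁⟩ := ih.1
      obtain ⟨M₂, h₂⟩ := ih'.1
      obtain ⟨M, hM⟩ := t3 ((d.alphabet, n), M₁, M₂)
      exact ⟨M, .intro h₁ h₂ (by iterate 3 (apply Or.inr)
                                 exact Or.inl ⟨⟨rfl, rfl, rfl⟩, hM⟩)⟩
    · intro M hM
      obtain ⟨⟨n₁, c₁, M₁⟩, ⟨n₂, c₂, M₂⟩, h₁, h₂, hr⟩ := hM.cases
      simp [rule, FOC.code, OmegaPresentation.data] at hr
      obtain ⟨⟨rfl, rfl, rfl, rfl⟩, hr⟩ := hr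
      exact spec_of_iff le_rfl (u3 _ _ hr) fun w => imp_iff (ih.2 _ h₁) (ih'.2 _ h₂) w
  | @all n φ ih =>
    constructor
    · obtain ⟨M₁, h₁⟩ := ih.1
      obtain ⟨M, hM⟩ := t4 (d.data, n, M₁)
      exact ⟨M, .intro₁ h₁ (by iterate 4 (apply Or.inr)
                               exact Or.inl ⟨⟨rfl, rfl⟩, hM⟩)⟩
    · intro M hM
      obtain ⟨⟨n₁, c₁, M₁⟩, e₂, h₁, -, hr⟩ := hM.cases
      simp [rule, FOC.code] at hr
      obtain ⟨⟨rfl, rfl⟩, hr⟩ := hr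
      exact spec_of_iff le_rfl (u4 _ _ hr) fun w => allRel_iff h (ih.2 _ h₁) w le_rfl
  | @exMod n r m hm φ ih =>
    constructor
    · obtain ⟨M₁, h₁⟩ := ih.1
      obtain ⟨M, hM⟩ := (ut5 d (List.ofFn d.rel) n M₁ r m).2 (exists_isCertificate h n M₁ hm)
      exact ⟨M, .intro₁ h₁ (by iterate 5 (apply Or.inr)
                               exact Or.inl ⟨(r, m), ⟨rfl, rfl⟩, hM⟩)⟩
    · intro M hM
      obtain ⟨⟨n₁, c₁, M₁⟩, e₂, h₁, -, hr⟩ := hM.cases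
      simp [rule, FOC.code] at hr
      obtain ⟨⟨rfl, rfl⟩, hr⟩ := hr
      obtain ⟨S, MU, MG, hc, hS⟩ := (ut5 d (List.ofFn d.rel) n M₁ r m).1 M hr
      exact spec_of_iff (by have := hc.1; omega) hS fun w => modRel_iff h (ih.2 _ h₁) w hm hc r
  | @exInf n φ ih =>
    constructor
    · obtain ⟨M₁, h₁⟩ := ih.1
      obtain ⟨M, hM⟩ := t6 (d.data, n, M₁)
      exact ⟨M, .intro₁ h₁ (by iterate 6 (apply Or.inr)
                               exact Or.inl ⟨⟨rfl, rfl⟩, hM⟩)⟩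
    · intro M hM
      obtain ⟨⟨n₁, c₁, M₁⟩, e₂, h₁, -, hr⟩ := hM.cases
      simp [rule, FOC.code] at hr
      obtain ⟨⟨rfl, rfl⟩, hr⟩ := hr
      exact spec_of_iff e1 (u6 _ _ hr) fun w => (pattern_iff h (ih.2 _ h₁) w le_rfl).2
  | @exCountable n φ ih =>
    constructor
    · obtain ⟨M₁, h₁⟩ := ih.1
      obtain ⟨M, hM⟩ := t7 (d.data, n, M₁)
      exact ⟨M, .intro₁ h₁ (by iterate 7 (apply Or.inr)
                               exact Or.inl ⟨⟨rfl, rfl⟩, hM⟩)⟩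
    · intro M hM
      obtain ⟨⟨n₁, c₁, M₁⟩, e₂, h₁, -, hr⟩ := hM.cases
      simp [rule, FOC.code] at hr
      obtain ⟨⟨rfl, rfl⟩, hr⟩ := hr
      exact spec_of_iff e1 (u7 _ _ hr) fun w =>
        not_iff_comm.1 (pattern_iff h (ih.2 _ h₁) w le_rfl).1.symm
  | @exUncountable n φ ih =>
    constructor
    · obtain ⟨M₁, h₁⟩ := ih.1
      obtain ⟨M, hM⟩ := t8 (d.data, n, M₁)
      exact ⟨M, .intro₁ h₁ (by iterate 8 (apply Or.inr)
                               exact ⟨⟨rfl, rfl⟩, hM⟩)⟩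
    · intro M hM
      obtain ⟨⟨n₁, c₁, M₁⟩, e₂, h₁, -, hr⟩ := hM.cases
      simp [rule, FOC.code] at hr
      obtain ⟨⟨rfl, rfl⟩, hr⟩ := hr
      exact spec_of_iff e1 (u8 _ _ hr) fun w => (pattern_iff h (ih.2 _ h₁) w le_rfl).1

end OmegaPresentation

/-! ### Parameters -/

open Function BuchiAutomaton

theorem Primrec.tail_apply {α β : Type*} [Primcodable α] [Primcodable β] {f : α → List β}
    (hf : Primrec f) : Primrec fun a => (f a).tail := Primrec.list_tail.comp hf

attribute [fun_prop] Primrec.tail_apply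

/-- The successor of a position on a lasso of length `N` whose loop starts at `b`. -/
def lassoNext (b N j : ℕ) : ℕ := if j + 1 = N then b else j + 1

/-- The position on a lasso after `i` steps. -/
def lassoPos (b N i : ℕ) : ℕ := (lassoNext b N)^[i] 0

theorem lassoPos_succ (b N i : ℕ) :
    lassoPos b N (i + 1) = lassoNext b N (lassoPos b N i) := Function.iterate_succ_apply' _ _ _

theorem lassoPos_eq (b : ℕ) {c : ℕ} (hc : 0 < c) (i : ℕ) :
    lassoPos b (b + c) i = if i < b then i else b + (i - b) % c := by
  induction i with
  | zero => rcases Nat.eq_zero_or_pos b with rfl | h <;> simp [lassoPos, *]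
  | succ i ih =>
    rw [lassoPos_succ, ih]
    unfold lassoNext
    rcases Nat.lt_or_ge i b with h | h
    · rw [if_pos h, if_neg (by omega)]
      split_ifs with h'
      · rfl
      · obtain rfl : b = i + 1 := by omega
        simp
    · have h1 := Nat.mod_lt (i - b) hc
      have h2 : (i + 1 - b) % c = ((i - b) % c + 1) % c := by
        rw [Nat.succ_sub h, Nat.succ_eq_add_one]
        simp [Nat.add_mod]
      rw [if_neg (by omega : ¬ i < b), if_neg (by omega : ¬ i + 1 < b), h2]
      split_ifs with h'
      · rw [show (i - b) % c + 1 = c by omega, Nat.mod_self, Nat.add_zero]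
      · rw [Nat.mod_eq_of_lt (by omega : (i - b) % c + 1 < c), Nat.add_assoc]

theorem lassoPos_lt (b : ℕ) {c : ℕ} (hc : 0 < c) (i : ℕ) : lassoPos b (b + c) i < b + c := by
  have := Nat.mod_lt (i - b) hc
  rw [lassoPos_eq b hc]
  split_ifs <;> omega

theorem upWord_eq {s : ℕ} (u v : List (Fin s)) (hv : v ≠ []) (i : ℕ) :
    (upWord u v hv i : ℕ) = (u.map Fin.val ++ v.map Fin.val).getD
      (lassoPos u.length (u.length + v.length) i) 0 := by
  have hc := List.length_pos_of_ne_nil hv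
  have := Nat.mod_lt (i - u.length) hc
  rw [lassoPos_eq _ hc]
  unfold upWord
  split_ifs with h
  · simp [List.getElem?_append_left, h]
  · simp [this]

namespace BuchiAutomaton

/-- The automaton whose first track is fixed to the word that the lasso spells. -/
def fixTrack (b : ℕ) (l : List ℕ) (M : BuchiAutomaton) : BuchiAutomaton where
  trans := M.trans.flatMap fun t => (List.range l.length).flatMap fun j =>
    if t.2.1 = l.getD j 0 :: t.2.1.tail then
      [(Nat.pair t.1 j, t.2.1.tail, Nat.pair t.2.2 (lassoNext b l.length j))] else []
  init := M.init.map fun q => Nat.pair q 0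
  acc := M.acc.flatMap fun q => (List.range l.length).map fun j => Nat.pair q j

theorem mem_trans_fixTrack {b : ℕ} {l : List ℕ} {M : BuchiAutomaton} {p q : ℕ} {a : List ℕ} :
    (p, a, q) ∈ (M.fixTrack b l).trans ↔ ∃ p' j q', p = Nat.pair p' j ∧ j < l.length ∧
      q = Nat.pair q' (lassoNext b l.length j) ∧ (p', l.getD j 0 :: a, q') ∈ M.trans := by
  simp only [fixTrack, List.mem_flatMap, List.mem_range]
  constructor
  · rintro ⟨⟨p', a', q'⟩, ht, j, hj, h⟩
    split_ifs at h with h'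
    · obtain ⟨rfl, rfl, rfl⟩ := by simpa using h
      refine ⟨p', j, q', rfl, hj, rfl, ?_⟩
      rw [← h']
      exact ht
    · simp at h
  · rintro ⟨p', j, q', rfl, hj, rfl, ht⟩
    exact ⟨_, ht, j, hj, by simp⟩

theorem fixTrack_acceptsWord {b : ℕ} {l : List ℕ} {c : ℕ} (hc : 0 < c) (hl : l.length = b + c)
    (M : BuchiAutomaton) (w : ℕ → List ℕ) : (M.fixTrack b l).AcceptsWord w ↔
      M.AcceptsWord fun i => l.getD (lassoPos b l.length i) 0 :: w i := by
  have hlt : ∀ i, lassoPos b l.length i < l.length := fun i => hl ▸ lassoPos_lt b hc i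
  constructor
  · rintro ⟨ρ, h1, h2, h3⟩
    obtain ⟨q₀, hq₀, h0⟩ : ∃ q ∈ M.init, Nat.pair q 0 = ρ 0 := by simpa [fixTrack] using h1
    -- The second component of a state moves deterministically, so in any run it is the current
    -- position on the lasso.
    have hpos : ∀ i, (ρ i).unpair.2 = lassoPos b l.length i := fun i => by
      induction i with
      | zero => simp [← h0, lassoPos]
      | succ i ih =>
        obtain ⟨p', j, q', e, -, e', -⟩ := mem_trans_fixTrack.1 (h2 i)
        rw [e, Nat.unpair_pair] at ih
        rw [e', Nat.unpair_pair, lassoPos_succ, ← ih]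
    refine ⟨fun i => (ρ i).unpair.1, by simpa [← h0] using hq₀, fun i => ?_, fun N => ?_⟩
    · obtain ⟨p', j, q', e, -, e', ht⟩ := mem_trans_fixTrack.1 (h2 i)
      have := hpos i
      rw [e, Nat.unpair_pair] at this
      subst this
      simpa [e, e'] using ht
    · obtain ⟨i, hi, ha⟩ := h3 N
      simp only [fixTrack, List.mem_flatMap, List.mem_map] at ha
      obtain ⟨q, hq, j, -, e⟩ := ha
      exact ⟨i, hi, by simpa [← e] using hq⟩
  · rintro ⟨ρ, h1, h2, h3⟩
    refine ⟨fun i => Nat.pair (ρ i) (lassoPos b l.length i), ?_, fun i => ?_, fun N => ?_⟩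
    · exact List.mem_map.2 ⟨_, h1, rfl⟩
    · exact mem_trans_fixTrack.2 ⟨_, _, _, rfl, hlt i, by beta_reduce; rw [lassoPos_succ], h2 i⟩
    · obtain ⟨i, hi, ha⟩ := h3 N
      exact ⟨i, hi, List.mem_flatMap.2 ⟨_, ha, List.mem_map.2 ⟨_, List.mem_range.2 (hlt i), rfl⟩⟩⟩

/-- The automaton whose first tracks are fixed to ultimately periodic words. -/
def fixTracks (M : BuchiAutomaton) (l : List (List ℕ × List ℕ)) : BuchiAutomaton :=
  l.foldl (fun M x => M.fixTrack x.1.length (x.1 ++ x.2)) M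

theorem primrec_fixTracks {α : Type*} [Primcodable α] {M : α → BuchiAutomaton}
    {l : α → List (List ℕ × List ℕ)} (hM : Primrec M) (hl : Primrec l) :
    Primrec fun a => (M a).fixTracks (l a) := by
  unfold fixTracks
  refine Primrec.list_foldl (h := fun _ x => x.1.fixTrack x.2.1.length (x.2.1 ++ x.2.2)) hl hM ?_
  unfold Primrec₂ fixTrack lassoNext
  fun_prop

theorem fixTracks_acceptsWord (M : BuchiAutomaton) {l : List (List ℕ × List ℕ)}
    (hl : ∀ x ∈ l, x.2 ≠ []) (w : ℕ → List ℕ) : (M.fixTracks l).AcceptsWord w ↔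
      M.AcceptsWord fun i => (l.map fun x => (x.1 ++ x.2).getD
        (lassoPos x.1.length (x.1.length + x.2.length) i) 0) ++ w i := by
  induction l generalizing M w with
  | nil => simp [fixTracks]
  | cons x l ih =>
    have := List.length_pos_of_ne_nil (hl x (by simp))
    have h := ih (M.fixTrack x.1.length (x.1 ++ x.2)) (fun y hy => hl y (by simp [hy])) w
    rw [fixTrack_acceptsWord this (by simp)] at h
    simpa [fixTracks] using h

theorem fixTracks_accepts (M : BuchiAutomaton) {s p k : ℕ} (u v : Fin p → List (Fin s))
    (hv : ∀ j, v j ≠ []) (w : Fin k → OmegaWord s) :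
    (M.fixTracks (List.ofFn fun j => ((u j).map Fin.val, (v j).map Fin.val))).Accepts w ↔
      M.Accepts (Fin.append (fun j => upWord (u j) (v j) (hv j)) w) := by
  refine (fixTracks_acceptsWord M (fun x hx => ?_) _).trans ?_
  · obtain ⟨j, rfl⟩ := List.mem_ofFn.1 hx
    simpa using hv j
  · have : ∀ i, List.ofFn (fun j =>
        (Fin.append (fun j => upWord (u j) (v j) (hv j)) w j i : ℕ)) =
        List.ofFn (fun j => (upWord (u j) (v j) (hv j) i : ℕ)) ++ List.ofFn fun j => (w j i : ℕ) :=
      fun i => by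
        rw [← List.ofFn_fin_append]
        congr 1
        funext j
        induction j using Fin.addCases <;> simp
    simp only [Accepts, AcceptsWord, this, List.map_ofFn, upWord_eq]
    simp [Function.comp_def]

end BuchiAutomaton

namespace ER

variable {α β : Type*} [Primcodable α] [Primcodable β] {S n : β → ℕ}

theorem comp {R : β → Env → Prop} (h : ER S n R) {f : α → β} (hf : Primrec f) :
    ER (fun a => S (f a)) (fun a => n (f a)) fun a => R (f a) := by
  obtain ⟨D, h1, h2, h3⟩ := h
  exact ⟨fun x => D (f x.1, x.2), h1.comp (by fun_prop), fun a => h2 (f a), fun a => h3 (f a)⟩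

/-- The number of conjuncts is a parameter, so the automaton arises by recursion: the derivable
facts pair a number `k` with an automaton for the first `k` conjuncts. -/
theorem forall_index (hS : Primrec S) (hn : Primrec n) {R : β → ℕ → Env → Prop}
    (h : ER (fun a : β × ℕ => S a.1) (fun a => n a.1) fun a => R a.1 a.2) {k : β → ℕ}
    (hk : Primrec k) : ER S n fun a v => ∀ t < k a, R a t v := by
  -- The empty conjunction, written as `¬ X ∨ X`.
  obtain ⟨D, s, u, t⟩ := (ER.on₀ (α := β) hS hn (M := fun _ => BuchiAutomaton.none) (k := n)
    (by fun_prop) (by fun_prop)).not hS hn |>.or hS hn (ER.on₀ (α := β) hS hn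
    (M := fun _ => BuchiAutomaton.none) (k := n) (by fun_prop) (by fun_prop))
  obtain ⟨D', s', u', t'⟩ := ER.and (α := (β × ℕ) × BuchiAutomaton) (S := fun a => S a.1.1)
    (n := fun a => n a.1.1) (by fun_prop) (by fun_prop)
    (ER.on₀ (by fun_prop) (by fun_prop) (M := fun a => a.2) (k := fun a => n a.1.1)
      (by fun_prop) (by fun_prop)) (h.comp (f := fun a : (β × ℕ) × BuchiAutomaton => a.1) (by fun_prop))
  let rule : β × (ℕ × BuchiAutomaton) × (ℕ × BuchiAutomaton) × ℕ × BuchiAutomaton → Prop :=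
    fun x => (x.2.2.2.1 = 0 ∧ D (x.1, x.2.2.2.2)) ∨
      (x.2.2.2.1 = x.2.1.1 + 1 ∧ D' (((x.1, x.2.1.1), x.2.1.2), x.2.2.2.2))
  have hrule : Sig1 rule :=
    .or (.and (.of_primrecPred (by fun_prop)) (s.comp (by fun_prop)))
      (.and (.of_primrecPred (by fun_prop)) (s'.comp (by fun_prop)))
  have h1 : ∀ a k M, Derivable rule (a, k, M) → ∀ v, InEnv (S a) (n a) v →
      (M.At (List.range (n a)) v ↔ ∀ t < k, R a t v) := fun a k => by
    induction k with
    | zero =>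
      intro M hM v hv
      obtain ⟨e₁, e₂, -, -, hr⟩ := hM.cases
      simp only [rule, true_and, (Nat.succ_ne_zero _).symm, false_and, or_false] at hr
      rw [u _ _ hr v hv]
      simp [em']
    | succ k ih =>
      intro M hM v hv
      obtain ⟨⟨k', M'⟩, e₂, h', -, hr⟩ := hM.cases
      simp only [rule, Nat.succ_ne_zero, false_and, false_or, Nat.add_right_cancel_iff] at hr
      obtain ⟨rfl, hr⟩ := hr
      rw [u' _ _ hr v hv, Nat.forall_lt_succ_right, ← ih _ h' v hv]
      simp [On, At]
  have h2 : ∀ a k, ∃ M, Derivable rule (a, k, M) := fun a k => by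
    induction k with
    | zero =>
      obtain ⟨M, hM⟩ := t a
      exact ⟨M, .intro₀ (Or.inl ⟨rfl, hM⟩)⟩
    | succ k ih =>
      obtain ⟨M', h'⟩ := ih
      obtain ⟨M, hM⟩ := t' ((a, k), M')
      exact ⟨M, h'.intro₁ (Or.inr ⟨rfl, hM⟩)⟩
  exact ⟨fun x => Derivable rule (x.1, k x.1, x.2), (Derivable.sig1 hrule).comp (by fun_prop),
    fun a M => h1 a _ M, fun a => h2 a (k a)⟩

end ER

namespace OmegaPresentation

/-- An automaton for the formula on `p + k` tracks has its first `p` tracks fixed to the parameters.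
It is then intersected with the domain on each remaining track, because `Spec` does not exclude
tuples that are not names. -/
theorem exists_partrec_automaton.{u} : ∃ F : PresentationData × (ℕ × ℕ) ×
      List (List ℕ × List ℕ) →. BuchiAutomaton, Partrec F ∧
    ∀ {A : Type u} {r : ℕ} {ar : Fin r → ℕ} (R : RelStructure ar A) (d : OmegaPresentation (Fin r))
      (f : d.Dom → A), d.Presents R f → ∀ (p k : ℕ) (φ : FOC ar (p + k))
      (u v : Fin p → List (Fin d.alphabet)) (hv : ∀ j, v j ≠ [])
      (hp : ∀ j, d.dom.Accepts ![upWord (u j) (v j) (hv j)]),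
      ∃ M ∈ F (d.data, (k, φ.code), List.ofFn fun j => ((u j).map Fin.val, (v j).map Fin.val)),
        ∀ w : Fin k → OmegaWord d.alphabet, M.Accepts w ↔ ∃ h : ∀ j, d.dom.Accepts ![w j],
          φ.Realize R (Fin.append (fun j => f ⟨upWord (u j) (v j) (hv j), hp j⟩)
            (fun j => f ⟨w j, h j⟩)) := by
  obtain ⟨D, hD, hφ⟩ := exists_derivation.{u}
  have hdom : ER (α := (ℕ × ℕ × BuchiAutomaton × BuchiAutomaton) × ℕ) (fun a => a.1.1)
      (fun a => a.1.2.1) fun a => a.1.2.2.2.At [a.2] :=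
    ER.at_ (by fun_prop) (by fun_prop) (by fun_prop) (by fun_prop)
  obtain ⟨D', s, b, t⟩ := ER.and (α := ℕ × ℕ × BuchiAutomaton × BuchiAutomaton) (S := fun a => a.1)
    (n := fun a => a.2.1) (by fun_prop) (by fun_prop)
    (ER.on₀ (by fun_prop) (by fun_prop) (M := fun a => a.2.2.1) (k := fun a => a.2.1)
      (by fun_prop) (by fun_prop))
    (ER.forall_index (R := fun a t => a.2.2.2.At [t]) (by fun_prop) (by fun_prop) hdom
      (k := fun a => a.2.1) (by fun_prop))
  let P : (PresentationData × (ℕ × ℕ) × List (List ℕ × List ℕ)) × BuchiAutomaton → Prop := fun x =>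
    ∃ M, D (x.1.1, x.1.2.2.length + x.1.2.1.1, x.1.2.1.2, M) ∧
      D' ((x.1.1.1, x.1.2.1.1, M.fixTracks x.1.2.2, x.1.1.2.1), x.2)
  have hP : Sig1 P := by
    have := primrec_fixTracks (α := ((PresentationData × (ℕ × ℕ) × List (List ℕ × List ℕ)) ×
      BuchiAutomaton) × BuchiAutomaton) (M := fun x => x.2) (l := fun x => x.1.1.2.2)
      (by fun_prop) (by fun_prop)
    exact .ex (.and (hD.comp (by fun_prop)) (s.comp (by fun_prop)))
  obtain ⟨F, hF, h1, h2⟩ := hP.exists_partrec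
  refine ⟨F, hF, fun {A r ar} R d f h p k φ u v hv hp => ?_⟩
  obtain ⟨M, hM⟩ := h2 (d.data, (k, φ.code),
      List.ofFn fun j => ((u j).map Fin.val, (v j).map Fin.val)) <| by
    obtain ⟨M, hM⟩ := (hφ h φ).1
    obtain ⟨N, hN⟩ := t (d.alphabet, k,
      M.fixTracks (List.ofFn fun j => ((u j).map Fin.val, (v j).map Fin.val)), d.dom)
    exact ⟨N, M, by simpa using hM, hN⟩
  refine ⟨M, hM, fun w => ?_⟩
  obtain ⟨N, hN, hMN⟩ := h1 _ _ hM
  have hN := (hφ h φ).2 N (by simpa using hN)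
  have hMN := b _ _ hMN (toEnv w) (inEnv_toEnv w le_rfl)
  have e1 : M.At (List.range k) (toEnv w) ↔ M.Accepts w := by
    rw [accepts_iff_on]
    simp [On, At]
  have e2 : ∀ j : Fin k, d.dom.At [(j : ℕ)] (toEnv w) ↔ d.dom.Accepts ![w j] := fun j => by
    rw [accepts_one_iff]
    simp [At, Env.col, toEnv]
  have e3 : (∀ t < k, d.dom.At [t] (toEnv w)) ↔ ∀ j, d.dom.Accepts ![w j] :=
    ⟨fun h j => (e2 j).1 (h j j.2), fun h t ht => (e2 ⟨t, ht⟩).2 (h ⟨t, ht⟩)⟩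
  simp only [data] at hMN
  rw [e1, ← accepts_iff_on, e3, fixTracks_accepts N u v hv, and_comm, ← exists_prop] at hMN
  rw [hMN]
  refine exists_congr fun hw => ?_
  have h4 := hN (Fin.append (fun j => ⟨upWord (u j) (v j) (hv j), hp j⟩) fun j => ⟨w j, hw j⟩)
  convert h4 using 2
  · funext j
    induction j using Fin.addCases <;> simp
  · funext j
    induction j using Fin.addCases <;> simp

end OmegaPresentation

/-! ### Decidability of the theory -/

open Function BuchiAutomaton

namespace FOC

variable {r : ℕ} {ar : Fin r → ℕ} {n : ℕ}

/-- The number is the code of a formula with `n` free variables. -/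
def IsCode (ar : Fin r → ℕ) (n c : ℕ) : Prop := ∃ φ : FOC ar n, φ.code = c

theorem not_isCode_zero : ¬ IsCode ar n 0 := by
  rintro ⟨φ, h⟩
  cases φ <;> simp [code] at h

theorem not_isCode {t : ℕ} (ht : 9 ≤ t) (a : ℕ) : ¬ IsCode ar n (Nat.pair t a + 1) := by
  rintro ⟨φ, h⟩
  cases φ <;> simp [code] at h <;> omega

theorem isCode_falsum {a : ℕ} : IsCode ar n (Nat.pair 0 a + 1) ↔ a = 0 := by
  constructor
  · rintro ⟨φ, h⟩
    cases φ <;> simp [code] at h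
    exact h.symm
  · rintro rfl
    exact ⟨falsum, rfl⟩

theorem isCode_equal {i j : ℕ} : IsCode ar n (Nat.pair 1 (Nat.pair i j) + 1) ↔ i < n ∧ j < n := by
  constructor
  · rintro ⟨φ, h⟩
    cases φ <;> simp [code] at h
    obtain ⟨rfl, rfl⟩ := h
    exact ⟨Fin.is_lt _, Fin.is_lt _⟩
  · rintro ⟨hi, hj⟩
    exact ⟨equal ⟨i, hi⟩ ⟨j, hj⟩, rfl⟩

theorem isCode_rel {i : ℕ} {l : List ℕ} :
    IsCode ar n (Nat.pair 2 (Nat.pair i (Encodable.encode l)) + 1) ↔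
      i < r ∧ l.length = (List.ofFn ar).getD i 0 ∧ ∀ x ∈ l, x < n := by
  constructor
  · rintro ⟨φ, h⟩
    cases φ <;> simp [code] at h
    obtain ⟨rfl, rfl⟩ := h
    refine ⟨Fin.is_lt _, by simp, fun x hx => ?_⟩
    obtain ⟨j, rfl⟩ := List.mem_ofFn.1 hx
    exact Fin.is_lt _
  · rintro ⟨hi, hl, hx⟩
    have hl' : l.length = ar ⟨i, hi⟩ := by simpa [hi] using hl
    refine ⟨rel ⟨i, hi⟩ fun j => ⟨l[j], hx _ (List.getElem_mem _)⟩, ?_⟩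
    simp only [code]
    congr 4
    exact List.ext_getElem (by simp [hl']) fun t h1 h2 => by simp

theorem isCode_imp {a b : ℕ} :
    IsCode ar n (Nat.pair 3 (Nat.pair a b) + 1) ↔ IsCode ar n a ∧ IsCode ar n b := by
  constructor
  · rintro ⟨φ, h⟩
    cases φ <;> simp [code] at h
    exact ⟨⟨_, h.1⟩, ⟨_, h.2⟩⟩
  · rintro ⟨⟨φ, rfl⟩, ψ, rfl⟩
    exact ⟨imp φ ψ, rfl⟩

theorem isCode_quantifier {t : ℕ} (ht : t = 4 ∨ t = 6 ∨ t = 7 ∨ t = 8) {a : ℕ} :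
    IsCode ar n (Nat.pair t a + 1) ↔ IsCode ar (n + 1) a := by
  constructor
  · rintro ⟨φ, h⟩
    rcases ht with rfl | rfl | rfl | rfl <;> cases φ <;> simp [code] at h <;> exact ⟨_, h⟩
  · rintro ⟨φ, rfl⟩
    rcases ht with rfl | rfl | rfl | rfl
    exacts [⟨all φ, rfl⟩, ⟨exInf φ, rfl⟩, ⟨exCountable φ, rfl⟩, ⟨exUncountable φ, rfl⟩]

theorem isCode_exMod {k m a : ℕ} :
    IsCode ar n (Nat.pair 5 (Nat.pair k (Nat.pair m a)) + 1) ↔ 0 < m ∧ IsCode ar (n + 1) a := by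
  constructor
  · rintro ⟨φ, h⟩
    cases φ <;> simp [code] at h
    obtain ⟨-, rfl, h⟩ := h
    exact ⟨by assumption, _, h⟩
  · rintro ⟨hm, φ, rfl⟩
    exact ⟨exMod k m hm φ, rfl⟩

/-- The rule that determines whether `c` is the code of a formula with `n` free variables. -/
def CodeRule (x : (ℕ × List ℕ) × (ℕ × ℕ × Bool) × (ℕ × ℕ × Bool) × ℕ × ℕ × Bool) : Prop :=
  (x.2.2.2.2.1 = 0 ∧ x.2.2.2.2.2 = false) ∨
  (∃ i : ℕ × ℕ, x.2.2.2.2.1 = Nat.pair i.1 i.2 + 1 ∧ 9 ≤ i.1 ∧ x.2.2.2.2.2 = false) ∨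
  (∃ i : ℕ, x.2.2.2.2.1 = Nat.pair 0 i + 1 ∧ (x.2.2.2.2.2 = true ↔ i = 0)) ∨
  (∃ i : ℕ × ℕ, x.2.2.2.2.1 = Nat.pair 1 (Nat.pair i.1 i.2) + 1 ∧
    (x.2.2.2.2.2 = true ↔ i.1 < x.2.2.2.1 ∧ i.2 < x.2.2.2.1)) ∨
  (∃ i : ℕ × List ℕ, x.2.2.2.2.1 = Nat.pair 2 (Nat.pair i.1 (Encodable.encode i.2)) + 1 ∧
    (x.2.2.2.2.2 = true ↔
      i.1 < x.1.1 ∧ i.2.length = x.1.2.getD i.1 0 ∧ ∀ j ∈ i.2, j < x.2.2.2.1)) ∨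
  (x.2.1.1 = x.2.2.2.1 ∧ x.2.2.1.1 = x.2.2.2.1 ∧
    x.2.2.2.2.1 = Nat.pair 3 (Nat.pair x.2.1.2.1 x.2.2.1.2.1) + 1 ∧
    (x.2.2.2.2.2 = true ↔ x.2.1.2.2 = true ∧ x.2.2.1.2.2 = true)) ∨
  (∃ t : ℕ, (t = 4 ∨ t = 6 ∨ t = 7 ∨ t = 8) ∧ x.2.1.1 = x.2.2.2.1 + 1 ∧
    x.2.2.2.2.1 = Nat.pair t x.2.1.2.1 + 1 ∧ (x.2.2.2.2.2 = true ↔ x.2.1.2.2 = true)) ∨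
  (∃ i : ℕ × ℕ, x.2.1.1 = x.2.2.2.1 + 1 ∧
    x.2.2.2.2.1 = Nat.pair 5 (Nat.pair i.1 (Nat.pair i.2 x.2.1.2.1)) + 1 ∧
    (x.2.2.2.2.2 = true ↔ 0 < i.2 ∧ x.2.1.2.2 = true))

theorem sig1_codeRule : Sig1 CodeRule :=
  .or (.of_primrecPred (by fun_prop)) <| .or (.ex (.of_primrecPred (by fun_prop))) <|
  .or (.ex (.of_primrecPred (by fun_prop))) <| .or (.ex (.of_primrecPred (by fun_prop))) <|
  .or (.ex (.of_primrecPred (by fun_prop))) <| .or (.of_primrecPred (by fun_prop)) <|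
  .or (.ex (.of_primrecPred (by fun_prop))) (.ex (.of_primrecPred (by fun_prop)))

/-- In the rules with premises, the relevant codes get smaller; strong induction on the code
therefore works although derivations may be circular. -/
theorem isCode_of_derivable (ar : Fin r → ℕ) {c : ℕ} : ∀ {n : ℕ} {b : Bool},
    Derivable CodeRule ((r, List.ofFn ar), n, c, b) → (b = true ↔ IsCode ar n c) := by
  induction c using Nat.strong_induction_on with
  | _ c ih =>
  intro n b h
  obtain ⟨⟨n₁, c₁, b₁⟩, ⟨n₂, c₂, b₂⟩, h₁, h₂, hr⟩ := h.cases
  simp only [CodeRule] at hr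
  have ht : ∀ t a, a < Nat.pair t a + 1 := fun t a => Nat.lt_succ_of_le (Nat.right_le_pair t a)
  rcases hr with ⟨rfl, rfl⟩ | ⟨⟨t, a⟩, rfl, hi, rfl⟩ | ⟨i, rfl, hb⟩ | ⟨⟨i, j⟩, rfl, hb⟩ |
    ⟨⟨i, l⟩, rfl, hb⟩ | ⟨rfl, rfl, rfl, hb⟩ | ⟨t, hi, rfl, rfl, hb⟩ | ⟨⟨k, m⟩, rfl, rfl, hb⟩
  · simp [not_isCode_zero]
  · simp [not_isCode hi]
  · rw [hb, isCode_falsum]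
  · rw [hb, isCode_equal]
  · rw [hb, isCode_rel]
  · rw [hb, isCode_imp, ih c₁ ((Nat.left_le_pair c₁ c₂).trans_lt (ht _ _)) h₁,
      ih c₂ ((Nat.right_le_pair c₁ c₂).trans_lt (ht _ _)) h₂]
  · rw [hb, isCode_quantifier hi, ih c₁ (ht _ _) h₁]
  · rw [hb, isCode_exMod, ih c₁ (((Nat.right_le_pair m c₁).trans
      (Nat.right_le_pair k _)).trans_lt (ht _ _)) h₁]

/-- Completeness of the rules: every number is decided. Together with soundness this makes non-codes
enumerable, which the complement of the theory requires. -/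
theorem exists_derivable (a : ℕ × List ℕ) (c : ℕ) :
    ∀ n, ∃ b, Derivable CodeRule (a, n, c, b) := by
  have hbool : ∀ p : Prop, ∃ b : Bool, (b = true ↔ p) := fun p => by
    classical exact ⟨decide p, by simp⟩
  have ht : ∀ t a, a < Nat.pair t a + 1 := fun t a => Nat.lt_succ_of_le (Nat.right_le_pair t a)
  induction c using Nat.strong_induction_on with
  | _ c ih =>
  intro n
  rcases c with - | c
  · exact ⟨false, .intro₀ (Or.inl ⟨rfl, rfl⟩)⟩
  obtain ⟨t, c, rfl⟩ : ∃ t a, c = Nat.pair t a := ⟨_, _, (Nat.pair_unpair c).symm⟩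
  by_cases h : 9 ≤ t
  · exact ⟨false, .intro₀ (Or.inr (Or.inl ⟨(t, c), rfl, h, rfl⟩))⟩
  by_cases hq : t = 4 ∨ t = 6 ∨ t = 7 ∨ t = 8
  · obtain ⟨b, hb⟩ := ih c (ht _ _) (n + 1)
    exact ⟨b, hb.intro₁ (by
      iterate 6 (apply Or.inr)
      exact Or.inl ⟨t, hq, rfl, rfl, Iff.rfl⟩)⟩
  obtain ⟨i, c', rfl⟩ : ∃ t a, c = Nat.pair t a := ⟨_, _, (Nat.pair_unpair c).symm⟩
  obtain rfl | rfl | rfl | rfl | rfl : t = 0 ∨ t = 1 ∨ t = 2 ∨ t = 3 ∨ t = 5 := by omega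
  · obtain ⟨b, hb⟩ := hbool (Nat.pair i c' = 0)
    exact ⟨b, .intro₀ (Or.inr (Or.inr (Or.inl ⟨_, rfl, hb⟩)))⟩
  · obtain ⟨b, hb⟩ := hbool (i < n ∧ c' < n)
    exact ⟨b, .intro₀ (Or.inr (Or.inr (Or.inr (Or.inl ⟨(i, c'), rfl, hb⟩))))⟩
  -- Every number codes a list, so no malformed case remains for relation symbols.
  · obtain ⟨l, rfl⟩ : ∃ l : List ℕ, c' = Encodable.encode l :=
      ⟨Denumerable.ofNat _ c', (Denumerable.encode_ofNat c').symm⟩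
    obtain ⟨b, hb⟩ := hbool (i < a.1 ∧ l.length = a.2.getD i 0 ∧ ∀ j ∈ l, j < n)
    exact ⟨b, .intro₀ (Or.inr (Or.inr (Or.inr (Or.inr (Or.inl ⟨(i, l), rfl, hb⟩)))))⟩
  · obtain ⟨b₁, h₁⟩ := ih i ((Nat.left_le_pair i c').trans_lt (ht _ _)) n
    obtain ⟨b₂, h₂⟩ := ih c' ((Nat.right_le_pair i c').trans_lt (ht _ _)) n
    exact ⟨b₁ && b₂, h₁.intro h₂ (by
      iterate 5 (apply Or.inr)
      exact Or.inl ⟨rfl, rfl, rfl, by simp⟩)⟩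
  · obtain ⟨m, c, rfl⟩ : ∃ t a, c' = Nat.pair t a := ⟨_, _, (Nat.pair_unpair c').symm⟩
    obtain ⟨b₁, h₁⟩ := ih c (((Nat.right_le_pair m c).trans
      (Nat.right_le_pair i _)).trans_lt (ht _ _)) (n + 1)
    obtain ⟨b, hb⟩ := hbool (0 < m ∧ b₁ = true)
    exact ⟨b, h₁.intro₁ (by
      iterate 7 (apply Or.inr)
      exact ⟨(i, m), rfl, rfl, hb⟩)⟩

end FOC

/-- Without tracks there is only one environment, so acceptance and rejection are both validity
statements, to which `ER.sig1_forall` applies. -/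
theorem BuchiAutomaton.sig1_accepts_nil (p : Prop) :
    Sig1 fun M : BuchiAutomaton => (M.AcceptsWord fun _ => []) ↔ p := by
  have h1 := ER.at_ (α := BuchiAutomaton) (S := fun _ => 0) (n := fun _ => 0) (M := fun M => M)
    (ρ := fun _ => []) (by fun_prop) (by fun_prop) (by fun_prop) (by fun_prop)
  have h0 : InEnv 0 0 fun _ _ => 0 := fun i => ⟨fun t ht => absurd ht (Nat.not_lt_zero t),
    fun _ _ => rfl⟩
  by_cases hp : p
  · exact (h1.sig1_forall (by fun_prop) (by fun_prop)).of_eq fun M =>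
      ⟨fun h => iff_of_true (h _ h0) hp, fun h v _ => h.2 hp⟩
  · exact ((h1.not (by fun_prop) (by fun_prop)).sig1_forall (by fun_prop) (by fun_prop)).of_eq
      fun M => ⟨fun h => iff_of_false (h _ h0) hp, fun h v _ => fun hv => hp (h.1 hv)⟩

/-- The theory of an ω-automatic structure is decidable. -/
theorem IsOmegaAutomatic.computablePred {A : Type*} {r : ℕ} {ar : Fin r → ℕ}
    {R : RelStructure ar A} (h : IsOmegaAutomatic R) :
    ComputablePred fun c : ℕ => ∃ φ : FOC ar 0, φ.code = c ∧ φ.Realize R Fin.elim0 := by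
  obtain ⟨d, f, h⟩ := h
  obtain ⟨D, hD, hφ⟩ := OmegaPresentation.exists_derivation
  have hcode := fun c => (FOC.exists_derivable (r, List.ofFn ar) c 0)
  have hsound := fun c b => FOC.isCode_of_derivable ar (c := c) (n := 0) (b := b)
  have hwf : ∀ b : Bool, Sig1 fun c : ℕ =>
      Derivable FOC.CodeRule ((r, List.ofFn ar), 0, c, b) := fun b =>
    (Derivable.sig1 FOC.sig1_codeRule).comp (by fun_prop)
  have hacc : ∀ p : Prop, Sig1 fun c : ℕ => ∃ M, D (d.data, 0, c, M) ∧
      ((M.AcceptsWord fun _ => []) ↔ p) := fun p =>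
    .ex (.and (hD.comp (by fun_prop)) ((sig1_accepts_nil p).comp (by fun_prop)))
  have key : ∀ (φ : FOC ar 0) (p : Prop), (∃ M, D (d.data, 0, φ.code, M) ∧
      ((M.AcceptsWord fun _ => []) ↔ p)) ↔ (φ.Realize R Fin.elim0 ↔ p) := fun φ p => by
    have h1 : ∀ M, D (d.data, 0, φ.code, M) →
        ((M.AcceptsWord fun _ => []) ↔ φ.Realize R Fin.elim0) := fun M hM => by
      have h2 := (hφ h φ).2 M hM Fin.elim0
      rw [Subsingleton.elim (fun j => f (Fin.elim0 j)) Fin.elim0] at h2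
      simpa [Accepts, AcceptsWord] using h2
    constructor
    · rintro ⟨M, hM, hp⟩
      rw [← h1 M hM, hp]
    · intro hp
      obtain ⟨M, hM⟩ := (hφ h φ).1
      exact ⟨M, hM, by rw [h1 M hM, hp]⟩
  -- Post's theorem. A number outside the set of true sentences is not the code of a sentence, or it
  -- is one whose automaton rejects.
  refine ComputablePred.computable_iff_re_compl_re'.2 ⟨?_, ?_⟩
  · refine (((hwf true).and (hacc True)).of_eq fun c => ?_).rePred
    constructor
    · rintro ⟨hc, ht⟩
      obtain ⟨φ, rfl⟩ := (hsound c true hc).1 rfl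
      exact ⟨φ, rfl, ((key φ True).1 ht).2 trivial⟩
    · rintro ⟨φ, rfl, ht⟩
      obtain ⟨b, hb⟩ := hcode φ.code
      obtain rfl := (hsound _ _ hb).2 ⟨φ, rfl⟩
      exact ⟨hb, (key φ True).2 (iff_true_intro ht)⟩
  · refine (((hwf false).or ((hwf true).and (hacc False))).of_eq fun c => ?_).rePred
    constructor
    · rintro (hc | ⟨hc, ht⟩) ⟨φ, rfl, hR⟩
      · exact Bool.false_ne_true ((hsound _ _ hc).2 ⟨φ, rfl⟩)
      · exact ((key φ False).1 ht).1 hR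
    · intro hn
      obtain ⟨b, hb⟩ := hcode c
      cases b
      · exact Or.inl hb
      · obtain ⟨φ, rfl⟩ := (hsound c true hb).1 rfl
        exact Or.inr ⟨hb, (key φ False).2 (iff_false_intro fun hR => hn ⟨φ, rfl, hR⟩)⟩

/-! ### Interpretations -/

open Function BuchiAutomaton

/-- The relation on infinite words is saturated. -/
def SatOn {s n : ℕ} (Q : (Fin n → OmegaWord s) → Prop) : Prop :=
  ∃ P : Env → Prop, Sat P ∧ ∀ w, P (toEnv w) ↔ Q w

namespace SatOn

variable {s n : ℕ} {Q Q' : (Fin n → OmegaWord s) → Prop}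

theorem exists_automaton (h : SatOn Q) : ∃ M : BuchiAutomaton, ∀ w, M.Accepts w ↔ Q w := by
  obtain ⟨P, hP, hQ⟩ := h
  obtain ⟨M, hM⟩ := hP.exists_automaton s n
  refine ⟨M, fun w => ?_⟩
  rw [accepts_iff_on, ← hQ, ← hM _ (inEnv_toEnv w le_rfl)]
  simp [On, At]

theorem and (h : SatOn Q) (h' : SatOn Q') : SatOn fun w => Q w ∧ Q' w := by
  obtain ⟨P, hP, hQ⟩ := h
  obtain ⟨P', hP', hQ'⟩ := h'
  exact ⟨_, hP.and hP', fun w => and_congr (hQ w) (hQ' w)⟩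

theorem forall_fin {m : ℕ} {Q : Fin m → (Fin n → OmegaWord s) → Prop} (h : ∀ i, SatOn (Q i)) :
    SatOn fun w => ∀ i, Q i w := by
  choose P hP hQ using h
  exact ⟨_, Sat.forall_finite hP, fun w => forall_congr' fun i => hQ i w⟩

end SatOn

/-- The `j`-th component of a word over an alphabet of tuples. -/
def OmegaWord.component {s k : ℕ} (w : OmegaWord (s ^ k)) (j : Fin k) : OmegaWord s :=
  fun i => finFunctionFinEquiv.symm (w i) j

namespace OmegaPresentation

variable {ι A : Type*} {ar : ι → ℕ} {d : OmegaPresentation ι} {R : RelStructure ar A}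
  {f : d.Dom → A}

/-- The formula, evaluated at elements that are named by components of words. -/
def SatAt (R : RelStructure ar A) (f : d.Dom → A) {N n k : ℕ} (φ : FOC ar N)
    (e : Fin N → Fin n × Fin k) (w : Fin n → OmegaWord (d.alphabet ^ k)) : Prop :=
  ∃ h : ∀ t, d.dom.Accepts ![(w (e t).1).component (e t).2],
    φ.Realize R fun t => f ⟨_, h t⟩

/-- A letter of the product alphabet is a tuple written in base `d.alphabet`. Taking a component is
extraction of a digit, hence a letter-to-letter map, and `Sat.comap` applies. -/
theorem satOn_satAt (h : d.Presents R f) {N n k : ℕ} (φ : FOC ar N)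
    (e : Fin N → Fin n × Fin k) : SatOn (SatAt R f φ e) := by
  obtain ⟨M, hM⟩ := exists_spec h φ
  let g : (ℕ → ℕ) → ℕ → ℕ := fun c t =>
    if h : t < N then c (e ⟨t, h⟩).1 / d.alphabet ^ ((e ⟨t, h⟩).2 : ℕ) % d.alphabet else 0
  refine ⟨_, Sat.comap (Sat.and (Sat.forall_finite fun t : Fin N => sat_at d.dom [(t : ℕ)])
    (sat_at M (List.range N))) g, fun w => ?_⟩
  let z : Fin N → OmegaWord d.alphabet := fun t => (w (e t).1).component (e t).2
  have hz : (fun t i => g ((toEnv w).col i) t) = toEnv z := by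
    funext t i
    by_cases ht : t < N
    · simp [g, z, ht, toEnv, Env.col, OmegaWord.component, finFunctionFinEquiv]
    · simp [g, ht, toEnv]
  have e1 : M.At (List.range N) (toEnv z) ↔ M.Accepts z := by
    rw [accepts_iff_on]
    simp [On, At]
  have e2 : ∀ j : Fin N, d.dom.At [(j : ℕ)] (toEnv z) ↔ d.dom.Accepts ![z j] := fun j => by
    rw [accepts_one_iff]
    simp [At, Env.col, toEnv]
  rw [hz, e1, forall_congr' e2, ← exists_prop]
  exact exists_congr fun hd => hM fun t => ⟨z t, hd t⟩

end OmegaPresentation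

namespace FOCInterpretation

variable {ι κ A B : Type*} {ar : ι → ℕ} {br : κ → ℕ} {I : FOCInterpretation ar br}
  {R : RelStructure ar A} {S : RelStructure br B} {d : OmegaPresentation ι} {f : d.Dom → A}

/-- An element of the interpreted structure is named by the convolution of names of the entries of a
tuple satisfying `I.dom`. The automata for equality and relations also test that all arguments are
such names. -/
theorem Interprets.exists_presents (hI : I.Interprets R S) (h : d.Presents R f) :
    ∃ (d' : OmegaPresentation κ) (f' : d'.Dom → B), d'.Presents S f' ∧
      (d.IsFiniteWord → d'.IsFiniteWord) := by
  obtain ⟨g, hg, heqv, hrel⟩ := hI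
  have hdom := fun (n : ℕ) (i : Fin n) =>
    OmegaPresentation.satOn_satAt h I.dom fun j => (i, j)
  obtain ⟨Md, hMd⟩ := (hdom 1 0).exists_automaton
  obtain ⟨Me, hMe⟩ := ((SatOn.forall_fin (hdom 2)).and (OmegaPresentation.satOn_satAt h I.eqv
    (Fin.append (fun j => ((0 : Fin 2), j)) fun j => (1, j)))).exists_automaton
  choose Mr hMr using fun i => ((SatOn.forall_fin (hdom (br i))).and
    (OmegaPresentation.satOn_satAt h (I.rel i) fun j => (j.divNat, j.modNat))).exists_automaton
  have hDom : ∀ w : OmegaWord (d.alphabet ^ I.dim), Md.Accepts ![w] ↔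
      ∃ h : ∀ j, d.dom.Accepts ![w.component j], I.dom.Realize R fun j => f ⟨_, h j⟩ :=
    fun w => hMd ![w]
  let el : ∀ w : OmegaWord (d.alphabet ^ I.dim), Md.Accepts ![w] →
      {x : Fin I.dim → A // I.dom.Realize R x} := fun w hw =>
    ⟨fun j => f ⟨w.component j, ((hDom w).1 hw).1 j⟩, ((hDom w).1 hw).2⟩
  refine ⟨⟨d.alphabet ^ I.dim, Md, Me, Mr⟩, fun w => g (el w.1 w.2), ⟨?_, ?_, ?_⟩, ?_⟩
  · intro b
    obtain ⟨⟨x, hx⟩, rfl⟩ := hg b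
    choose y hy using fun j => h.surjective (x j)
    let w : OmegaWord (d.alphabet ^ I.dim) := fun i => finFunctionFinEquiv fun j => (y j).1 i
    have hw : ∀ j, w.component j = (y j).1 := fun j => by
      funext i
      simp [w, OmegaWord.component]
    have hd : ∀ j, d.dom.Accepts ![w.component j] := fun j => by
      rw [hw]
      exact (y j).2
    have hf : (fun j => f ⟨w.component j, hd j⟩) = x := by
      funext j
      rw [← hy j]
      congr 1
      exact Subtype.ext (hw j)
    refine ⟨⟨w, (hDom w).2 ⟨hd, by rwa [hf]⟩⟩, ?_⟩
    exact congrArg g (Subtype.ext hf)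
  · intro u w
    refine (hMe ![u, w]).trans ?_
    have e1 : (∀ i : Fin 2, OmegaPresentation.SatAt R f I.dom (fun j => (i, j)) ![u, w]) ↔
        Md.Accepts ![u] ∧ Md.Accepts ![w] := by
      rw [Fin.forall_fin_two, hDom, hDom]
      rfl
    rw [e1, and_assoc, ← exists_prop]
    refine exists_congr fun hu => ?_
    rw [← exists_prop]
    refine exists_congr fun hw => ?_
    rw [← heqv]
    have hd : ∀ t, d.dom.Accepts ![(![u, w] (Fin.append (fun j : Fin I.dim => ((0 : Fin 2), j))
        (fun j => (1, j)) t).1).component (Fin.append (fun j : Fin I.dim => ((0 : Fin 2), j))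
        (fun j => (1, j)) t).2] := fun t => by
      induction t using Fin.addCases with
      | left j =>
        rw [Fin.append_left]
        exact ((hDom u).1 hu).1 j
      | right j =>
        rw [Fin.append_right]
        exact ((hDom w).1 hw).1 j
    have hr : (fun t => f ⟨_, hd t⟩) = Fin.append (el u hu).1 (el w hw).1 := by
      funext t
      induction t using Fin.addCases with
      | left j =>
        refine (congrArg f (Subtype.ext ?_)).trans (Fin.append_left (el u hu).1 (el w hw).1 j).symm
        exact congrArg (fun p : Fin 2 × Fin I.dim => (![u, w] p.1).component p.2)
          (Fin.append_left _ _ j)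
      | right j =>
        refine (congrArg f (Subtype.ext ?_)).trans (Fin.append_right (el u hu).1 (el w hw).1 j).symm
        exact congrArg (fun p : Fin 2 × Fin I.dim => (![u, w] p.1).component p.2)
          (Fin.append_right _ _ j)
    rw [← hr]
    exact ⟨fun h => h.2, fun h => ⟨hd, h⟩⟩
  · intro i w
    refine (hMr i w).trans ?_
    have e1 : (∀ t, OmegaPresentation.SatAt R f I.dom (fun j => (t, j)) w) ↔
        ∀ t, Md.Accepts ![w t] := forall_congr' fun t => (hDom (w t)).symm
    rw [e1, ← exists_prop]
    refine exists_congr fun hw => ?_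
    rw [← hrel i fun t => el (w t) (hw t)]
    exact ⟨fun h => h.2, fun h => ⟨fun t => ((hDom _).1 (hw _)).1 _, h⟩⟩
  · rintro ⟨pad, hpad⟩
    refine ⟨finFunctionFinEquiv fun _ => pad, fun w => ?_⟩
    choose n hn hn' using fun j => hpad ⟨w.1.component j, ((hDom w.1).1 w.2).1 j⟩
    -- The convolution is padded from the latest end of its components on; before that, some
    -- component is not yet padded, so the tuple is not the padding tuple. In dimension `0` the
    -- supremum is `0`.
    refine ⟨Finset.univ.sup n, fun i hi e => ?_, fun i hi => ?_⟩
    · obtain ⟨j, -, hj⟩ := Finset.lt_sup_iff.1 hi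
      refine hn j i hj ?_
      simp [OmegaWord.component, e]
    · rw [← Equiv.symm_apply_eq]
      funext j
      exact hn' j i ((Finset.le_sup (Finset.mem_univ j)).trans hi)

end FOCInterpretation

theorem theorem2 :
    -- (i) FOC-definable relations are effectively ω-regular
    (∃ F : (ℕ × BuchiAutomaton × BuchiAutomaton × List BuchiAutomaton) ×
          (ℕ × ℕ) × List (List ℕ × List ℕ) →. BuchiAutomaton,
      Partrec F ∧
      ∀ {A : Type*} {r : ℕ} {ar : Fin r → ℕ} (R : RelStructure ar A)
        (d : OmegaPresentation (Fin r)) (f : d.Dom → A), d.Presents R f →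
      ∀ (p k : ℕ) (φ : FOC ar (p + k))
        (u v : Fin p → List (Fin d.alphabet)) (hv : ∀ j, v j ≠ [])
        (hp : ∀ j, d.dom.Accepts ![upWord (u j) (v j) (hv j)]),
      ∃ M : BuchiAutomaton,
        M ∈ F (d.data, (k, φ.code),
          List.ofFn fun j => ((u j).map Fin.val, (v j).map Fin.val)) ∧
        ∀ w : Fin k → OmegaWord d.alphabet, M.Accepts w ↔
          ∃ h : ∀ j, d.dom.Accepts ![w j],
            φ.Realize R (Fin.append (fun j => f ⟨upWord (u j) (v j) (hv j), hp j⟩)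
              (fun j => f ⟨w j, h j⟩))) ∧
    -- (ii) the FOC-theory of every ω-automatic structure is decidable
    (∀ {A : Type*} {r : ℕ} {ar : Fin r → ℕ} (R : RelStructure ar A), IsOmegaAutomatic R →
      ComputablePred fun c : ℕ => ∃ φ : FOC ar 0, φ.code = c ∧ φ.Realize R Fin.elim0) ∧
    -- (iii) the classes of ω-automatic and of automatic structures are closed under
    -- FOC-interpretations
    (∀ {ι κ A B : Type*} {ar : ι → ℕ} {br : κ → ℕ} (I : FOCInterpretation ar br)
      (R : RelStructure ar A) (S : RelStructure br B), I.Interprets R S →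
      (IsOmegaAutomatic R → IsOmegaAutomatic S) ∧ (IsAutomatic R → IsAutomatic S)) := by
  refine ⟨OmegaPresentation.exists_partrec_automaton, fun R h => h.computablePred,
    fun I R S hI => ⟨?_, ?_⟩⟩
  · rintro ⟨d, f, h⟩
    obtain ⟨d', f', h', -⟩ := hI.exists_presents h
    exact ⟨d', f', h'⟩
  · rintro ⟨d, f, h, hw⟩
    obtain ⟨d', f', h', hw'⟩ := hI.exists_presents h
    exact ⟨d', f', h', hw' hw⟩
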